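/- Let $k$ be an algebraically closed field, $X$ and $Z$ smooth projective (integral) curves over $k$, $W$ a finite group and $\pi:Z\to X$ an étale Galois cover with group $W$; we let $W$ act on $Z$ from the left by $\rho$. Let $T$ be a commutative group scheme over $k$ which is affine (for instance a torus) or étale over $k$ (an abstract abelian group), with an action $\sigma:W\to\mathrm{Aut}(T)$. The étale sheaf $\underline T$ of local sections of $T$ on $Z$ is a $W$-equivariant sheaf through the actions of $W$ on $Z$ and on $T$. Let $\Gamma_Z$ be the functor of global sections from $W$-equivariant sheaves of abelian groups on the étale site of $Z$ to $W$-modules, and $\Gamma^W$ the functor of invariants of $W$-modules. Write $H^q(Z,T)=R^q\Gamma_Z(\underline T)$, which is a $W$-module, and $H^n(Z;W;T)=R^n(\Gamma^W\circ\Gamma_Z)(\underline T)$. A $T$-bundle on $Z$ is an étale $\underline T$-torsor. The group $W$ acts on $T$-bundles by $w\cdot E=(w^{-1})^*E\times_w T$ (pull-back along the automorphism $\rho(w)^{-1}$ of $Z$, then extension of the structure group by $\sigma(w)$); $E$ is $W$-invariant if $E\cong w\cdot E$ for all $w\in W$. Its Mumford group $\mathcal G^\sigma(E)$ is the group of pairs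 $(w,\gamma)$ with $w\in W$ and $\gamma:E\to w\cdot E$ an isomorphism of $T$-bundles, with product $(w,\gamma)(v,\delta)=(wv,\,w(\delta)\circ\gamma)$. (1) Assigning to a $T$-bundle its class in $H^1(Z,T)$ induces a bijection from the isomorphism classes of $T$-bundles to $H^1(Z,T)$. It takes the contracted product of bundles to the sum and the bundle $w\cdot E$ to the image of the class of $E$ under $w$. In particular, $W$-invariant $T$-bundles have their classes in $H^1(Z,T)^W$. (2) For a $W$-invariant $T$-bundle $E$ the maps $t\mapsto(1,t)$ and $(w,\gamma)\mapsto w$ form a group extension $$0\to T(k)\to\mathcal G^\sigma(E)\to W\to 0,$$ and $\mathcal G^\sigma(E)$ acts on $T(k)$ by conjugation through $\sigma$. (3) There is a homomorphism of groups $$c:H^1(Z,T)^W\to H^2(W,T(k))$$ which sends the class of each $W$-invariant $T$-bundle $E$ to the class of this extension (the class of the factor set $f$ with $s(w)s(v)=f(w,v)s(wv)$, for a set-theoretic section $s$). (4) The constant sections induce an isomorphism $H^2(W,T(k))\cong H^2(W,H^0(Z,T))$, and with this identification $c$ is the differential $d_2:E_2^{0,1}\to E_2^{2,0}$ of the Grothendieck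 spectral sequence $$E_2^{p,q}=H^p(W,H^q(Z,T))\Rightarrow H^{p+q}(Z;W;T).$$ Explicitly, let $\underline T\to I^\bullet$ be any injective resolution by $W$-equivariant sheaves. Consider the spectral sequence of the double complex $C^p(W,\Gamma_Z(I^q))$ of inhomogeneous cochains of $W$, with total differential $d'+(-1)^pd''$ on bidegree $(p,q)$, where $d'$ is the differential of group cochains and $d''$ that of $I^\bullet$, filtered by $p$. There are isomorphisms $E_2^{p,q}\cong H^p(W,H^q(Z,T))$ for all $p,q\ge 0$, which take the class of a cochain $z$ to the class of the cocycle $g\mapsto[z^{p,q}(g)]$, and with them $c=d_2:E_2^{0,1}\to E_2^{2,0}$. The cohomology of the total complex in degree $n$ is isomorphic to $H^n(Z;W;T)$ for all $n\ge0$, by the map which places an invariant cocycle $y\in\Gamma_Z(I^n)^W$ in bidegree $(0,n)$. -/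

import Mathlib

universe u

open CategoryTheory AlgebraicGeometry Limits Opposite
open scoped MonObj

noncomputable section

namespace EquivariantCurve

variable {S : Scheme.{u}} {Z : Over S} {W : Type (u + 1)} [Group W]

/-- The automorphism of the scheme `Z` by which `w` acts (a left action). -/
def actHom (ρ : W →* Aut Z) (w : W) : Z.left ⟶ Z.left := (ρ w).hom.left

@[simp]
lemma actHom_one (ρ : W →* Aut Z) : actHom ρ 1 = 𝟙 _ := by
  simp only [actHom, map_one]; rfl

lemma actHom_mul (ρ : W →* Aut Z) (w v : W) :
    actHom ρ (w * v) = actHom ρ v ≫ actHom ρ w := by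
  simp only [actHom, map_mul]; rfl

instance isIso_actHom (ρ : W →* Aut Z) (w : W) : IsIso (actHom ρ w) :=
  ((Over.forget S).mapIso (ρ w)).isIso_hom

/-- The site of étale `Z`-schemes, with the morphisms that are compatible with the action of `W`
on `Z`: a morphism `U ⟶ V` is an element `w` of `W` with a morphism of schemes that lies over the
automorphism `w` of `Z`. Sheaves on this site are the same as sheaves `F` on the small étale site
of `Z` with an action of `W`, that is, with isomorphisms `F → w^* F` for `w` in `W` that satisfy the
cocycle condition: the sections of `w^* F` over `U → Z` are those of `F` over `U → Z → Z`. -/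
structure QuotSite (ρ : W →* Aut Z) : Type (u + 1) where
  left : Scheme.{u}
  hom : left ⟶ Z.left
  [etale : Etale hom]

namespace QuotSite

attribute [instance] QuotSite.etale

variable {ρ : W →* Aut Z}

/-- Morphisms in `QuotSite ρ`. -/
@[ext]
structure Hom (U V : QuotSite ρ) : Type (u + 1) where
  weight : W
  map : U.left ⟶ V.left
  comm : map ≫ V.hom = U.hom ≫ actHom ρ weight

instance : Category.{u + 1} (QuotSite ρ) where
  Hom := Hom
  id U := ⟨1, 𝟙 _, by simp⟩
  comp f g := ⟨g.weight * f.weight, f.map ≫ g.map, by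
    rw [Category.assoc, g.comm, ← Category.assoc, f.comm, actHom_mul, Category.assoc]⟩
  id_comp f := Hom.ext (mul_one _) (Category.id_comp _)
  comp_id f := Hom.ext (one_mul _) (Category.comp_id _)
  assoc f g h := Hom.ext (mul_assoc _ _ _).symm (Category.assoc _ _ _)

@[ext]
lemma hom_ext {U V : QuotSite ρ} {f g : U ⟶ V} (h₁ : f.weight = g.weight) (h₂ : f.map = g.map) :
    f = g := Hom.ext h₁ h₂

@[simp] lemma id_weight (U : QuotSite ρ) : Hom.weight (𝟙 U) = 1 := rfl
@[simp] lemma id_map (U : QuotSite ρ) : Hom.map (𝟙 U) = 𝟙 _ := rfl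
@[simp] lemma comp_weight {U V Y : QuotSite ρ} (f : U ⟶ V) (g : V ⟶ Y) :
    (f ≫ g).weight = g.weight * f.weight := rfl
@[simp] lemma comp_map {U V Y : QuotSite ρ} (f : U ⟶ V) (g : V ⟶ Y) :
    (f ≫ g).map = f.map ≫ g.map := rfl

variable (ρ) in
/-- The small étale site of `Z`: the same objects, with the morphisms over `Z`. -/
def incl : Z.left.Etale ⥤ QuotSite ρ where
  obj U := ⟨U.left, U.hom⟩
  map {U V} f := ⟨1, f.left, by
    have h := Over.w ((Scheme.Etale.forget _).map f)
    rw [actHom_one, Category.comp_id]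
    exact h⟩
  map_id U := hom_ext rfl rfl
  map_comp f g := hom_ext (one_mul (1 : W)).symm rfl

instance etale_map {U V : QuotSite ρ} (f : U ⟶ V) : Etale f.map := by
  have : Etale (f.map ≫ V.hom) := by rw [f.comm]; infer_instance
  exact Etale.of_comp f.map V.hom

/-- Fibre products exist in `QuotSite ρ` and are those of schemes. -/
lemma exists_pullback {U V Y : QuotSite ρ} (f : U ⟶ V) (g : Y ⟶ V) :
    ∃ (P : QuotSite ρ) (a : P ⟶ U) (b : P ⟶ Y), a ≫ f = b ≫ g ∧
      a.weight = 1 ∧ IsPullback a.map b.map f.map g.map := by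
  have h2 : Y.hom = g.map ≫ V.hom ≫ actHom ρ g.weight⁻¹ := by
    rw [← Category.assoc, g.comm, Category.assoc, ← actHom_mul, inv_mul_cancel, actHom_one,
      Category.comp_id]
  let P : QuotSite ρ := ⟨pullback f.map g.map, pullback.fst f.map g.map ≫ U.hom⟩
  let a : P ⟶ U := ⟨1, pullback.fst f.map g.map, by simp [P]⟩
  let b : P ⟶ Y := ⟨g.weight⁻¹ * f.weight, pullback.snd f.map g.map, by
    rw [h2, actHom_mul, ← Category.assoc, ← pullback.condition, Category.assoc, ← Category.assoc f.map,
      f.comm]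
    simp [P]⟩
  exact ⟨P, a, b, hom_ext (by simp [a, b]) pullback.condition, rfl, IsPullback.of_hasPullback _ _⟩

variable (ρ) in
/-- The étale topology: covering sieves are those that contain a jointly surjective family. -/
def topology : GrothendieckTopology (QuotSite ρ) where
  sieves U := {R | ∀ x : U.left, ∃ (V : QuotSite ρ) (f : V ⟶ U), R f ∧ x ∈ Set.range f.map}
  top_mem' U x := ⟨U, 𝟙 U, trivial, x, by simp⟩
  pullback_stable' U V R f hR y := by
    obtain ⟨Y, g, hg, z, hz⟩ := hR (f.map y)
    obtain ⟨P, a, b, hab, -, hP⟩ := exists_pullback f g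
    obtain ⟨p, hp, -⟩ := Scheme.exists_preimage_of_isPullback hP y z hz.symm
    refine ⟨P, a, ?_, p, hp⟩
    change R (a ≫ f)
    rw [hab]
    exact R.downward_closed hg b
  transitive' U R hR R' h x := by
    obtain ⟨V, f, hf, y, rfl⟩ := hR x
    obtain ⟨Y, g, hg, z, rfl⟩ := h hf y
    exact ⟨Y, g ≫ f, hg, z, by simp⟩

end QuotSite


namespace QuotSite

variable {ρ : W →* Aut Z}

variable (ρ) in
/-- An étale `Z`-scheme, viewed as a scheme over the base. -/
def toOver : QuotSite ρ ⥤ Over S where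
  obj U := Over.mk (U.hom ≫ Z.hom)
  map {U V} f := Over.homMk f.map (by
    have h : actHom ρ f.weight ≫ Z.hom = Z.hom := Over.w _
    simp only [Over.mk_left, Over.mk_hom]
    rw [← Category.assoc, f.comm, Category.assoc, h])

end QuotSite

section Coefficients

variable {T : CommGrp (Over S)}

/-- The automorphism of the group scheme `T` by which `w` acts. -/
def autHom (σ : W →* Aut T) (w : W) : T.X ⟶ T.X := (σ w).hom.hom.hom.hom

instance (σ : W →* Aut T) (w : W) : IsMonHom (autHom σ w) :=
  inferInstanceAs (IsMonHom (σ w).hom.hom.hom.hom)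

@[simp]
lemma autHom_one (σ : W →* Aut T) : autHom σ 1 = 𝟙 _ := by
  simp only [autHom, map_one]; rfl

lemma autHom_mul (σ : W →* Aut T) (w v : W) :
    autHom σ (w * v) = autHom σ v ≫ autHom σ w := by
  simp only [autHom, map_mul]; rfl

variable (ρ : W →* Aut Z) (σ : W →* Aut T)

/-- The presheaf `U ↦ T(U)`. A morphism `f` over the automorphism `w` of `Z` acts by
`t ↦ w⁻¹ ∘ t ∘ f`, where `w⁻¹` acts on `T` through `σ`. -/
def coeffPresheaf : (QuotSite ρ)ᵒᵖ ⥤ Ab.{u + 1} where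
  obj U := AddCommGrpCat.of (ULift.{u + 1} (Additive ((QuotSite.toOver ρ).obj U.unop ⟶ T.X)))
  map {U V} f := AddCommGrpCat.ofHom
    { toFun := fun t => ⟨Additive.ofMul
        ((QuotSite.toOver ρ).map f.unop ≫ t.down.toMul ≫ autHom σ f.unop.weight⁻¹)⟩
      map_zero' := by
        apply ULift.ext
        change Additive.ofMul (_ ≫ (1 : _ ⟶ T.X) ≫ _) = Additive.ofMul 1
        simp
      map_add' := fun a b => by
        apply ULift.ext
        change Additive.ofMul (_ ≫ (a.down.toMul * b.down.toMul) ≫ _) = Additive.ofMul (_ * _)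
        simp [MonObj.comp_mul, MonObj.mul_comp] }
  map_id U := by
    refine AddCommGrpCat.hom_ext (AddMonoidHom.ext fun t => ?_)
    apply ULift.ext
    change Additive.ofMul ((QuotSite.toOver ρ).map (𝟙 _) ≫ t.down.toMul ≫ autHom σ (1 : W)⁻¹) = _
    simp
  map_comp {U V Y} f g := by
    refine AddCommGrpCat.hom_ext (AddMonoidHom.ext fun t => ?_)
    apply ULift.ext
    change Additive.ofMul ((QuotSite.toOver ρ).map (g.unop ≫ f.unop) ≫ t.down.toMul ≫
      autHom σ (f.unop.weight * g.unop.weight)⁻¹) =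
      Additive.ofMul ((QuotSite.toOver ρ).map g.unop ≫
        ((QuotSite.toOver ρ).map f.unop ≫ t.down.toMul ≫ autHom σ f.unop.weight⁻¹) ≫
        autHom σ g.unop.weight⁻¹)
    rw [mul_inv_rev, autHom_mul]
    simp

/-- Morphisms into a fixed scheme glue along coverings of `QuotSite ρ`. -/
lemma exists_glue {U : QuotSite ρ} (R : Sieve U) (hR : R ∈ QuotSite.topology ρ U) (Y : Scheme.{u})
    (y : ∀ ⦃V : QuotSite ρ⦄ (f : V ⟶ U), R f → (V.left ⟶ Y))
    (hy : ∀ ⦃V V' : QuotSite ρ⦄ (g : V' ⟶ V) (f : V ⟶ U) (hf : R f),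
      y (g ≫ f) (R.downward_closed hf g) = g.map ≫ y f hf) :
    ∃! t : U.left ⟶ Y, ∀ ⦃V : QuotSite ρ⦄ (f : V ⟶ U) (hf : R f), f.map ≫ t = y f hf := by
  have hsub : Scheme.etaleTopology.{u}.Subcanonical :=
    .of_le (Scheme.etaleTopology_le_proetaleTopology.trans Scheme.proetaleTopology_le_fpqcTopology)
  let I := Σ V : QuotSite ρ, { f : V ⟶ U // R f }
  have hcov : Sieve.ofArrows (fun i : I => i.1.left) (fun i : I => i.2.1.map) ∈
      Scheme.etaleTopology.{u} U.left := by
    choose V f hf z hz using hR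
    let 𝒰 : Scheme.Cover (Scheme.precoverage @Etale) U.left :=
      Scheme.Cover.mkOfCovers U.left (fun x => (V x).left) (fun x => (f x).map)
        (fun x => ⟨x, z x, hz x⟩) inferInstance
    refine Scheme.mem_grothendieckTopology_iff.2 ⟨𝒰, ?_⟩
    rintro _ _ ⟨x⟩
    exact Sieve.le_generate _ _ _ (Presieve.ofArrows.mk (⟨V x, f x, hf x⟩ : I))
  have hsh := (Presieve.isSheafFor_iff_generate _).2
    ((GrothendieckTopology.Subcanonical.isSheaf_of_isRepresentable
      (J := Scheme.etaleTopology.{u}) (yoneda.obj Y)) _ hcov)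
  rw [Presieve.isSheafFor_arrows_iff] at hsh
  obtain ⟨t, ht, hu⟩ := hsh (fun i => y i.2.1 i.2.2) (by
    intro i j Q gi gj h
    obtain ⟨P, a, b, hab, -, hP⟩ := QuotSite.exists_pullback i.2.1 j.2.1
    have e : a.map ≫ y i.2.1 i.2.2 = b.map ≫ y j.2.1 j.2.2 := by
      rw [← hy, ← hy]; congr
    change gi ≫ _ = gj ≫ _
    rw [← hP.lift_fst gi gj h, Category.assoc, e, ← Category.assoc, hP.lift_snd])
  exact ⟨t, fun V f hf => ht ⟨V, f, hf⟩, fun t' ht' => hu t' fun i => ht' i.2.1 i.2.2⟩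

lemma isSheaf_coeffPresheaf : Presheaf.IsSheaf (QuotSite.topology ρ) (coeffPresheaf ρ σ) := by
  refine Presheaf.isSheaf_of_isSheaf_comp _ _ (forget Ab.{u + 1}) ?_
  rw [isSheaf_iff_isSheaf_of_type]
  intro U R hR x hx
  let v : ∀ ⦃V : QuotSite ρ⦄ (f : V ⟶ U), R f → ((QuotSite.toOver ρ).obj V ⟶ T.X) :=
    fun V f hf => (ULift.down (x f hf)).toMul ≫ autHom σ f.weight
  have hv : ∀ ⦃V V' : QuotSite ρ⦄ (g : V' ⟶ V) (f : V ⟶ U) (hf : R f),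
      v (g ≫ f) (R.downward_closed hf g) = (QuotSite.toOver ρ).map g ≫ v f hf := by
    intro V V' g f hf
    have h := (Presieve.compatible_iff_sieveCompatible x).1 hx f g hf
    have h' : (ULift.down (x (g ≫ f) (R.downward_closed hf g))).toMul =
      (QuotSite.toOver ρ).map g ≫ (ULift.down (x f hf)).toMul ≫ autHom σ g.weight⁻¹ :=
      congrArg (fun s => (ULift.down s).toMul) h
    simp only [v, h', QuotSite.comp_weight, Category.assoc, ← autHom_mul, mul_inv_cancel_right]
  obtain ⟨t, ht, hu⟩ := exists_glue ρ R hR T.X.left (fun V f hf => (v f hf).left)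
    (fun V V' g f hf => congrArg (fun s => Over.Hom.left s) (hv g f hf))
  have htS : t ≫ T.X.hom = U.hom ≫ Z.hom := by
    obtain ⟨s, -, hs⟩ := exists_glue ρ R hR S
      (fun V f hf => V.hom ≫ Z.hom) (fun V V' g f hf => (Over.w ((QuotSite.toOver ρ).map g)).symm)
    rw [hs (t ≫ T.X.hom) fun V f hf => by rw [← Category.assoc, ht f hf]; exact Over.w (v f hf),
      hs (U.hom ≫ Z.hom) fun V f hf => Over.w ((QuotSite.toOver ρ).map f)]
  have hcancel : ∀ (w : W) {Y : Over S} (a b : Y ⟶ T.X),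
      a ≫ autHom σ w⁻¹ = b ↔ a = b ≫ autHom σ w := by
    intro w Y a b
    constructor
    · rintro rfl; rw [Category.assoc, ← autHom_mul]; simp
    · rintro rfl; rw [Category.assoc, ← autHom_mul]; simp
  refine ⟨⟨Additive.ofMul (Over.homMk t htS)⟩, fun V f hf => ?_, fun t' ht' => ?_⟩
  · apply ULift.ext
    change (QuotSite.toOver ρ).map f ≫ Over.homMk t htS ≫ autHom σ f.weight⁻¹ = (x f hf).down.toMul
    rw [← Category.assoc, hcancel]
    exact Over.OverMorphism.ext (ht f hf)
  · apply ULift.ext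
    refine Over.OverMorphism.ext (hu _ fun V f hf => ?_)
    have h := congrArg (fun s => (ULift.down s).toMul) (ht' f hf)
    change (QuotSite.toOver ρ).map f ≫ t'.down.toMul ≫ autHom σ f.weight⁻¹ = (x f hf).down.toMul at h
    rw [← Category.assoc, hcancel] at h
    exact congrArg (fun s => Over.Hom.left s) h

/-- The étale sheaf of local sections of `T` on `Z`, with the action of `W` that comes from those
on `Z` and on `T`. -/
def coeffSheaf : Sheaf (QuotSite.topology ρ) Ab.{u + 1} :=
  ⟨coeffPresheaf ρ σ, isSheaf_coeffPresheaf ρ σ⟩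

end Coefficients

section GlobalSections

/-- The ring of integers, in the universe of the coefficients. -/
def IntRing : Type (u + 1) := ULift.{u + 1} ℤ

instance : CommRing IntRing.{u} := inferInstanceAs (CommRing (ULift.{u + 1} ℤ))

lemma IntRing.cast_down (r : IntRing.{u}) : ((ULift.down r : ℤ) : IntRing.{u}) = r := by
  apply ULift.ext
  change ULift.ringEquiv.{0, u + 1} (((ULift.down r : ℤ) : ULift.{u + 1} ℤ)) = ULift.down r
  rw [map_intCast]
  rfl

/-- An abelian group is a module over the ring of integers. -/
abbrev intModule (M : Type (u + 1)) [AddCommGroup M] : Module IntRing.{u} M :=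
  Module.compHom M (ULift.ringEquiv.{0, u + 1} : ULift.{u + 1} ℤ ≃+* ℤ).toRingHom

/-- An additive map, as a linear map over the integers. -/
def toIntLinear {M N : Type (u + 1)} [AddCommGroup M] [AddCommGroup N] [Module IntRing.{u} M]
    [Module IntRing.{u} N] (f : M →+ N) : M →ₗ[IntRing.{u}] N where
  toFun := f
  map_add' := f.map_add
  map_smul' r x := by
    rw [← IntRing.cast_down r, Int.cast_smul_eq_zsmul, RingHom.id_apply, Int.cast_smul_eq_zsmul]
    exact map_zsmul f _ x

/-- An abelian group with an action of `W` by automorphisms, as a `W`-module. -/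
def intRep (M : Type (u + 1)) [AddCommGroup M] (act : W → M →+ M) (act_one : ∀ m, act 1 m = m)
    (act_mul : ∀ w v m, act (w * v) m = act w (act v m)) : Rep.{u + 1} IntRing.{u} W :=
  letI := intModule M
  Rep.of (X := M)
    { toFun := fun w => toIntLinear (act w)
      map_one' := LinearMap.ext act_one
      map_mul' := fun w v => LinearMap.ext (act_mul w v) }

/-- An equivariant additive map, as a morphism of `W`-modules. -/
def intRepHom {M N : Rep.{u + 1} IntRing.{u} W} (f : M →+ N)
    (hf : ∀ w m, f (M.ρ w m) = N.ρ w (f m)) : M ⟶ N :=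
  Rep.ofHom { toLinearMap := toIntLinear f, isIntertwining' := fun w => LinearMap.ext (hf w) }

variable (ρ : W →* Aut Z)

/-- `Z` itself as an object of the site. -/
def QuotSite.top : QuotSite ρ := ⟨Z.left, 𝟙 _⟩

/-- The automorphism of `Z` given by `w`, as a morphism of the site. -/
def QuotSite.elt (w : W) : QuotSite.top ρ ⟶ QuotSite.top ρ :=
  ⟨w, actHom ρ w, by simp [QuotSite.top]⟩

lemma QuotSite.elt_one : QuotSite.elt ρ 1 = 𝟙 _ := QuotSite.hom_ext rfl (actHom_one ρ)

lemma QuotSite.elt_mul (w v : W) :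
    QuotSite.elt ρ (w * v) = QuotSite.elt ρ v ≫ QuotSite.elt ρ w :=
  QuotSite.hom_ext rfl (actHom_mul ρ w v)

/-- The functor `Γ_Z` of global sections, from sheaves of `W`-modules on `Z` to `W`-modules: the
element `w` acts on global sections by pull-back along `w⁻¹`. Its derived functors, as functors to
`W`-modules, are the cohomology groups `H^q(Z, F)` with their action of `W`. -/
def globalSections : Sheaf (QuotSite.topology ρ) Ab.{u + 1} ⥤ Rep.{u + 1} IntRing.{u} W where
  obj F := intRep (F.obj.obj (op (QuotSite.top ρ)))
    (fun w => (F.obj.map (QuotSite.elt ρ w⁻¹).op).hom)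
    (fun x => by
      change F.obj.map (QuotSite.elt ρ (1 : W)⁻¹).op x = x
      rw [inv_one, QuotSite.elt_one]
      simp)
    (fun w v x => by
      change F.obj.map (QuotSite.elt ρ (w * v)⁻¹).op x =
        F.obj.map (QuotSite.elt ρ w⁻¹).op (F.obj.map (QuotSite.elt ρ v⁻¹).op x)
      rw [mul_inv_rev, QuotSite.elt_mul]
      simp)
  map {F G} f := intRepHom (f.hom.app (op (QuotSite.top ρ))).hom
    fun w x => ConcreteCategory.congr_hom (f.hom.naturality (QuotSite.elt ρ w⁻¹).op) x
  map_id F := rfl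
  map_comp f g := rfl

instance : (globalSections ρ).Additive where
  map_add {_ _ f g} := by ext x; rfl

/-- The functor `Γ^W ∘ Γ_Z` of invariant global sections. Its derived functors are the cohomology
groups `Hⁿ(Z; W; F)`. -/
abbrev invariantSections : Sheaf (QuotSite.topology ρ) Ab.{u + 1} ⥤ ModuleCat.{u + 1} IntRing.{u} :=
  globalSections ρ ⋙ Rep.invariantsFunctor IntRing.{u} W

/-- The element `h` of `RⁿF(A)` is the class of the cocycle `a` of the complex `F(I^•)`, for an
injective resolution `I^•` of `A`. -/
def IsDerivedClass {C D : Type*} [Category* C] [Category* D]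
  [Abelian C] [HasInjectiveResolutions C] [Abelian D] {FD : D → D → Type*} {CD : D → Type*} [∀ A B, FunLike (FD A B) (CD A) (CD B)]
   [ConcreteCategory D FD] (F : C ⥤ D) [F.Additive] {A : C} (I : InjectiveResolution A) (n : ℕ)
    (a : ToType (F.obj (I.cocomplex.X n))) (h : ToType ((F.rightDerived n).obj A)) : Prop :=
  ∃ z : ToType (((F.mapHomologicalComplex _).obj I.cocomplex).cycles n),
     (((F.mapHomologicalComplex _).obj I.cocomplex).iCycles n) z = a ∧ 
     (((F.mapHomologicalComplex _).obj I.cocomplex).homologyπ n) z = (I.isoRightDerivedObj F n).hom h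

end GlobalSections

section Bundles

variable {ρ : W →* Aut Z}

/-- Principal bundles on `Z` with structure group `A`: sheaves of sets on the small étale site of
`Z` with a simply transitive action of `A` that locally have a section. -/
structure Bundle (A : Sheaf (QuotSite.topology ρ) Ab.{u + 1}) where
  sheaf : Sheaf Z.left.smallEtaleTopology (Type (u + 1))
  act (U : Z.left.Etale) : A.obj.obj (op ((QuotSite.incl ρ).obj U)) →
    sheaf.obj.obj (op U) → sheaf.obj.obj (op U)
  zero_act (U : Z.left.Etale) (e : sheaf.obj.obj (op U)) : act U 0 e = e
  add_act (U : Z.left.Etale) (a b : A.obj.obj (op ((QuotSite.incl ρ).obj U)))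
    (e : sheaf.obj.obj (op U)) : act U (a + b) e = act U a (act U b e)
  map_act {U V : Z.left.Etale} (f : U ⟶ V) (a : A.obj.obj (op ((QuotSite.incl ρ).obj V)))
    (e : sheaf.obj.obj (op V)) : sheaf.obj.map f.op (act V a e) =
      act U (A.obj.map ((QuotSite.incl ρ).map f).op a) (sheaf.obj.map f.op e)
  existsUnique_act (U : Z.left.Etale) (e e' : sheaf.obj.obj (op U)) : ∃! a, act U a e = e'
  locally_nonempty (U : Z.left.Etale) : ∃ R ∈ Z.left.smallEtaleTopology U,
    ∀ (V : Z.left.Etale) (f : V ⟶ U), R f → Nonempty (sheaf.obj.obj (op V))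

namespace Bundle

variable {A : Sheaf (QuotSite.topology ρ) Ab.{u + 1}}

/-- The set of sections of a bundle over `U`. -/
abbrev Sec (E : Bundle A) (U : Z.left.Etale) : Type (u + 1) := E.sheaf.obj.obj (op U)

/-- Restriction of sections. -/
abbrev res (E : Bundle A) {U V : Z.left.Etale} (f : U ⟶ V) (e : E.Sec V) : E.Sec U :=
  E.sheaf.obj.map f.op e

lemma res_id (E : Bundle A) {U : Z.left.Etale} (e : E.Sec U) : E.res (𝟙 U) e = e := by
  simp [res]

lemma res_res (E : Bundle A) {U V Y : Z.left.Etale} (f : U ⟶ V) (g : V ⟶ Y) (e : E.Sec Y) :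
    E.res f (E.res g e) = E.res (f ≫ g) e := by
  simp [res]

/-- Isomorphisms of principal bundles. -/
@[ext]
structure Iso (E F : Bundle A) where
  equiv (U : Z.left.Etale) : E.Sec U ≃ F.Sec U
  equiv_act (U : Z.left.Etale) (a : A.obj.obj (op ((QuotSite.incl ρ).obj U))) (e : E.Sec U) :
    equiv U (E.act U a e) = F.act U a (equiv U e)
  equiv_res {U V : Z.left.Etale} (f : U ⟶ V) (e : E.Sec V) :
    equiv U (E.res f e) = F.res f (equiv V e)

end Bundle

variable (ρ) in
/-- The étale `Z`-scheme `U → Z → Z`, where the second map is the automorphism `w⁻¹`. It is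
isomorphic to the pull-back of `U` along `w`; a sheaf `F` evaluated on it is `(w⁻¹)^* F`. -/
def shift (w : W) : Z.left.Etale ⥤ Z.left.Etale where
  obj U := Scheme.Etale.mk (U.hom ≫ actHom ρ w⁻¹)
  map {U V} f := MorphismProperty.Over.homMk f.left (by
    have h := Over.w ((Scheme.Etale.forget _).map f)
    change f.left ≫ V.hom ≫ _ = U.hom ≫ _
    rw [← Category.assoc]
    exact congrArg (· ≫ actHom ρ w⁻¹) h)
  map_id U := rfl
  map_comp f g := rfl

lemma comp_actHom_one (ρ : W →* Aut Z) {Y : Scheme.{u}} (p : Y ⟶ Z.left) :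
    p ≫ actHom ρ 1⁻¹ = p := by simp

lemma comp_actHom_mul (ρ : W →* Aut Z) (w v : W) {Y : Scheme.{u}} (p : Y ⟶ Z.left) :
    p ≫ actHom ρ (w * v)⁻¹ = (p ≫ actHom ρ w⁻¹) ≫ actHom ρ v⁻¹ := by
  rw [mul_inv_rev, actHom_mul, Category.assoc]

lemma etale_hom_ext {U V : Z.left.Etale} {f g : U ⟶ V} (h : f.left = g.left) : f = g :=
  MorphismProperty.Over.Hom.ext h

lemma mem_smallEtaleTopology_iff' {U : Z.left.Etale} (R : Sieve U) :
    R ∈ Z.left.smallEtaleTopology U ↔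
      ∀ x : U.left, ∃ (V : Z.left.Etale) (f : V ⟶ U), R f ∧ x ∈ Set.range f.left := by
  let I := Σ V : Z.left.Etale, { f : V ⟶ U // R f }
  have h : Sieve.ofArrows (fun i : I => i.1) (fun i : I => i.2.1) = R := by
    ext V f
    constructor
    · rintro ⟨_, g, _, ⟨i⟩, rfl⟩
      exact R.downward_closed i.2.2 g
    · intro hf
      exact Sieve.ofArrows_mk (fun i : I => i.1) (fun i : I => i.2.1) ⟨V, f, hf⟩
  conv_lhs => rw [← h]
  rw [Scheme.ofArrows_mem_smallEtaleTopology_iff, Set.eq_univ_iff_forall]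
  refine forall_congr' fun x => ?_
  rw [Set.mem_iUnion]
  exact ⟨fun ⟨i, hi⟩ => ⟨i.1, i.2.1, i.2.2, hi⟩, fun ⟨V, f, hf, hx⟩ => ⟨⟨V, f, hf⟩, hx⟩⟩

variable (ρ) in
/-- The identity of `U`, as a comparison of `shift ρ 1 U` with `U`. -/
def shiftOne (U : Z.left.Etale) : (shift ρ 1).obj U ⟶ U :=
  MorphismProperty.Over.homMk (𝟙 _) ((Category.id_comp _).trans (comp_actHom_one ρ U.hom).symm)

variable (ρ) in
/-- The inverse of `shiftOne`. -/
def oneShift (U : Z.left.Etale) : U ⟶ (shift ρ 1).obj U :=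
  MorphismProperty.Over.homMk (𝟙 _) ((Category.id_comp _).trans (comp_actHom_one ρ U.hom))

variable (ρ) in
/-- The identity of `U`, as a comparison of shifts by a product. -/
def shiftMul (w v : W) (U : Z.left.Etale) :
    (shift ρ (w * v)).obj U ⟶ (shift ρ v).obj ((shift ρ w).obj U) :=
  MorphismProperty.Over.homMk (𝟙 _) ((Category.id_comp _).trans (comp_actHom_mul ρ w v U.hom).symm)

variable (ρ) in
/-- The inverse of `shiftMul`. -/
def mulShift (w v : W) (U : Z.left.Etale) :
    (shift ρ v).obj ((shift ρ w).obj U) ⟶ (shift ρ (w * v)).obj U :=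
  MorphismProperty.Over.homMk (𝟙 _) ((Category.id_comp _).trans (comp_actHom_mul ρ w v U.hom))

instance (w : W) : (shift ρ w).Faithful where
  map_injective h := etale_hom_ext (congrArg (fun f => f.left) h)

instance (w : W) : (shift ρ w).Full where
  map_surjective {U V} f := ⟨MorphismProperty.Over.homMk f.left (by
    have h := Over.w ((Scheme.Etale.forget _).map f)
    change f.left ≫ V.hom ≫ actHom ρ w⁻¹ = U.hom ≫ actHom ρ w⁻¹ at h
    exact (cancel_mono _).1 ((Category.assoc _ _ _).trans h)), rfl⟩

instance (w : W) : (shift ρ w).EssSurj where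
  mem_essImage V := ⟨(shift ρ w⁻¹).obj V, ⟨MorphismProperty.Over.isoMk (CategoryTheory.Iso.refl _) (by
    change 𝟙 _ ≫ V.hom = (V.hom ≫ actHom ρ w⁻¹⁻¹) ≫ actHom ρ w⁻¹
    rw [Category.assoc, ← actHom_mul]; simp)⟩⟩

instance (w : W) : (shift ρ w).IsEquivalence where

instance (w : W) : (shift ρ w).IsContinuous Z.left.smallEtaleTopology Z.left.smallEtaleTopology := by
  refine Functor.isContinuous_of_coverPreserving (compatiblePreservingOfFlat _ _) ⟨fun {U R} hR => ?_⟩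
  rw [mem_smallEtaleTopology_iff'] at hR ⊢
  intro x
  obtain ⟨V, f, hf, hx⟩ := hR x
  exact ⟨(shift ρ w).obj V, (shift ρ w).map f, Sieve.image_mem_functorPushforward _ _ hf, hx⟩

variable (ρ) in
/-- The identity of `U`, as a morphism over the automorphism `w` of `Z`. -/
def twistHom (w : W) (U : Z.left.Etale) :
    (QuotSite.incl ρ).obj ((shift ρ w).obj U) ⟶ (QuotSite.incl ρ).obj U :=
  ⟨w, 𝟙 U.left, (Category.id_comp _).trans (by
    change U.hom = (U.hom ≫ actHom ρ w⁻¹) ≫ actHom ρ w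
    rw [Category.assoc, ← actHom_mul, mul_inv_cancel, actHom_one]
    exact (Category.comp_id _).symm)⟩

variable (ρ) in
/-- The inverse of `twistHom`. -/
def twistInv (w : W) (U : Z.left.Etale) :
    (QuotSite.incl ρ).obj U ⟶ (QuotSite.incl ρ).obj ((shift ρ w).obj U) :=
  ⟨w⁻¹, 𝟙 U.left, Category.id_comp _⟩

lemma twistHom_twistInv (w : W) (U : Z.left.Etale) :
    twistHom ρ w U ≫ twistInv ρ w U = 𝟙 _ :=
  QuotSite.hom_ext (inv_mul_cancel w) (Category.id_comp _)

lemma twistInv_twistHom (w : W) (U : Z.left.Etale) :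
    twistInv ρ w U ≫ twistHom ρ w U = 𝟙 _ :=
  QuotSite.hom_ext (mul_inv_cancel w) (Category.id_comp _)

lemma twistHom_naturality (w : W) {U V : Z.left.Etale} (f : U ⟶ V) :
    twistHom ρ w U ≫ (QuotSite.incl ρ).map f =
      (QuotSite.incl ρ).map ((shift ρ w).map f) ≫ twistHom ρ w V :=
  QuotSite.hom_ext ((one_mul w).trans (mul_one w).symm)
    ((Category.id_comp _).trans (Category.comp_id _).symm)

lemma invShift_aux (ρ : W →* Aut Z) (w : W) {Y : Scheme.{u}} (p : Y ⟶ Z.left) :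
    (p ≫ actHom ρ w⁻¹⁻¹) ≫ actHom ρ w⁻¹ = p := by
  rw [← comp_actHom_mul, inv_mul_cancel, comp_actHom_one]

lemma scheme_aux {P Q Y : Scheme.{u}} (a : Q ⟶ P) (b : P ⟶ Q) (c : Q ⟶ Y) (d : P ⟶ Y)
    (hd : d = b ≫ c) (h : a ≫ b = 𝟙 _) (y : Q) : d (a y) = c y := by
  subst hd
  rw [← Scheme.Hom.comp_apply, ← Category.assoc, h, Category.id_comp]

namespace Bundle

variable {A : Sheaf (QuotSite.topology ρ) Ab.{u + 1}}

/-- The twisted action of `w` on bundles: the bundle `(w⁻¹)^* E ×_w A` obtained from the pull-back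
of `E` along the automorphism `w⁻¹` of `Z`, which is a bundle under `(w⁻¹)^* A`, by extension of the
structure group along the isomorphism `(w⁻¹)^* A → A` given by `w`. -/
def twist (w : W) (E : Bundle A) : Bundle A where
  sheaf := ((shift ρ w).sheafPushforwardContinuous (Type (u + 1))
    Z.left.smallEtaleTopology Z.left.smallEtaleTopology).obj E.sheaf
  act U a e := E.act ((shift ρ w).obj U) (A.obj.map (twistHom ρ w U).op a) e
  zero_act U e := (congrArg (fun a => E.act ((shift ρ w).obj U) a e)
    (map_zero (A.obj.map (twistHom ρ w U).op).hom)).trans (E.zero_act _ _)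
  add_act U a b e := (congrArg (fun a => E.act ((shift ρ w).obj U) a e)
    (map_add (A.obj.map (twistHom ρ w U).op).hom a b)).trans (E.add_act _ _ _ _)
  map_act {U V} f a e := by
    refine (E.map_act ((shift ρ w).map f) _ _).trans ?_
    congr 1
    change (A.obj.map _ ≫ A.obj.map _) a = (A.obj.map _ ≫ A.obj.map _) a
    rw [← A.obj.map_comp, ← A.obj.map_comp, ← op_comp, ← op_comp, ← twistHom_naturality]
  existsUnique_act U e e' := by
    obtain ⟨a, ha, hu⟩ := E.existsUnique_act ((shift ρ w).obj U) e e'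
    have h₁ : ∀ x, A.obj.map (twistHom ρ w U).op (A.obj.map (twistInv ρ w U).op x) = x := fun x => by
      change (A.obj.map _ ≫ A.obj.map _) x = x
      rw [← A.obj.map_comp, ← op_comp, twistHom_twistInv]
      simp
    have h₂ : ∀ x, A.obj.map (twistInv ρ w U).op (A.obj.map (twistHom ρ w U).op x) = x := fun x => by
      change (A.obj.map _ ≫ A.obj.map _) x = x
      rw [← A.obj.map_comp, ← op_comp, twistInv_twistHom]
      simp
    refine ⟨A.obj.map (twistInv ρ w U).op a, ?_, fun b hb => ?_⟩
    · beta_reduce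
      rw [h₁]
      exact ha
    · rw [← hu _ hb, h₂]
  locally_nonempty U := by
    obtain ⟨R, hR, h⟩ := E.locally_nonempty ((shift ρ w).obj U)
    refine ⟨R.functorPullback (shift ρ w), ?_, fun V f hf => h _ _ hf⟩
    rw [mem_smallEtaleTopology_iff'] at hR ⊢
    intro x
    obtain ⟨V, f, hf, hx⟩ := hR x
    obtain ⟨V', ⟨i⟩⟩ := (inferInstance : (shift ρ w).EssSurj).mem_essImage V
    obtain ⟨g, hg⟩ := (shift ρ w).map_surjective (i.hom ≫ f)
    refine ⟨V', g, ?_, ?_⟩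
    · change R ((shift ρ w).map g)
      rw [hg]
      exact R.downward_closed hf _
    · obtain ⟨y, rfl⟩ := hx
      refine ⟨i.inv.left y, ?_⟩
      have hgl : g.left = i.hom.left ≫ f.left := congrArg (fun q => q.left) hg
      have hi : i.inv.left ≫ i.hom.left = 𝟙 V.left := congrArg (fun q => q.left) i.inv_hom_id
      exact scheme_aux i.inv.left i.hom.left f.left g.left hgl hi y

end Bundle

/-- The Mumford group of `E`: the pairs of an element `w` of `W` and an isomorphism of bundles from
`E` to the twist of `E` by `w`. The product is `(w, γ)(v, δ) = (wv, w(δ) ∘ γ)`. -/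
@[ext]
structure Mumford {A : Sheaf (QuotSite.topology ρ) Ab.{u + 1}} (E : Bundle A) where
  weight : W
  iso : E.Iso (E.twist weight)

namespace Mumford

variable {A : Sheaf (QuotSite.topology ρ) Ab.{u + 1}} {E : Bundle A}

/-- The isomorphism, on sections. -/
def app (x : Mumford E) (U : Z.left.Etale) : E.Sec U ≃ E.Sec ((shift ρ x.weight).obj U) :=
  x.iso.equiv U

lemma app_act (x : Mumford E) (U : Z.left.Etale) (a : A.obj.obj (op ((QuotSite.incl ρ).obj U)))
    (e : E.Sec U) : x.app U (E.act U a e) =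
      E.act ((shift ρ x.weight).obj U) (A.obj.map (twistHom ρ x.weight U).op a) (x.app U e) :=
  x.iso.equiv_act U a e

lemma app_res (x : Mumford E) {U V : Z.left.Etale} (f : U ⟶ V) (e : E.Sec V) :
    x.app U (E.res f e) = E.res ((shift ρ x.weight).map f) (x.app V e) :=
  x.iso.equiv_res f e

/-- Sections over two isomorphic objects. -/
def resEquiv (E : Bundle A) {U V : Z.left.Etale} (f : U ⟶ V) (g : V ⟶ U) (h : f ≫ g = 𝟙 _)
    (h' : g ≫ f = 𝟙 _) : E.Sec V ≃ E.Sec U where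
  toFun := E.res f
  invFun := E.res g
  left_inv e := by rw [E.res_res, h', E.res_id]
  right_inv e := by rw [E.res_res, h, E.res_id]


variable (ρ) in
/-- The comparison of the shifts by equal elements. -/
def shiftCast {w v : W} (h : w = v) (U : Z.left.Etale) :
    (shift ρ w).obj U ⟶ (shift ρ v).obj U :=
  MorphismProperty.Over.homMk (𝟙 _) ((Category.id_comp _).trans (by subst h; rfl))

lemma ext_app {x y : Mumford E} (h : x.weight = y.weight)
    (H : ∀ U e, x.app U e = E.res (shiftCast ρ h U) (y.app U e)) : x = y := by
  obtain ⟨w, i⟩ := x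
  obtain ⟨v, j⟩ := y
  obtain rfl : w = v := h
  congr 1
  refine Bundle.Iso.ext (funext fun U => Equiv.ext fun e => (H U e).trans ?_)
  exact E.res_id _

instance : Mul (Mumford E) where
  mul x y :=
    { weight := x.weight * y.weight
      iso :=
        { equiv := fun U => (x.app U).trans ((y.app ((shift ρ x.weight).obj U)).trans
            (resEquiv E (shiftMul ρ x.weight y.weight U) (mulShift ρ x.weight y.weight U)
              (etale_hom_ext (Category.id_comp _)) (etale_hom_ext (Category.id_comp _))))
          equiv_act := fun U a e => by
            change E.res _ (y.app _ (x.app U (E.act U a e))) =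
              E.act _ (A.obj.map _ a) (E.res _ (y.app _ (x.app U e)))
            rw [app_act, app_act]
            refine (E.map_act _ _ _).trans ?_
            congr 1
            change (A.obj.map _ ≫ A.obj.map _ ≫ A.obj.map _) a = _
            rw [← A.obj.map_comp, ← A.obj.map_comp, ← op_comp, ← op_comp]
            exact congrArg (fun q => A.obj.map (Quiver.Hom.op q) a)
              (QuotSite.hom_ext (by simp [twistHom, QuotSite.incl]) (by simp [twistHom, QuotSite.incl]; rfl))
          equiv_res := fun {U V} f e => by
            change E.res _ (y.app _ (x.app U (E.res f e))) =
              E.res _ (E.res _ (y.app _ (x.app V e)))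
            rw [app_res, app_res, E.res_res, E.res_res]
            congr 1 } }

instance : One (Mumford E) where
  one :=
    { weight := 1
      iso :=
        { equiv := fun U => resEquiv E (shiftOne ρ U) (oneShift ρ U)
            (etale_hom_ext (Category.id_comp _)) (etale_hom_ext (Category.id_comp _))
          equiv_act := fun U a e => E.map_act _ _ _
          equiv_res := fun {U V} f e => by
            change E.res _ (E.res _ e) = E.res _ (E.res _ e)
            rw [E.res_res, E.res_res]
            congr 1 } }

variable (ρ) in
/-- The identity of `U`, as a comparison of `U` with its shift by `w⁻¹` and by `w`. -/
def shiftInv (w : W) (U : Z.left.Etale) : U ⟶ (shift ρ w).obj ((shift ρ w⁻¹).obj U) :=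
  MorphismProperty.Over.homMk (𝟙 _) ((Category.id_comp _).trans (invShift_aux ρ w U.hom))

variable (ρ) in
/-- The inverse of `shiftInv`. -/
def invShift (w : W) (U : Z.left.Etale) : (shift ρ w).obj ((shift ρ w⁻¹).obj U) ⟶ U :=
  MorphismProperty.Over.homMk (𝟙 _) ((Category.id_comp _).trans (invShift_aux ρ w U.hom).symm)

/-- The isomorphism from the shift of `E` by `w⁻¹` to `E`. -/
def invEquiv (x : Mumford E) (U : Z.left.Etale) :
    E.Sec ((shift ρ x.weight⁻¹).obj U) ≃ E.Sec U :=
  (x.app _).trans (resEquiv E (shiftInv ρ x.weight U) (invShift ρ x.weight U)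
    (etale_hom_ext (Category.id_comp _)) (etale_hom_ext (Category.id_comp _)))

lemma invEquiv_apply (x : Mumford E) (U : Z.left.Etale) (e) :
    x.invEquiv U e = E.res (shiftInv ρ x.weight U) (x.app _ e) := rfl

lemma invEquiv_act (x : Mumford E) (U : Z.left.Etale)
    (a : A.obj.obj (op ((QuotSite.incl ρ).obj U))) (e : E.Sec ((shift ρ x.weight⁻¹).obj U)) :
    x.invEquiv U (E.act _ (A.obj.map (twistHom ρ x.weight⁻¹ U).op a) e) =
      E.act U a (x.invEquiv U e) := by
  rw [invEquiv_apply, app_act]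
  refine (E.map_act _ _ _).trans ?_
  congr 1
  change (A.obj.map _ ≫ A.obj.map _ ≫ A.obj.map _) a = _
  rw [← A.obj.map_comp, ← A.obj.map_comp, ← op_comp, ← op_comp]
  refine Eq.trans (congrArg (fun q => A.obj.map (Quiver.Hom.op q) a) (?_ : _ = 𝟙 _)) (by simp)
  exact QuotSite.hom_ext (by simp [twistHom, QuotSite.incl])
    (by simp [twistHom, QuotSite.incl]; rfl)

lemma invEquiv_res (x : Mumford E) {U V : Z.left.Etale} (f : U ⟶ V)
    (e : E.Sec ((shift ρ x.weight⁻¹).obj V)) :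
    x.invEquiv U (E.res ((shift ρ x.weight⁻¹).map f) e) = E.res f (x.invEquiv V e) := by
  rw [invEquiv_apply, invEquiv_apply, app_res, E.res_res, E.res_res]
  congr 1

instance : Inv (Mumford E) where
  inv x :=
    { weight := x.weight⁻¹
      iso :=
        { equiv := fun U => (x.invEquiv U).symm
          equiv_act := fun U a e => (x.invEquiv U).injective <|
            ((x.invEquiv U).apply_symm_apply _).trans <| Eq.symm <|
              (x.invEquiv_act U a ((x.invEquiv U).symm e)).trans
                (congrArg (E.act U a) ((x.invEquiv U).apply_symm_apply e))
          equiv_res := fun {U V} f e => (x.invEquiv U).injective <|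
            ((x.invEquiv U).apply_symm_apply _).trans <| Eq.symm <|
              (x.invEquiv_res f ((x.invEquiv V).symm e)).trans
                (congrArg (E.res f) ((x.invEquiv V).apply_symm_apply e)) } }

@[simp] lemma mul_weight (x y : Mumford E) : (x * y).weight = x.weight * y.weight := rfl
@[simp] lemma one_weight : (1 : Mumford E).weight = 1 := rfl
@[simp] lemma inv_weight (x : Mumford E) : x⁻¹.weight = x.weight⁻¹ := rfl

lemma mul_app (x y : Mumford E) (U : Z.left.Etale) (e : E.Sec U) :
    (x * y).app U e = E.res (shiftMul ρ x.weight y.weight U) (y.app _ (x.app U e)) := rfl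

lemma one_app (U : Z.left.Etale) (e : E.Sec U) :
    (1 : Mumford E).app U e = E.res (shiftOne ρ U) e := rfl

lemma inv_app (x : Mumford E) (U : Z.left.Etale) (e : E.Sec U) :
    x⁻¹.app U e = (x.invEquiv U).symm e := rfl

instance : Group (Mumford E) where
  mul_assoc x y z := ext_app (mul_assoc _ _ _) fun U e => by
    rw [mul_app, mul_app, mul_app, mul_app, app_res, E.res_res, E.res_res, E.res_res]
    congr 1
  one_mul x := ext_app (one_mul _) fun U e => by
    rw [mul_app, one_app, app_res, E.res_res]
    congr 1
  mul_one x := ext_app (mul_one _) fun U e => by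
    rw [mul_app, one_app, E.res_res]
    congr 1
  inv_mul_cancel x := ext_app (inv_mul_cancel _) fun U e => by
    obtain ⟨f, rfl⟩ := (x.invEquiv U).surjective e
    rw [mul_app, one_app, inv_app, E.res_res, Equiv.symm_apply_apply, invEquiv_apply, E.res_res]
    congr 1

variable (E) in
/-- The projection of the Mumford group to `W`. -/
def proj : Mumford E →* W where
  toFun := weight
  map_one' := rfl
  map_mul' _ _ := rfl

variable (ρ) in
/-- The structure morphism of `U`, as a morphism of the site. -/
def toTop (U : Z.left.Etale) : (QuotSite.incl ρ).obj U ⟶ QuotSite.top ρ :=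
  ⟨1, U.hom, by rw [actHom_one, Category.comp_id]; exact Category.comp_id _⟩

lemma incl_map_toTop {U V : Z.left.Etale} (f : U ⟶ V) :
    (QuotSite.incl ρ).map f ≫ toTop ρ V = toTop ρ U :=
  QuotSite.hom_ext (mul_one 1) (Over.w ((Scheme.Etale.forget _).map f))

/-- The restriction to `U` of a section over `Z`. -/
def toSec (a : A.obj.obj (op (QuotSite.top ρ))) (U : Z.left.Etale) :
    A.obj.obj (op ((QuotSite.incl ρ).obj U)) := A.obj.map (toTop ρ U).op a

lemma toSec_add (a b : A.obj.obj (op (QuotSite.top ρ))) (U : Z.left.Etale) :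
    toSec (a + b) U = toSec a U + toSec b U :=
  map_add (A.obj.map (toTop ρ U).op).hom a b

lemma toSec_zero (U : Z.left.Etale) : toSec (0 : A.obj.obj (op (QuotSite.top ρ))) U = 0 :=
  map_zero (A.obj.map (toTop ρ U).op).hom

lemma map_toSec (a : A.obj.obj (op (QuotSite.top ρ))) {U V : Z.left.Etale} (f : U ⟶ V) :
    A.obj.map ((QuotSite.incl ρ).map f).op (toSec a V) = toSec a U := by
  change (A.obj.map _ ≫ A.obj.map _) a = A.obj.map _ a
  rw [← A.obj.map_comp, ← op_comp, incl_map_toTop]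

variable (E) in
/-- The automorphism of `E` given by a global section of `A`. -/
def translation (a : A.obj.obj (op (QuotSite.top ρ))) : Mumford E where
  weight := 1
  iso :=
    { equiv := fun U => Equiv.trans
        { toFun := fun e => E.act U (toSec a U) e
          invFun := fun e => E.act U (toSec (-a) U) e
          left_inv := fun e => by
            change E.act U _ (E.act U _ e) = e
            rw [← E.add_act, ← toSec_add, neg_add_cancel, toSec_zero, E.zero_act]
          right_inv := fun e => by
            change E.act U _ (E.act U _ e) = e
            rw [← E.add_act, ← toSec_add, add_neg_cancel, toSec_zero, E.zero_act] }
        ((1 : Mumford E).app U)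
      equiv_act := fun U b e => by
        change (1 : Mumford E).app U (E.act U _ (E.act U b e)) =
          E.act _ _ ((1 : Mumford E).app U (E.act U _ e))
        rw [← E.add_act, add_comm, E.add_act]
        exact app_act 1 U b _
      equiv_res := fun {U V} f e => by
        change (1 : Mumford E).app U (E.act U _ (E.res f e)) =
          E.res _ ((1 : Mumford E).app V (E.act V _ e))
        refine Eq.trans ?_ (app_res 1 f _)
        rw [← map_toSec a f]
        exact congrArg _ (E.map_act f _ _).symm }

lemma translation_app (a : A.obj.obj (op (QuotSite.top ρ))) (U : Z.left.Etale) (e : E.Sec U) :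
    (translation E a).app U e = E.res (shiftOne ρ U) (E.act U (toSec a U) e) := rfl

variable (E) in
/-- The inclusion of the global sections of `A` in the Mumford group. -/
def inl : Multiplicative (A.obj.obj (op (QuotSite.top ρ))) →* Mumford E where
  toFun a := translation E a.toAdd
  map_one' := ext_app rfl fun U e => by
    rw [translation_app, one_app, toAdd_one, toSec_zero, E.zero_act, E.res_res]
    congr 1
  map_mul' a b := ext_app (one_mul (1 : W)).symm fun U e => by
    have h₁ : E.act U (toSec (a * b).toAdd U) e =
        E.act U (toSec b.toAdd U) (E.act U (toSec a.toAdd U) e) := by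
      rw [toAdd_mul, add_comm, toSec_add, E.add_act]
    have h₂ (e' : E.Sec U) : E.act _ (toSec b.toAdd ((shift ρ 1).obj U)) (E.res (shiftOne ρ U) e') =
        E.res (shiftOne ρ U) (E.act U (toSec b.toAdd U) e') := by
      rw [← map_toSec b.toAdd (shiftOne ρ U)]
      exact (E.map_act (shiftOne ρ U) _ _).symm
    have h₃ (e' : E.Sec U) : E.res (shiftOne ρ U) e' =
        E.res (shiftCast ρ (one_mul (1 : W)).symm U) (E.res (shiftMul ρ 1 1 U)
          (E.res (shiftOne ρ ((shift ρ 1).obj U)) (E.res (shiftOne ρ U) e'))) := by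
      refine Eq.symm (Eq.trans (congrArg (E.res _) (congrArg (E.res _) (E.res_res _ _ _))) ?_)
      refine Eq.trans (congrArg (E.res _) (E.res_res _ _ _)) ?_
      refine Eq.trans (E.res_res _ _ _) ?_
      congr 1
    refine (congrArg (E.res (shiftOne ρ U)) h₁).trans ?_
    refine (h₃ _).trans ?_
    exact congrArg (fun q => E.res (shiftCast ρ (one_mul (1 : W)).symm U)
      (E.res (shiftMul ρ 1 1 U) (E.res (shiftOne ρ ((shift ρ 1).obj U)) q))) (h₂ _).symm

end Mumford

/-- `E` is isomorphic to its twists by all elements of `W`. -/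
def Bundle.IsInvariant {A : Sheaf (QuotSite.topology ρ) Ab.{u + 1}} (E : Bundle A) : Prop :=
  ∀ w : W, Nonempty (E.Iso (E.twist w))

/-- `E` is the contracted product of `E₁` and `E₂`, the sum in the group of isomorphism classes of
bundles. -/
def Bundle.IsContractedProduct {A : Sheaf (QuotSite.topology ρ) Ab.{u + 1}}
    (E₁ E₂ E : Bundle A) : Prop :=
  ∃ m : ∀ U : Z.left.Etale, E₁.Sec U → E₂.Sec U → E.Sec U,
    (∀ (U V : Z.left.Etale) (f : U ⟶ V) (e₁ : E₁.Sec V) (e₂ : E₂.Sec V),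
      m U (E₁.res f e₁) (E₂.res f e₂) = E.res f (m V e₁ e₂)) ∧
    ∀ (U : Z.left.Etale) (a b : A.obj.obj (op ((QuotSite.incl ρ).obj U)))
      (e₁ : E₁.Sec U) (e₂ : E₂.Sec U),
      m U (E₁.act U a e₁) (E₂.act U b e₂) = E.act U (a + b) (m U e₁ e₂)

end Bundles

section Classes

variable (ρ : W →* Aut Z) {A : Sheaf (QuotSite.topology ρ) Ab.{u + 1}}

variable {ρ} in
/-- The class of a bundle `E` in `H¹(Z, A)`, computed with an injective resolution
`0 → A → I⁰ → I¹ → ⋯`: the bundle `E` is isomorphic, through some `φ`, to the bundle of local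
sections of `I⁰` whose differential is a given global section `a` of `I¹`, and `h` is the class of
`a`. -/
def IsBundleClass (I : InjectiveResolution A) (E : Bundle A)
    (h : ((globalSections ρ).rightDerived 1).obj A) : Prop :=
  ∃ (a : (I.cocomplex.X 1).obj.obj (op (QuotSite.top ρ)))
    (φ : ∀ U : Z.left.Etale, E.Sec U → (I.cocomplex.X 0).obj.obj (op ((QuotSite.incl ρ).obj U))),
    (∀ (U V : Z.left.Etale) (f : U ⟶ V) (e : E.Sec V),
      φ U (E.res f e) = (I.cocomplex.X 0).obj.map ((QuotSite.incl ρ).map f).op (φ V e)) ∧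
    (∀ (U : Z.left.Etale) (t : A.obj.obj (op ((QuotSite.incl ρ).obj U))) (e : E.Sec U),
      φ U (E.act U t e) = (I.ι.f 0).hom.app (op ((QuotSite.incl ρ).obj U)) t + φ U e) ∧
    (∀ (U : Z.left.Etale) (e : E.Sec U),
      (I.cocomplex.d 0 1).hom.app (op ((QuotSite.incl ρ).obj U)) (φ U e) =
        (I.cocomplex.X 1).obj.map (Mumford.toTop ρ U).op a) ∧
    IsDerivedClass (globalSections ρ) I 1 a h

variable {T : CommGrp (Over S)} (σ : W →* Aut T)

/-- The `W`-module of the points of `T` over the base. -/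
def pointsRep : Rep.{u + 1} IntRing.{u} W :=
  intRep (ULift.{u + 1} (Additive (Over.mk (𝟙 S) ⟶ T.X)))
    (fun w =>
      { toFun := fun t => ⟨Additive.ofMul (t.down.toMul ≫ autHom σ w)⟩
        map_zero' := by
          apply ULift.ext
          change Additive.ofMul ((1 : _ ⟶ T.X) ≫ _) = Additive.ofMul 1
          simp
        map_add' := fun a b => by
          apply ULift.ext
          change Additive.ofMul ((a.down.toMul * b.down.toMul) ≫ _) = Additive.ofMul (_ * _)
          simp [MonObj.mul_comp] })
    (fun t => by
      apply ULift.ext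
      change Additive.ofMul (t.down.toMul ≫ autHom σ 1) = t.down
      simp)
    (fun w v t => by
      apply ULift.ext
      change Additive.ofMul (t.down.toMul ≫ autHom σ (w * v)) =
        Additive.ofMul ((t.down.toMul ≫ autHom σ v) ≫ autHom σ w)
      rw [autHom_mul, Category.assoc])

/-- The structure morphism of `Z`, over the base. -/
def structureMap : (QuotSite.toOver ρ).obj (QuotSite.top ρ) ⟶ Over.mk (𝟙 S) :=
  Over.homMk (𝟙 _ ≫ Z.hom) (Category.comp_id _)

lemma toOver_elt_structureMap (w : W) :
    (QuotSite.toOver ρ).map (QuotSite.elt ρ w) ≫ structureMap ρ = structureMap ρ :=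
  Over.mkIdTerminal.hom_ext _ _

/-- A point of `T` over the base, viewed as a constant section of `T` over `Z`. -/
def constant : ULift.{u + 1} (Additive (Over.mk (𝟙 S) ⟶ T.X)) →+
    (coeffSheaf ρ σ).obj.obj (op (QuotSite.top ρ)) where
  toFun t := ⟨Additive.ofMul (structureMap ρ ≫ t.down.toMul)⟩
  map_zero' := by
    apply ULift.ext
    change Additive.ofMul (_ ≫ (1 : _ ⟶ T.X)) = Additive.ofMul 1
    simp
  map_add' a b := by
    apply ULift.ext
    change Additive.ofMul (_ ≫ (a.down.toMul * b.down.toMul)) = Additive.ofMul (_ * _)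
    simp [MonObj.comp_mul]

/-- The constant sections, as a morphism of `W`-modules. -/
def constantSection : pointsRep σ ⟶ (globalSections ρ).obj (coeffSheaf ρ σ) :=
  intRepHom (M := pointsRep σ) (N := (globalSections ρ).obj (coeffSheaf ρ σ)) (constant ρ σ)
    fun w (t : ULift.{u + 1} (Additive (Over.mk (𝟙 S) ⟶ T.X))) => by
      apply ULift.ext
      change Additive.ofMul (structureMap ρ ≫ t.down.toMul ≫ autHom σ w) =
        Additive.ofMul ((QuotSite.toOver ρ).map (QuotSite.elt ρ w⁻¹) ≫
          (structureMap ρ ≫ t.down.toMul) ≫ autHom σ w⁻¹⁻¹)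
      rw [inv_inv, ← Category.assoc, ← Category.assoc, ← Category.assoc, toOver_elt_structureMap]

/-- The morphism `T → H⁰(Z, T)` of `W`-modules given by the constant sections. -/
def pointsToH0 : pointsRep σ ⟶ ((globalSections ρ).rightDerived 0).obj (coeffSheaf ρ σ) :=
  constantSection ρ σ ≫ (globalSections ρ).toRightDerivedZero.app (coeffSheaf ρ σ)

variable {ρ σ} in
/-- The inclusion of the points of `T` in the Mumford group of a `T`-bundle. -/
def Mumford.pointsInl (E : Bundle (coeffSheaf ρ σ)) : Multiplicative (pointsRep σ) →* Mumford E :=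
  (Mumford.inl E).comp (AddMonoidHom.toMultiplicative (constant ρ σ))

end Classes

section Extensions

/-- `1 → M → G → W → 1` is an extension of `W` by the `W`-module `M`. -/
structure IsExtension (M : Rep.{u + 1} IntRing.{u} W) {G : Type*} [Group G]
    (i : Multiplicative M →* G) (p : G →* W) : Prop where
  injective : Function.Injective i
  range_eq_ker : i.range = p.ker
  surjective : Function.Surjective p
  conj (g : G) (m : M) :
    g * i (Multiplicative.ofAdd m) * g⁻¹ = i (Multiplicative.ofAdd (M.ρ (p g) m))

/-- `x` is the class in `H²(W, M)` of an extension `1 → M → G → W → 1`: it is the class of the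
factor set `f` of some set-theoretic section `s`, `s(w)s(v) = f(w,v)s(wv)`. -/
def IsExtensionClass (M : Rep.{u + 1} IntRing.{u} W) {G : Type*} [Group G]
    (i : Multiplicative M →* G) (p : G →* W) (x : groupCohomology M 2) : Prop :=
  ∃ (s : W → G) (f : groupCohomology.cocycles₂ M), (∀ w, p (s w) = w) ∧
    (∀ w v, s w * s v = i (Multiplicative.ofAdd (f (w, v))) * s (w * v)) ∧
    x = groupCohomology.H2π M f

end Extensions

section DoubleComplex

/-- Families of elements of the groups `C^p(W, K^q)` of the double complex of inhomogeneous
cochains of `W` with values in a complex of `W`-modules. -/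
abbrev DoubleCochain (K : CochainComplex (Rep.{u + 1} IntRing.{u} W) ℕ) : Type (u + 1) :=
  ∀ p q : ℕ, (Fin p → W) → K.X q

namespace DoubleCochain

variable {K : CochainComplex (Rep.{u + 1} IntRing.{u} W) ℕ}

/-- The differential of the group cochains. -/
def horizontal : DoubleCochain K →+ DoubleCochain K where
  toFun x
    | 0, _ => 0
    | p + 1, q => inhomogeneousCochains.d (K.X q) p (x p q)
  map_zero' := by
    funext p q
    cases p with
    | zero => rfl
    | succ p => exact map_zero (inhomogeneousCochains.d (K.X q) p).hom
  map_add' x y := by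
    funext p q
    cases p with
    | zero => exact (add_zero 0).symm
    | succ p => exact map_add (inhomogeneousCochains.d (K.X q) p).hom (x p q) (y p q)

/-- The differential of the coefficients. -/
def vertical : DoubleCochain K →+ DoubleCochain K where
  toFun x
    | _, 0 => 0
    | p, q + 1 => fun g => K.d q (q + 1) (x p q g)
  map_zero' := by
    funext p q
    cases q with
    | zero => rfl
    | succ q => exact funext fun g => map_zero (K.d q (q + 1)).hom
  map_add' x y := by
    funext p q
    cases q with
    | zero => exact (add_zero 0).symm
    | succ q => exact funext fun g => map_add (K.d q (q + 1)).hom (x p q g) (y p q g)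

lemma horizontal_horizontal (x : DoubleCochain K) : horizontal (horizontal x) = 0 := by
  funext p q
  match p with
  | 0 => rfl
  | 1 => exact map_zero (inhomogeneousCochains.d (K.X q) 0).hom
  | p + 2 =>
    exact ConcreteCategory.congr_hom (groupCohomology.inhomogeneousCochains.d_comp_d (A := K.X q) p)
      (x p q)

lemma vertical_vertical (x : DoubleCochain K) : vertical (vertical x) = 0 := by
  funext p q
  match q with
  | 0 => rfl
  | 1 => exact funext fun g => map_zero (K.d 0 1).hom
  | q + 2 =>
    exact funext fun g => ConcreteCategory.congr_hom (K.d_comp_d q (q + 1) (q + 2)) (x p q g)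

lemma horizontal_vertical (x : DoubleCochain K) :
    horizontal (vertical x) = vertical (horizontal x) := by
  funext p q
  match p, q with
  | 0, 0 => rfl
  | 0, q + 1 => exact funext fun g => (map_zero (K.d q (q + 1)).hom).symm
  | p + 1, 0 => exact map_zero (inhomogeneousCochains.d (K.X 0) p).hom
  | p + 1, q + 1 =>
    funext g
    change inhomogeneousCochains.d (K.X (q + 1)) p (fun g => K.d q (q + 1) (x p q g)) g =
      K.d q (q + 1) (inhomogeneousCochains.d (K.X q) p (x p q) g)
    simp [inhomogeneousCochains.d_hom_apply, Rep.hom_comm_apply]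

/-- Multiplication by `(-1)^p` on the cells of bidegree `(p, q)`. -/
def sign : DoubleCochain K →+ DoubleCochain K where
  toFun x p q := (-1 : ℤ) ^ p • x p q
  map_zero' := by
    funext p q
    exact smul_zero _
  map_add' x y := by
    funext p q
    exact smul_add _ _ _

lemma sign_sign (x : DoubleCochain K) : sign (sign x) = x := by
  funext p q
  change (-1 : ℤ) ^ p • (-1 : ℤ) ^ p • x p q = x p q
  rw [smul_smul, ← mul_pow]
  simp

lemma horizontal_sign (x : DoubleCochain K) : horizontal (sign x) = - sign (horizontal x) := by
  funext p q
  match p with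
  | 0 =>
    change (0 : (Fin 0 → W) → K.X q) = - ((-1 : ℤ) ^ 0 • 0)
    simp
  | p + 1 =>
    refine (map_zsmul (inhomogeneousCochains.d (K.X q) p).hom _ (x p q)).trans ?_
    change _ = - ((-1 : ℤ) ^ (p + 1) • (inhomogeneousCochains.d (K.X q) p).hom (x p q))
    rw [pow_succ, mul_neg_one, neg_smul, neg_neg]

lemma vertical_sign (x : DoubleCochain K) : vertical (sign x) = sign (vertical x) := by
  funext p q
  match q with
  | 0 => exact (smul_zero _).symm
  | q + 1 => exact funext fun g => map_zsmul (K.d q (q + 1)).hom _ (x p q g)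

variable (K) in
/-- The total differential, `d' + (-1)^p d''` on the cell of bidegree `(p, q)`. -/
def D : DoubleCochain K →+ DoubleCochain K := horizontal + sign.comp vertical

lemma D_apply (x : DoubleCochain K) : D K x = horizontal x + sign (vertical x) := rfl

lemma D_D (x : DoubleCochain K) : D K (D K x) = 0 := by
  simp only [D_apply, map_add, horizontal_horizontal, horizontal_sign, horizontal_vertical,
    vertical_sign, sign_sign, vertical_vertical]
  simp

variable (K) in
/-- The cochains of total degree `n`. -/
def degree (n : ℤ) : AddSubgroup (DoubleCochain K) where
  carrier := {x | ∀ p q : ℕ, (p : ℤ) + q ≠ n → x p q = 0}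
  zero_mem' _ _ _ := rfl
  add_mem' hx hy p q h := by simp [hx p q h, hy p q h]
  neg_mem' hx p q h := by simp [hx p q h]

variable (K) in
/-- The filtration by the degree `p` of the group cochains. -/
def filtration (s : ℤ) : AddSubgroup (DoubleCochain K) where
  carrier := {x | ∀ p q : ℕ, (p : ℤ) < s → x p q = 0}
  zero_mem' _ _ _ := rfl
  add_mem' hx hy p q h := by simp [hx p q h, hy p q h]
  neg_mem' hx p q h := by simp [hx p q h]

lemma D_mem_degree {n : ℤ} {x : DoubleCochain K} (hx : x ∈ degree K n) :
    D K x ∈ degree K (n + 1) := by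
  intro p q h
  have h₁ : horizontal x p q = 0 := by
    match p with
    | 0 => rfl
    | p + 1 =>
      refine (congrArg (inhomogeneousCochains.d (K.X q) p) (hx p q fun h' => h ?_)).trans
        (map_zero (inhomogeneousCochains.d (K.X q) p).hom)
      push_cast
      omega
  have h₂ : vertical x p q = 0 := by
    match q with
    | 0 => rfl
    | q + 1 =>
      refine funext fun g => (congrArg (K.d q (q + 1)) (congrFun (hx p q fun h' => h ?_) g)).trans
        (map_zero (K.d q (q + 1)).hom)
      push_cast
      omega
  change horizontal x p q + (-1 : ℤ) ^ p • vertical x p q = 0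
  rw [h₁, h₂, smul_zero, add_zero]

variable (K) in
/-- `Z_r^p` in total degree `n`: the cochains in `F^p` whose differential is in `F^{p+r}`. -/
def pageCycles (r p n : ℤ) : AddSubgroup (DoubleCochain K) :=
  degree K n ⊓ filtration K p ⊓ (filtration K (p + r)).comap (D K)

variable (K) in
/-- `Z_{r-1}^{p+1} + D Z_{r-1}^{p-r+1}` in total degree `n`. -/
def pageBoundaries (r p n : ℤ) : AddSubgroup (DoubleCochain K) :=
  pageCycles K (r - 1) (p + 1) n ⊔ (pageCycles K (r - 1) (p - r + 1) (n - 1)).map (D K)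

variable (K) in
/-- The term `E_r^{p,n-p}` of the spectral sequence of the double complex. -/
abbrev Page (r p n : ℤ) : Type (u + 1) :=
  pageCycles K r p n ⧸ (pageBoundaries K r p n).addSubgroupOf (pageCycles K r p n)

lemma D_mem_pageCycles {r p p' n n' : ℤ} (hp : p' = p + r) (hn : n' = n + 1)
    {x : DoubleCochain K} (hx : x ∈ pageCycles K r p n) : D K x ∈ pageCycles K r p' n' := by
  subst hp hn
  refine ⟨⟨D_mem_degree hx.1.1, hx.2⟩, ?_⟩
  change D K (D K x) ∈ filtration K (p + r + r)
  rw [D_D]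
  exact zero_mem (filtration K _)

lemma D_mem_pageBoundaries {r p p' n n' : ℤ} (hp : p' = p + r) (hn : n' = n + 1)
    {x : DoubleCochain K} (hx : x ∈ pageBoundaries K r p n) : D K x ∈ pageBoundaries K r p' n' := by
  subst hp hn
  obtain ⟨y, hy, _, ⟨z, -, rfl⟩, rfl⟩ := AddSubgroup.mem_sup.1 hx
  rw [map_add, D_D, add_zero]
  refine AddSubgroup.mem_sup_right ⟨y, ?_, rfl⟩
  rwa [add_sub_cancel_right, add_sub_cancel_right]

variable (K) in
/-- The differential `d_r` of the spectral sequence, from `E_r^{p,n-p}` to `E_r^{p',n'-p'}` for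
`p' = p + r` and `n' = n + 1`. -/
def differential (r : ℤ) {p p' n n' : ℤ} (hp : p' = p + r) (hn : n' = n + 1) :
    Page K r p n →+ Page K r p' n' :=
  QuotientAddGroup.map _ _
    (((D K).comp (pageCycles K r p n).subtype).codRestrict (pageCycles K r p' n')
      fun x => D_mem_pageCycles hp hn x.2)
    fun _ hx => D_mem_pageBoundaries hp hn hx

variable (K) in
/-- The cocycles of total degree `n`. -/
def totalCycles (n : ℤ) : AddSubgroup (DoubleCochain K) := degree K n ⊓ (D K).ker

variable (K) in
/-- The cohomology of the total complex in degree `n`. -/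
abbrev TotalCohomology (n : ℤ) : Type (u + 1) :=
  totalCycles K n ⧸ ((degree K (n - 1)).map (D K)).addSubgroupOf (totalCycles K n)

end DoubleCochain

end DoubleComplex

section SpectralSequence

variable {ρ : W →* Aut Z} {A : Sheaf (QuotSite.topology ρ) Ab.{u + 1}}

/-- The complex of `W`-modules `Γ(Z, I⁰) → Γ(Z, I¹) → ⋯`. -/
abbrev sectionsComplex (I : InjectiveResolution A) :
    CochainComplex (Rep.{u + 1} IntRing.{u} W) ℕ :=
  ((globalSections ρ).mapHomologicalComplex _).obj I.cocomplex

/-- `e` is the identification of `E₂^{p,q}` with `H^p(W, H^q(Z, A))`: it sends the class of `z` to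
the class of the cocycle `g ↦ [z^{p,q}(g)]`. -/
def IsSecondPageIso (I : InjectiveResolution A) (p q : ℕ)
    (e : DoubleCochain.Page (sectionsComplex I) 2 p (p + q) ≃+
      groupCohomology (((globalSections ρ).rightDerived q).obj A) p) : Prop :=
  ∀ z : DoubleCochain.pageCycles (sectionsComplex I) 2 p (p + q),
    ∃ f : groupCohomology.cocycles (((globalSections ρ).rightDerived q).obj A) p,
      (∀ g : Fin p → W, IsDerivedClass (globalSections ρ) I q (z.1 p q g)
        (groupCohomology.iCocycles (((globalSections ρ).rightDerived q).obj A) p f g)) ∧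
      e (QuotientAddGroup.mk z) =
        groupCohomology.π (((globalSections ρ).rightDerived q).obj A) p f

/-- `a` is the identification of the derived functors of `Γ^W ∘ Γ_Z` with the cohomology of the
total complex: it sends the class of an invariant section `y` of `Iⁿ` to the class of the cochain
with value `y` in bidegree `(0, n)`, and zero elsewhere. -/
def IsAbutmentIso (I : InjectiveResolution A) (n : ℕ)
    (a : ((invariantSections ρ).rightDerived n).obj A ≃+
      DoubleCochain.TotalCohomology (sectionsComplex I) n) : Prop :=
  ∀ (y : ((globalSections ρ).obj (I.cocomplex.X n)).ρ.invariants)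
    (h : ((invariantSections ρ).rightDerived n).obj A),
    IsDerivedClass (invariantSections ρ) I n y h →
    ∃ z : DoubleCochain.totalCycles (sectionsComplex I) n, (∀ g, z.1 0 n g = y.1) ∧
      (∀ p q : ℕ, p ≠ 0 → z.1 p q = 0) ∧ a h = QuotientAddGroup.mk z

end SpectralSequence

section Curves

variable [Finite W]

/-- Smooth projective curves over a field `k`. For a smooth curve, to be projective is the same as
to be proper. -/
structure IsSmoothProjectiveCurve {k : Type u} [Field k] (X : Over (Spec (.of k))) : Prop where
  isIntegral : IsIntegral X.left
  isProper : IsProper X.hom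
  smooth : SmoothOfRelativeDimension 1 X.hom

/-- The map `(z)_w ↦ (z, w z)` from the disjoint union of copies of `Z` indexed by `W` to
`Z ×_X Z`. -/
def galoisMap {X : Over S} (π : Z ⟶ X) (ρ : W →* Aut Z) (hπ : ∀ w, (ρ w).hom ≫ π = π) :
    (∐ fun _ : W => Z.left) ⟶ pullback π.left π.left :=
  Sigma.desc fun w => pullback.lift (𝟙 _) (actHom ρ w) (by
    rw [Category.id_comp]
    exact (congrArg (fun f => Over.Hom.left f) (hπ w)).symm)

/-- `π : Z → X` is an étale Galois cover with group `W`, acting through `ρ`. -/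
structure IsEtaleGaloisCover {X : Over S} (π : Z ⟶ X) (ρ : W →* Aut Z) : Prop where
  finite : IsFinite π.left
  etale : Etale π.left
  comp (w : W) : (ρ w).hom ≫ π = π
  isIso : IsIso (galoisMap π ρ comp)

end Curves

end EquivariantCurve

end

open EquivariantCurve

/-! Everything is read off from an injective resolution `0 → A → I⁰ → I¹ → ⋯` by equivariant
sheaves, where `A` is the sheaf of sections of `T`. Since `I⁰` is injective, a bundle `E` has an
`A`-equivariant map `φ` to `I⁰`. The differential of `φ` does not change under `A`, so it descends
to a closed global section `a` of `I¹`, and `E` becomes the bundle of local primitives of `a`.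
Another choice of `φ` changes `a` by the differential of a global section of `I⁰`, and conversely
translation by such a section is an isomorphism of bundles. Hence bundles are classified by `H¹(Z,
A)`, and contracted products and twists are visible on `a`. The lemmas are
`nonempty_trivialization`, `Trivialization.exists_app_eq`, `cl_eq_cl_iff` and `cl_surjective`.

For an element `x = (w, γ)` of the Mumford group, comparing `φ` with its twist along `γ` gives a
global section `cochain x` of `I⁰` whose differential is `w a - a`. It is a crossed homomorphism
(`cochain_mul`), and together with the weight it embeds the Mumford group in the semidirect product
of `Γ(Z, I⁰)` by `W` (`eq_of_cochain_eq`). The extension property is checked there. Applied to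
`s(w)s(v) = f(w,v)s(wv)`, the crossed homomorphism rule says that `f` becomes, in `Γ(Z, I⁰)`, the
coboundary of `w ↦ cochain (s w)`.

This is exactly the recipe for `d₂`: the total cochain with entry `a` in bidegree `(0,1)` and `w ↦
cochain (s w)` in bidegree `(1,0)` has total differential `f`, placed in bidegree `(2,0)`. So `d₂`
takes the class of `E` to the class of `f` (`secondPage_differential`). The map `c` is defined as
`d₂` followed by the inverse of `H²(W, T(k)) → H²(W, H⁰(Z, T))`; its additivity is then automatic.

Three inputs remain. The second page is the usual argument for a double complex filtered by columns
(`pageEquiv`). The abutment needs the rows to be exact in positive degrees, which holds because an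
injective sheaf is a retract of a coinduced presheaf (`exists_cochain_primitive_of_injective`).
Finally `T(k) = H⁰(Z, T)` because the global functions on `Z` are `k`: this settles affine `T`, and
an étale `T` is discrete, so the irreducible `Z` maps to one point of it (`constant_bijective`). -/

noncomputable section

namespace EquivariantCurve

/-! ### Cohomology of complexes of modules and of representations, by elements. -/

section ElementwiseHomology

namespace ModuleCohomology

variable {R : Type*} [Ring R] (K : CochainComplex (ModuleCat.{u} R) ℕ) (n : ℕ)

lemma iCycles_injective : Function.Injective (K.iCycles n) :=
  (ModuleCat.mono_iff_injective _).1 inferInstance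

lemma homologyπ_surjective : Function.Surjective (K.homologyπ n) :=
  (ModuleCat.epi_iff_surjective _).1 inferInstance

lemma d_iCycles (z : K.cycles n) : K.d n (n + 1) (K.iCycles n z) = 0 := by
  rw [← ConcreteCategory.comp_apply, K.iCycles_d]
  rfl

lemma exists_cycle {a : K.X n} (ha : K.d n (n + 1) a = 0) : ∃ z, K.iCycles n z = a := by
  have h := (ShortComplex.exact_of_f_is_kernel (ShortComplex.mk (K.iCycles n) (K.d n (n + 1))
    (K.iCycles_d n (n + 1))) (K.cyclesIsKernel n (n + 1) (by simp)))
  rw [ShortComplex.moduleCat_exact_iff] at h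
  exact h a ha

/-- With the index given as `prev n`, degree zero is included: there `prev 0 = 0` and `d 0 0 = 0`,
so that being a boundary means being zero. -/
lemma homologyπ_eq_zero_iff {i : ℕ} (hi : (ComplexShape.up ℕ).prev n = i) (z : K.cycles n) :
    K.homologyπ n z = 0 ↔ ∃ b, K.d i n b = K.iCycles n z := by
  have h := (ShortComplex.exact_of_g_is_cokernel (ShortComplex.mk (K.toCycles i n) (K.homologyπ n)
    (K.toCycles_comp_homologyπ i n)) (K.homologyIsCokernel i n hi))
  rw [ShortComplex.moduleCat_exact_iff] at h
  constructor
  · intro hz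
    obtain ⟨b, hb⟩ := h z hz
    refine ⟨b, ?_⟩
    rw [← hb, ← K.toCycles_i i n]
    rfl
  · rintro ⟨b, hb⟩
    have : K.toCycles i n b = z := iCycles_injective K n (by
      rw [← hb, ← K.toCycles_i i n]
      rfl)
    rw [← this, ← ConcreteCategory.comp_apply, K.toCycles_comp_homologyπ]
    rfl

end ModuleCohomology

namespace RepCohomology

variable {R : Type*} [CommRing R] {G : Type*} [Group G]

lemma exists_of_exact {S : ShortComplex (Rep.{u} R G)} (hS : S.Exact) {x : S.X₂}
    (hx : S.g x = 0) : ∃ y, S.f y = x := by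
  have : (forget₂ (Rep.{u} R G) (ModuleCat.{u} R)).PreservesHomology := inferInstance
  have h := hS.map (forget₂ (Rep.{u} R G) (ModuleCat.{u} R))
  rw [ShortComplex.moduleCat_exact_iff] at h
  exact h x hx

variable (K : CochainComplex (Rep.{u} R G) ℕ) (n : ℕ)

lemma iCycles_injective : Function.Injective (K.iCycles n) :=
  (Rep.mono_iff_injective _).1 inferInstance

lemma homologyπ_surjective : Function.Surjective (K.homologyπ n) :=
  (Rep.epi_iff_surjective _).1 inferInstance

lemma d_iCycles (z : K.cycles n) : K.d n (n + 1) (K.iCycles n z) = 0 := by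
  rw [← ConcreteCategory.comp_apply, K.iCycles_d]
  rfl

lemma exists_cycle {a : K.X n} (ha : K.d n (n + 1) a = 0) : ∃ z, K.iCycles n z = a :=
  exists_of_exact (ShortComplex.exact_of_f_is_kernel (ShortComplex.mk (K.iCycles n) (K.d n (n + 1))
    (K.iCycles_d n (n + 1))) (K.cyclesIsKernel n (n + 1) (by simp))) ha

lemma homologyπ_eq_zero_iff {i : ℕ} (hi : (ComplexShape.up ℕ).prev n = i) (z : K.cycles n) :
    K.homologyπ n z = 0 ↔ ∃ b, K.d i n b = K.iCycles n z := by
  have h := (ShortComplex.exact_of_g_is_cokernel (ShortComplex.mk (K.toCycles i n) (K.homologyπ n)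
    (K.toCycles_comp_homologyπ i n)) (K.homologyIsCokernel i n hi))
  constructor
  · intro hz
    obtain ⟨b, hb⟩ := exists_of_exact h hz
    refine ⟨b, ?_⟩
    rw [← hb, ← K.toCycles_i i n]
    rfl
  · rintro ⟨b, hb⟩
    have : K.toCycles i n b = z := iCycles_injective K n (by
      rw [← hb, ← K.toCycles_i i n]
      rfl)
    rw [← this, ← ConcreteCategory.comp_apply, K.toCycles_comp_homologyπ]
    rfl

end RepCohomology

end ElementwiseHomology

/-! ### Calculus of cocycles that represent classes of derived functors. -/

section DerivedClasses

variable {S : Scheme.{u}} {Z : Over S} {W : Type (u + 1)} [Group W] {ρ : W →* Aut Z}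
  {A : Sheaf (QuotSite.topology ρ) Ab.{u + 1}}

instance : (invariantSections ρ).Additive where
  map_add {_ _ f g} := by ext x; rfl

namespace IsDerivedClass

variable {I : InjectiveResolution A} {n : ℕ}

/-- The cohomology class, as a class in the cohomology of the complex of sections. -/
abbrev homologyEquiv (I : InjectiveResolution A) (n : ℕ) :
    ((globalSections ρ).rightDerived n).obj A ≅ (sectionsComplex I).homology n :=
  I.isoRightDerivedObj (globalSections ρ) n

lemma d_eq_zero {a : (sectionsComplex I).X n} {h : ((globalSections ρ).rightDerived n).obj A}
    (H : IsDerivedClass (globalSections ρ) I n a h) : (sectionsComplex I).d n (n + 1) a = 0 := by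
  obtain ⟨z, rfl, -⟩ := H
  exact RepCohomology.d_iCycles _ n z

lemma exists_of_d_eq_zero {a : (sectionsComplex I).X n}
    (ha : (sectionsComplex I).d n (n + 1) a = 0) :
    ∃ h : ((globalSections ρ).rightDerived n).obj A, IsDerivedClass (globalSections ρ) I n a h := by
  obtain ⟨z, hz⟩ := RepCohomology.exists_cycle _ n ha
  refine ⟨(homologyEquiv I n).inv ((sectionsComplex I).homologyπ n z), z, hz, ?_⟩
  exact (ConcreteCategory.congr_hom (homologyEquiv I n).inv_hom_id _).symm

lemma exists_cocycle (I : InjectiveResolution A) (n : ℕ)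
    (h : ((globalSections ρ).rightDerived n).obj A) :
    ∃ a : (sectionsComplex I).X n, IsDerivedClass (globalSections ρ) I n a h := by
  obtain ⟨z, hz⟩ := RepCohomology.homologyπ_surjective (sectionsComplex I) n
    ((homologyEquiv I n).hom h)
  exact ⟨_, z, rfl, hz⟩

lemma add {a a' : (sectionsComplex I).X n} {h h' : ((globalSections ρ).rightDerived n).obj A}
    (H : IsDerivedClass (globalSections ρ) I n a h)
    (H' : IsDerivedClass (globalSections ρ) I n a' h') :
    IsDerivedClass (globalSections ρ) I n (a + a' : (sectionsComplex I).X n) (h + h') := by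
  obtain ⟨z, hz, e⟩ := H
  obtain ⟨z', hz', e'⟩ := H'
  refine ⟨z + z', ?_, ?_⟩
  · rw [← hz, ← hz']
    exact map_add ((sectionsComplex I).iCycles n).hom z z'
  · refine (map_add ((sectionsComplex I).homologyπ n).hom z z').trans ?_
    refine Eq.trans ?_ (map_add (homologyEquiv I n).hom.hom h h').symm
    exact congrArg₂ (· + ·) e e'

lemma neg {a : (sectionsComplex I).X n} {h : ((globalSections ρ).rightDerived n).obj A}
    (H : IsDerivedClass (globalSections ρ) I n a h) :
    IsDerivedClass (globalSections ρ) I n (-a : (sectionsComplex I).X n) (-h) := by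
  obtain ⟨z, hz, e⟩ := H
  refine ⟨-z, ?_, ?_⟩
  · rw [← hz]
    exact map_neg ((sectionsComplex I).iCycles n).hom z
  · refine (map_neg ((sectionsComplex I).homologyπ n).hom z).trans ?_
    refine Eq.trans ?_ (map_neg (homologyEquiv I n).hom.hom h).symm
    exact congrArg _ e

lemma act {a : (sectionsComplex I).X n} {h : ((globalSections ρ).rightDerived n).obj A}
    (H : IsDerivedClass (globalSections ρ) I n a h) (w : W) :
    IsDerivedClass (globalSections ρ) I n (((sectionsComplex I).X n).ρ w a)
      ((((globalSections ρ).rightDerived n).obj A).ρ w h) := by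
  obtain ⟨z, hz, e⟩ := H
  refine ⟨((sectionsComplex I).cycles n).ρ w z, ?_, ?_⟩
  · rw [← hz]
    exact Rep.hom_comm_apply ((sectionsComplex I).iCycles n) w z
  · refine (Rep.hom_comm_apply ((sectionsComplex I).homologyπ n) w z).trans ?_
    refine Eq.trans ?_ (Rep.hom_comm_apply (homologyEquiv I n).hom w h).symm
    exact congrArg _ e

lemma zero_iff {a : (sectionsComplex I).X n} {h : ((globalSections ρ).rightDerived n).obj A}
    (H : IsDerivedClass (globalSections ρ) I n a h) {i : ℕ}
    (hi : (ComplexShape.up ℕ).prev n = i) :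
    h = 0 ↔ ∃ b, (sectionsComplex I).d i n b = a := by
  obtain ⟨z, rfl, e⟩ := H
  refine Iff.trans ?_ (RepCohomology.homologyπ_eq_zero_iff (sectionsComplex I) n hi z)
  have e' : (sectionsComplex I).homologyπ n z = (homologyEquiv I n).hom h := e
  rw [e']
  refine ⟨fun h0 => ?_, fun h0 => ?_⟩
  · rw [h0]; exact map_zero (homologyEquiv I n).hom.hom
  · refine (ConcreteCategory.congr_hom (homologyEquiv I n).hom_inv_id h).symm.trans ?_
    refine (congrArg (homologyEquiv I n).inv h0).trans ?_
    exact map_zero (homologyEquiv I n).inv.hom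

lemma sub {a a' : (sectionsComplex I).X n} {h h' : ((globalSections ρ).rightDerived n).obj A}
    (H : IsDerivedClass (globalSections ρ) I n a h)
    (H' : IsDerivedClass (globalSections ρ) I n a' h') :
    IsDerivedClass (globalSections ρ) I n (a - a' : (sectionsComplex I).X n) (h - h') := by
  rw [sub_eq_add_neg, sub_eq_add_neg]
  exact H.add H'.neg

lemma eq_iff {a a' : (sectionsComplex I).X n} {h h' : ((globalSections ρ).rightDerived n).obj A}
    (H : IsDerivedClass (globalSections ρ) I n a h)
    (H' : IsDerivedClass (globalSections ρ) I n a' h') {i : ℕ}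
    (hi : (ComplexShape.up ℕ).prev n = i) :
    h = h' ↔ ∃ b, (sectionsComplex I).d i n b = a - a' := by
  rw [← sub_eq_zero]
  exact (H.sub H').zero_iff hi

lemma unique {a : (sectionsComplex I).X n} {h h' : ((globalSections ρ).rightDerived n).obj A}
    (H : IsDerivedClass (globalSections ρ) I n a h)
    (H' : IsDerivedClass (globalSections ρ) I n a h') : h = h' :=
  (H.eq_iff H' rfl).2 ⟨0, by rw [sub_self]; exact map_zero ((sectionsComplex I).d _ _).hom⟩

/-- Naturality of `isoRightDerivedObj` for the identity of `A`. It is what makes the class of a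
bundle independent of the resolution. -/
lemma change {J : InjectiveResolution A} (φ : I.cocomplex ⟶ J.cocomplex)
    (hφ : I.ι.f 0 ≫ φ.f 0 = J.ι.f 0)
    {a : (sectionsComplex I).X n} {h : ((globalSections ρ).rightDerived n).obj A}
    (H : IsDerivedClass (globalSections ρ) I n a h) :
    IsDerivedClass (globalSections ρ) J n
      ((((globalSections ρ).mapHomologicalComplex _).map φ).f n a : (sectionsComplex J).X n) h := by
  obtain ⟨z, rfl, e⟩ := H
  let Φ : sectionsComplex I ⟶ sectionsComplex J :=
    ((globalSections ρ).mapHomologicalComplex _).map φ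
  refine ⟨HomologicalComplex.cyclesMap Φ n z, ?_, ?_⟩
  · exact ConcreteCategory.congr_hom (HomologicalComplex.cyclesMap_i Φ n) z
  · have h1 := InjectiveResolution.isoRightDerivedObj_hom_naturality (𝟙 A) I J φ
      (hφ.trans (Category.id_comp _).symm) (globalSections ρ) n
    rw [CategoryTheory.Functor.map_id, Category.id_comp] at h1
    refine (ConcreteCategory.congr_hom (HomologicalComplex.homologyπ_naturality Φ n) z).symm.trans ?_
    refine Eq.trans ?_ (ConcreteCategory.congr_hom h1 h).symm
    exact congrArg _ e

lemma toRightDerivedZero (I : InjectiveResolution A)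
    (t : (globalSections ρ).obj A) :
    IsDerivedClass (globalSections ρ) I 0 ((globalSections ρ).map (I.ι.f 0) t)
      ((globalSections ρ).toRightDerivedZero.app A t) := by
  refine ⟨I.toRightDerivedZero' (globalSections ρ) t, ?_, ?_⟩
  · exact ConcreteCategory.congr_hom
      (InjectiveResolution.toRightDerivedZero'_comp_iCycles I (globalSections ρ)) t
  · have h : (globalSections ρ).toRightDerivedZero.app A ≫ (homologyEquiv I 0).hom =
        I.toRightDerivedZero' (globalSections ρ) ≫ (sectionsComplex I).homologyπ 0 :=
      (Iso.eq_comp_inv (homologyEquiv I 0)).1 ((InjectiveResolution.toRightDerivedZero_eq I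
        (globalSections ρ)).trans (Category.assoc _ _ _).symm)
    exact (ConcreteCategory.congr_hom h t).symm

end IsDerivedClass

end DerivedClasses

/-! ### Sections of sheaves of abelian groups: gluing, exactness, injectivity. -/

section SheafLemmas

variable {C : Type (u + 1)} [Category.{u + 1} C] {J : GrothendieckTopology C}

lemma sheaf_isSheafFor (F : Sheaf J Ab.{u + 1}) {U : C} {R : Sieve U} (hR : R ∈ J U) :
    Presieve.IsSheafFor (F.obj ⋙ forget Ab.{u + 1}) (R : Presieve U) :=
  (isSheaf_iff_isSheaf_of_type _ _).1
    ((Presheaf.isSheaf_iff_isSheaf_forget J F.obj (forget Ab.{u + 1})).1 F.property) R hR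

lemma sheaf_section_ext (F : Sheaf J Ab.{u + 1}) {U : C} {R : Sieve U} (hR : R ∈ J U)
    {a b : F.obj.obj (op U)}
    (h : ∀ ⦃V : C⦄ (f : V ⟶ U), R f → F.obj.map f.op a = F.obj.map f.op b) : a = b :=
  (sheaf_isSheafFor F hR).isSeparatedFor.ext fun _ f hf => h f hf

lemma sheaf_exists_glue (F : Sheaf J Ab.{u + 1}) {U : C} {R : Sieve U} (hR : R ∈ J U)
    (x : ∀ ⦃V : C⦄ (f : V ⟶ U), R f → F.obj.obj (op V))
    (hx : ∀ ⦃V V' : C⦄ (g : V' ⟶ V) (f : V ⟶ U) (hf : R f),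
      x (g ≫ f) (R.downward_closed hf g) = F.obj.map g.op (x f hf)) :
    ∃ a : F.obj.obj (op U), ∀ ⦃V : C⦄ (f : V ⟶ U) (hf : R f), F.obj.map f.op a = x f hf := by
  obtain ⟨a, ha, -⟩ := sheaf_isSheafFor F hR (fun V f hf => x f hf)
    ((Presieve.compatible_iff_sieveCompatible _).2 fun V V' f g hf => hx g f hf)
  exact ⟨a, fun V f hf => ha f hf⟩

/-- The inclusion of sheaves in presheaves is right adjoint to the exact functor of sheafification.
Maps to an injective sheaf can therefore be extended along monomorphisms of presheaves, such as
`toProduct` and `toCoinduced`, whose targets need not be shown to be sheaves. -/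
instance injective_presheaf (F : Sheaf J Ab.{u + 1}) [Injective F] : Injective F.obj :=
  Injective.injective_of_adjoint (sheafificationAdjunction J Ab.{u + 1}) F

/-- Sections of sheaves over `U`. -/
abbrev sectionsAt (J : GrothendieckTopology C) (U : C) : Sheaf J Ab.{u + 1} ⥤ Ab.{u + 1} :=
  sheafToPresheaf J _ ⋙ (evaluation _ _).obj (op U)

lemma sections_exact {F₁ F₂ F₃ : Sheaf J Ab.{u + 1}} {f : F₁ ⟶ F₂} {g : F₂ ⟶ F₃} (w : f ≫ g = 0)
    (h : IsLimit (KernelFork.ofι f w)) (U : C) (x : F₂.obj.obj (op U))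
    (hx : g.hom.app (op U) x = 0) : ∃ t, f.hom.app (op U) t = x := by
  have h' := KernelFork.mapIsLimit _ h (sectionsAt J U)
  have h'' : (ShortComplex.mk ((sectionsAt J U).map f) ((sectionsAt J U).map g) (by
      rw [← Functor.map_comp, w, Functor.map_zero])).Exact :=
    ShortComplex.exact_of_f_is_kernel _ h'
  rw [ShortComplex.ab_exact_iff] at h''
  exact h'' x hx

lemma sections_injective {F₁ F₂ : Sheaf J Ab.{u + 1}} (f : F₁ ⟶ F₂) [Mono f] (U : C) :
    Function.Injective (f.hom.app (op U)) :=
  (AddCommGrpCat.mono_iff_injective _).1 (inferInstanceAs (Mono ((sectionsAt J U).map f)))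

/-- Exactness makes the map to the sheaf of cycles an epimorphism, and an epimorphism of sheaves is
surjective only locally. -/
lemma sections_locally_exact {S : ShortComplex (Sheaf J Ab.{u + 1})} (hS : S.Exact) (U : C)
    (x : S.X₂.obj.obj (op U)) (hx : S.g.hom.app (op U) x = 0) :
    ∃ R ∈ J U, ∀ ⦃V : C⦄ (f : V ⟶ U), R f →
      ∃ y, S.f.hom.app (op V) y = S.X₂.obj.map f.op x := by
  obtain ⟨t, ht⟩ := sections_exact S.iCycles_g S.cyclesIsKernel U x hx
  have : Epi S.toCycles := hS.epi_toCycles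
  have : Sheaf.IsLocallySurjective S.toCycles := (Sheaf.isLocallySurjective_iff_epi' _ _).2 this
  refine ⟨_, Presheaf.imageSieve_mem J S.toCycles.hom t, fun V f hf => ?_⟩
  obtain ⟨y, hy⟩ := hf
  refine ⟨y, ?_⟩
  have h1 : S.f.hom.app (op V) y = S.iCycles.hom.app (op V) (S.toCycles.hom.app (op V) y) := by
    conv_lhs => rw [← S.toCycles_i]
    rfl
  rw [h1, hy, ← ht]
  exact ConcreteCategory.congr_hom (S.iCycles.hom.naturality f.op) t

end SheafLemmas

/-! ### The first terms of an injective resolution, on sections. -/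

section Resolutions

variable {S : Scheme.{u}} {Z : Over S} {W : Type (u + 1)} [Group W] {ρ : W →* Aut Z}
  {A : Sheaf (QuotSite.topology ρ) Ab.{u + 1}} (I : InjectiveResolution A)

/-- The augmentation of a resolution, on sections. -/
abbrev aug (U : QuotSite ρ) : A.obj.obj (op U) →+ (I.cocomplex.X 0).obj.obj (op U) :=
  ((I.ι.f 0).hom.app (op U)).hom

/-- The first differential of a resolution, on sections. -/
abbrev d0 (U : QuotSite ρ) :
    (I.cocomplex.X 0).obj.obj (op U) →+ (I.cocomplex.X 1).obj.obj (op U) :=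
  ((I.cocomplex.d 0 1).hom.app (op U)).hom

lemma aug_injective (U : QuotSite ρ) : Function.Injective (aug I U) :=
  sections_injective (I.ι.f 0) U

lemma d0_aug (U : QuotSite ρ) (t : A.obj.obj (op U)) : d0 I U (aug I U t) = 0 := by
  have h : I.ι.f 0 ≫ I.cocomplex.d 0 1 = 0 := I.ι_f_zero_comp_complex_d
  exact ConcreteCategory.congr_hom (congrArg (fun q => q.hom.app (op U)) h) t

lemma exists_aug (U : QuotSite ρ) {x : (I.cocomplex.X 0).obj.obj (op U)} (hx : d0 I U x = 0) :
    ∃ t, aug I U t = x :=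
  sections_exact I.ι_f_zero_comp_complex_d I.isLimitKernelFork U x hx

lemma aug_map {U V : QuotSite ρ} (f : U ⟶ V) (t : A.obj.obj (op V)) :
    aug I U (A.obj.map f.op t) = (I.cocomplex.X 0).obj.map f.op (aug I V t) :=
  ConcreteCategory.congr_hom ((I.ι.f 0).hom.naturality f.op) t

lemma d0_map {U V : QuotSite ρ} (f : U ⟶ V) (x : (I.cocomplex.X 0).obj.obj (op V)) :
    d0 I U ((I.cocomplex.X 0).obj.map f.op x) = (I.cocomplex.X 1).obj.map f.op (d0 I V x) :=
  ConcreteCategory.congr_hom ((I.cocomplex.d 0 1).hom.naturality f.op) x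

lemma exists_local_primitive (U : QuotSite ρ) {x : (I.cocomplex.X 1).obj.obj (op U)}
    (hx : (I.cocomplex.d 1 2).hom.app (op U) x = 0) :
    ∃ R ∈ QuotSite.topology ρ U, ∀ ⦃V : QuotSite ρ⦄ (f : V ⟶ U), R f →
      ∃ y, d0 I V y = (I.cocomplex.X 1).obj.map f.op x :=
  sections_locally_exact (I.exact_succ 0) U x hx

end Resolutions

/-! ### Passage between the small étale site and the equivariant site. -/

section Gluing

variable {S : Scheme.{u}} {Z : Over S} {W : Type (u + 1)} [Group W] {ρ : W →* Aut Z}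
  {A : Sheaf (QuotSite.topology ρ) Ab.{u + 1}}

/-- The source of a morphism of the site, as an étale scheme over its target. -/
def QuotSite.over {V U : QuotSite ρ} (f : V ⟶ U) : Z.left.Etale := Scheme.Etale.mk (f.map ≫ U.hom)

/-- The identity of the source of `f`, over the weight of `f`. -/
def QuotSite.toOverIncl {V U : QuotSite ρ} (f : V ⟶ U) :
    V ⟶ (QuotSite.incl ρ).obj (QuotSite.over f) :=
  ⟨f.weight, 𝟙 _, (Category.id_comp _).trans f.comm⟩

/-- The morphism between the sources of `g ≫ f` and `f`. -/
def QuotSite.overMap {V' V U : QuotSite ρ} (g : V' ⟶ V) (f : V ⟶ U) :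
    QuotSite.over (g ≫ f) ⟶ QuotSite.over f :=
  MorphismProperty.Over.homMk g.map (Category.assoc _ _ _).symm

lemma QuotSite.toOverIncl_overMap {V' V U : QuotSite ρ} (g : V' ⟶ V) (f : V ⟶ U) :
    QuotSite.toOverIncl (g ≫ f) ≫ (QuotSite.incl ρ).map (QuotSite.overMap g f) =
      g ≫ QuotSite.toOverIncl f :=
  QuotSite.hom_ext (one_mul _) ((Category.id_comp _).trans (Category.comp_id _).symm)

/-- The morphism over `U` that underlies `f`. -/
def QuotSite.fromOver {V : QuotSite ρ} {U : Z.left.Etale} (f : V ⟶ (QuotSite.incl ρ).obj U) :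
    QuotSite.over f ⟶ U :=
  MorphismProperty.Over.homMk f.map rfl

lemma QuotSite.toOverIncl_toTop {V : QuotSite ρ} (f : V ⟶ QuotSite.top ρ) :
    QuotSite.toOverIncl f ≫ Mumford.toTop ρ (QuotSite.over f) = f :=
  QuotSite.hom_ext (one_mul _) ((Category.id_comp _).trans (Category.comp_id _))

lemma functor_map_map {F : (QuotSite ρ)ᵒᵖ ⥤ Ab.{u + 1}} {U V Y : QuotSite ρ} (f : U ⟶ V)
    (g : V ⟶ Y) (x : F.obj (op Y)) : F.map f.op (F.map g.op x) = F.map (f ≫ g).op x := by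
  rw [op_comp, F.map_comp]
  rfl

lemma functor_map_id {F : (QuotSite ρ)ᵒᵖ ⥤ Ab.{u + 1}} {U : QuotSite ρ} (x : F.obj (op U)) :
    F.map (𝟙 U).op x = x := by
  rw [op_id, F.map_id]
  rfl

lemma sheaf_section_ext_etale (F : Sheaf (QuotSite.topology ρ) Ab.{u + 1}) {U : Z.left.Etale}
    {R : Sieve U} (hR : R ∈ Z.left.smallEtaleTopology U)
    {a b : F.obj.obj (op ((QuotSite.incl ρ).obj U))}
    (h : ∀ ⦃V : Z.left.Etale⦄ (f : V ⟶ U), R f →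
      F.obj.map ((QuotSite.incl ρ).map f).op a = F.obj.map ((QuotSite.incl ρ).map f).op b) :
    a = b := by
  have hR' : Sieve.functorPushforward (QuotSite.incl ρ) R ∈
      QuotSite.topology ρ ((QuotSite.incl ρ).obj U) := by
    intro y
    obtain ⟨V, f, hf, hy⟩ := (mem_smallEtaleTopology_iff' R).1 hR y
    exact ⟨_, _, Sieve.image_mem_functorPushforward _ _ hf, hy⟩
  refine sheaf_section_ext F hR' ?_
  rintro Y _ ⟨V, f, g, hf, rfl⟩
  rw [← functor_map_map, ← functor_map_map]
  exact congrArg _ (h f hf)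

/-- A morphism `f` to `U` in the equivariant site is the isomorphism `toOverIncl f`, which carries
the weight, followed by the morphism `fromOver f` of the small site. This extends a compatible
family on the small site to one on the larger sieve `R'`, where the sheaf condition applies. -/
lemma sheaf_exists_glue_etale (F : Sheaf (QuotSite.topology ρ) Ab.{u + 1}) {U : Z.left.Etale}
    {R : Sieve U} (hR : R ∈ Z.left.smallEtaleTopology U)
    (x : ∀ ⦃V : Z.left.Etale⦄ (f : V ⟶ U), R f → F.obj.obj (op ((QuotSite.incl ρ).obj V)))
    (hx : ∀ ⦃V V' : Z.left.Etale⦄ (g : V' ⟶ V) (f : V ⟶ U) (hf : R f),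
      x (g ≫ f) (R.downward_closed hf g) = F.obj.map ((QuotSite.incl ρ).map g).op (x f hf)) :
    ∃ b : F.obj.obj (op ((QuotSite.incl ρ).obj U)), ∀ ⦃V : Z.left.Etale⦄ (f : V ⟶ U) (hf : R f),
      F.obj.map ((QuotSite.incl ρ).map f).op b = x f hf := by
  have hx' : ∀ {V : Z.left.Etale} {f f' : V ⟶ U} (h : f = f') (hf : R f),
      x f hf = x f' (h ▸ hf) := by
    rintro V f _ rfl hf
    rfl
  have hcomp : ∀ {Y Y' : QuotSite ρ} (g : Y' ⟶ Y) (f : Y ⟶ (QuotSite.incl ρ).obj U),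
      QuotSite.fromOver (g ≫ f) = QuotSite.overMap g f ≫ QuotSite.fromOver f :=
    fun g f => etale_hom_ext rfl
  let R' : Sieve ((QuotSite.incl ρ).obj U) :=
    { arrows := fun _ f => R (QuotSite.fromOver f)
      downward_closed := fun {_ _ f} hf g => by
        rw [hcomp]
        exact R.downward_closed hf _ }
  -- For `f` in the small site, `over` returns `V` with a structure morphism that is only
  -- propositionally equal to the original one; `i` is the comparison.
  let i : ∀ {V : Z.left.Etale} (f : V ⟶ U), QuotSite.over ((QuotSite.incl ρ).map f) ⟶ V :=
    fun {V} f => MorphismProperty.Over.homMk (𝟙 _)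
      ((Category.id_comp _).trans (Over.w ((Scheme.Etale.forget _).map f)).symm)
  have hi : ∀ {V : Z.left.Etale} (f : V ⟶ U),
      QuotSite.fromOver ((QuotSite.incl ρ).map f) = i f ≫ f :=
    fun f => etale_hom_ext (Category.id_comp _).symm
  have hR' : R' ∈ QuotSite.topology ρ ((QuotSite.incl ρ).obj U) := by
    intro y
    obtain ⟨V, f, hf, hy⟩ := (mem_smallEtaleTopology_iff' R).1 hR y
    refine ⟨_, (QuotSite.incl ρ).map f, ?_, hy⟩
    change R (QuotSite.fromOver ((QuotSite.incl ρ).map f))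
    rw [hi]
    exact R.downward_closed hf _
  obtain ⟨b, hb⟩ := sheaf_exists_glue F hR'
    (fun V f hf => F.obj.map (QuotSite.toOverIncl f).op (x (QuotSite.fromOver f) hf))
    (fun V V' g f hf => by
      rw [hx' (hcomp g f), hx _ _ hf, functor_map_map, QuotSite.toOverIncl_overMap,
        ← functor_map_map])
  refine ⟨b, fun V f hf => ?_⟩
  have hf' : R (QuotSite.fromOver ((QuotSite.incl ρ).map f)) := by
    rw [hi]
    exact R.downward_closed hf _
  refine (hb _ hf').trans ?_
  rw [hx' (hi f), hx _ _ hf, functor_map_map]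
  refine Eq.trans ?_ (functor_map_id (F := F.obj) (x f hf))
  exact congrArg (fun q => F.obj.map (Quiver.Hom.op q) (x f hf))
    (QuotSite.hom_ext (one_mul _) (Category.id_comp _))

section LocalSections

variable {P : Z.left.Etale → Type (u + 1)} (res : ∀ {U V : Z.left.Etale}, (U ⟶ V) → P V → P U)
  (hP : ∀ U : Z.left.Etale, ∃ R ∈ Z.left.smallEtaleTopology U,
    ∀ (V : Z.left.Etale) (f : V ⟶ U), R f → Nonempty (P V))

/-- The morphisms to `U` on whose source the presheaf `P`, pulled back through `U`, has a
section. -/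
def sectionSieve (U : QuotSite ρ) : Sieve U where
  arrows _ f := Nonempty (P (QuotSite.over f))
  downward_closed {_ _ f} hf g := hf.map (res (QuotSite.overMap g f))

-- Local sections of `P` on the small site suffice to cover in the equivariant site. The presheaf
-- `P` is kept general because it is used both for the sections of one bundle and for pairs of
-- sections of two bundles.
include hP in
lemma sectionSieve_mem (U : QuotSite ρ) : sectionSieve res U ∈ QuotSite.topology ρ U := by
  intro x
  have := U.etale
  obtain ⟨R, hR, h⟩ := hP (Scheme.Etale.mk U.hom)
  obtain ⟨V, f, hf, hx⟩ := (mem_smallEtaleTopology_iff' R).1 hR x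
  have hV : V.hom = f.left ≫ U.hom := (Over.w ((Scheme.Etale.forget _).map f)).symm
  let f' : (QuotSite.incl ρ).obj V ⟶ U := ⟨1, f.left, by
    rw [actHom_one, Category.comp_id]
    exact hV.symm⟩
  let g : QuotSite.over f' ⟶ V :=
    MorphismProperty.Over.homMk (𝟙 _) ((Category.id_comp _).trans hV)
  exact ⟨(QuotSite.incl ρ).obj V, f', (h V f hf).map (res g), hx⟩

include res hP in
lemma section_ext_of_locally (F : Sheaf (QuotSite.topology ρ) Ab.{u + 1})
    {a b : F.obj.obj (op (QuotSite.top ρ))}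
    (h : ∀ U, P U → Mumford.toSec a U = Mumford.toSec b U) : a = b := by
  refine sheaf_section_ext F (sectionSieve_mem res hP (QuotSite.top ρ)) fun V f ⟨e⟩ => ?_
  rw [← QuotSite.toOverIncl_toTop f, ← functor_map_map, ← functor_map_map]
  exact congrArg _ (h _ e)

include hP in
/-- A family of sections, indexed by the sections of `P` but independent of them, comes from a
global section. -/
lemma exists_section_of_locally (F : Sheaf (QuotSite.topology ρ) Ab.{u + 1})
    (s : ∀ U, P U → F.obj.obj (op ((QuotSite.incl ρ).obj U)))
    (hs : ∀ U e e', s U e = s U e')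
    (hres : ∀ (U V : Z.left.Etale) (f : U ⟶ V) (e : P V),
      s U (res f e) = F.obj.map ((QuotSite.incl ρ).map f).op (s V e)) :
    ∃ b : F.obj.obj (op (QuotSite.top ρ)), ∀ U e, Mumford.toSec b U = s U e := by
  obtain ⟨b, hb⟩ := sheaf_exists_glue F (sectionSieve_mem res hP (QuotSite.top ρ))
    -- The choice of a section of `P` is arbitrary: by `hs` the value of `s` does not depend on it,
    -- and this gives the compatibility.
    (fun V f hf => F.obj.map (QuotSite.toOverIncl f).op (s _ hf.some))
    (fun _ _ g f hf => by
      rw [functor_map_map, ← QuotSite.toOverIncl_overMap, ← functor_map_map, ← hres]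
      exact congrArg _ (hs _ _ _))
  refine ⟨b, fun U e => ?_⟩
  let f := Mumford.toTop ρ U
  let g : QuotSite.over f ⟶ U := MorphismProperty.Over.homMk (𝟙 _)
    ((Category.id_comp _).trans (Category.comp_id _).symm)
  have hg : QuotSite.toOverIncl f ≫ (QuotSite.incl ρ).map g = 𝟙 _ :=
    QuotSite.hom_ext (one_mul _) (Category.id_comp _)
  have hf : sectionSieve res (QuotSite.top ρ) f := ⟨res g e⟩
  refine (hb f hf).trans ?_
  rw [hs _ _ (res g e), hres, functor_map_map, hg, functor_map_id]

end LocalSections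

namespace Bundle

variable (E : Bundle A)

lemma section_ext (F : Sheaf (QuotSite.topology ρ) Ab.{u + 1})
    {a b : F.obj.obj (op (QuotSite.top ρ))}
    (h : ∀ U, E.Sec U → Mumford.toSec a U = Mumford.toSec b U) : a = b :=
  section_ext_of_locally (P := E.Sec) (fun f => E.res f) E.locally_nonempty F h

lemma exists_section (F : Sheaf (QuotSite.topology ρ) Ab.{u + 1})
    (s : ∀ U, E.Sec U → F.obj.obj (op ((QuotSite.incl ρ).obj U)))
    (hs : ∀ U e e', s U e = s U e')
    (hres : ∀ (U V : Z.left.Etale) (f : U ⟶ V) (e : E.Sec V),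
      s U (E.res f e) = F.obj.map ((QuotSite.incl ρ).map f).op (s V e)) :
    ∃ b : F.obj.obj (op (QuotSite.top ρ)), ∀ U e, Mumford.toSec b U = s U e :=
  exists_section_of_locally (fun f => E.res f) E.locally_nonempty F s hs hres

end Bundle

end Gluing

/-! ### Bundles as bundles of local primitives of a section of `I¹`. -/

section Trivializations

variable {S : Scheme.{u}} {Z : Over S} {W : Type (u + 1)} [Group W] {ρ : W →* Aut Z}
  {A : Sheaf (QuotSite.topology ρ) Ab.{u + 1}}

/-- The presheaf of families of sections over all objects above a given one. -/
def productPresheaf (F : (QuotSite ρ)ᵒᵖ ⥤ Ab.{u + 1}) : (QuotSite ρ)ᵒᵖ ⥤ Ab.{u + 1} where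
  obj U := AddCommGrpCat.of (∀ (V : QuotSite ρ) (_ : V ⟶ U.unop), F.obj (op V))
  map g := AddCommGrpCat.ofHom
    { toFun := fun x V f => x V (f ≫ g.unop)
      map_zero' := rfl
      map_add' := fun _ _ => rfl }
  map_id U := by
    refine AddCommGrpCat.hom_ext (AddMonoidHom.ext fun x => funext fun V => funext fun f => ?_)
    exact congrArg (x V) (Category.comp_id f)
  map_comp g h := by
    refine AddCommGrpCat.hom_ext (AddMonoidHom.ext fun x => funext fun V => funext fun f => ?_)
    exact congrArg (x V) (Category.assoc f _ _).symm

/-- The restrictions of a section to all objects above. -/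
def toProduct (F : (QuotSite ρ)ᵒᵖ ⥤ Ab.{u + 1}) : F ⟶ productPresheaf F where
  app U := AddCommGrpCat.ofHom
    { toFun := fun a V f => F.map f.op a
      map_zero' := funext fun V => funext fun f => map_zero (F.map f.op).hom
      map_add' := fun a b => funext fun V => funext fun f => map_add (F.map f.op).hom a b }
  naturality U V g := by
    refine AddCommGrpCat.hom_ext (AddMonoidHom.ext fun a => funext fun Y => funext fun f => ?_)
    exact functor_map_map f g.unop a

instance (F : (QuotSite ρ)ᵒᵖ ⥤ Ab.{u + 1}) : Mono (toProduct F) := by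
  have : ∀ U, Mono ((toProduct F).app U) := fun U => by
    refine (AddCommGrpCat.mono_iff_injective _).2 fun a b h => ?_
    have h' : F.map (𝟙 U.unop).op a = F.map (𝟙 U.unop).op b :=
      congrFun (congrFun h U.unop) (𝟙 _)
    rwa [functor_map_id, functor_map_id] at h'
  exact NatTrans.mono_of_mono_app _

namespace Bundle

variable (E : Bundle A)

/-- The section of the structure group that takes `e` to `e'`. -/
def diff {U : Z.left.Etale} (e e' : E.Sec U) : A.obj.obj (op ((QuotSite.incl ρ).obj U)) :=
  (E.existsUnique_act U e e').choose

lemma diff_act {U : Z.left.Etale} (e e' : E.Sec U) : E.act U (E.diff e e') e = e' :=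
  (E.existsUnique_act U e e').choose_spec.1

lemma diff_eq {U : Z.left.Etale} {e e' : E.Sec U} {t} (h : E.act U t e = e') : E.diff e e' = t :=
  ((E.existsUnique_act U e e').choose_spec.2 t h).symm

lemma diff_act_right {U : Z.left.Etale} (e e' : E.Sec U) (t) :
    E.diff e (E.act U t e') = t + E.diff e e' :=
  E.diff_eq (by rw [E.add_act, E.diff_act])

/-- An object of the site as an étale scheme, with the structure morphism composed with `w`. -/
def shifted (V : QuotSite ρ) (w : W) : Z.left.Etale :=
  have := V.etale
  Scheme.Etale.mk (V.hom ≫ actHom ρ w)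

/-- The identity of `V`, over `w`. -/
def toShifted (V : QuotSite ρ) (w : W) : V ⟶ (QuotSite.incl ρ).obj (shifted V w) :=
  ⟨w, 𝟙 _, Category.id_comp _⟩

/-- The morphism over `U` that underlies `f`. -/
def fromShifted {V : QuotSite ρ} {U : Z.left.Etale} (f : V ⟶ (QuotSite.incl ρ).obj U) :
    shifted V f.weight ⟶ U :=
  MorphismProperty.Over.homMk f.map f.comm

lemma toShifted_fromShifted {V : QuotSite ρ} {U : Z.left.Etale}
    (f : V ⟶ (QuotSite.incl ρ).obj U) :
    toShifted V f.weight ≫ (QuotSite.incl ρ).map (fromShifted f) = f :=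
  QuotSite.hom_ext (one_mul _) (Category.id_comp _)

/-- The differences of a section with arbitrary chosen sections. -/
def toProductFun {U : Z.left.Etale} (e : E.Sec U) (V : QuotSite ρ)
    (f : V ⟶ (QuotSite.incl ρ).obj U) : A.obj.obj (op V) :=
  -- The chosen section `h.some` depends only on `V` and the weight, by proof irrelevance, although
  -- `e` serves to prove that one exists. So the same reference section serves all `e`.
  have h : Nonempty (E.Sec (shifted V f.weight)) := ⟨E.res (fromShifted f) e⟩
  A.obj.map (toShifted V f.weight).op (E.diff h.some (E.res (fromShifted f) e))

/-- The type of the reference section involves `f.weight`. Letting `w` and `p` vary freely permits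
rewriting along equalities of weights that are not definitional, such as those for composites. -/
lemma toProductFun_eq {U : Z.left.Etale} (e : E.Sec U) {V : QuotSite ρ} {w : W}
    (p : shifted V w ⟶ U) {f : V ⟶ (QuotSite.incl ρ).obj U}
    (hf : toShifted V w ≫ (QuotSite.incl ρ).map p = f) (h : Nonempty (E.Sec (shifted V w))) :
    E.toProductFun e V f = A.obj.map (toShifted V w).op (E.diff h.some (E.res p e)) := by
  have hw : f.weight = w := by rw [← hf]; exact one_mul w
  subst hw
  have hp : p = fromShifted f := etale_hom_ext (by
    have := congrArg QuotSite.Hom.map hf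
    exact (Category.id_comp _).symm.trans this)
  subst hp
  rfl

/-- An equivariant map from a bundle to a sheaf that contains the structure group, on sections. -/
structure EquivariantMap {F : Sheaf (QuotSite.topology ρ) Ab.{u + 1}} (j : A ⟶ F) where
  app (U : Z.left.Etale) : E.Sec U → F.obj.obj (op ((QuotSite.incl ρ).obj U))
  app_res (U V : Z.left.Etale) (f : U ⟶ V) (e : E.Sec V) :
    app U (E.res f e) = F.obj.map ((QuotSite.incl ρ).map f).op (app V e)
  app_act (U : Z.left.Etale) (t : A.obj.obj (op ((QuotSite.incl ρ).obj U))) (e : E.Sec U) :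
    app U (E.act U t e) = j.hom.app (op ((QuotSite.incl ρ).obj U)) t + app U e

/-- Differences with reference sections send `E` equivariantly to the presheaf of arbitrary families
of sections of `A`. The reference sections are not compatible with restriction, but families are not
asked to be so. Extending `j` along the monomorphism `toProduct` then carries the map over to `F`.
-/
lemma nonempty_equivariantMap {F : Sheaf (QuotSite.topology ρ) Ab.{u + 1}} [Injective F]
    (j : A ⟶ F) : Nonempty (E.EquivariantMap j) := by
  let r : productPresheaf A.obj ⟶ F.obj := Injective.factorThru j.hom (toProduct A.obj)
  have hr : toProduct A.obj ≫ r = j.hom := Injective.comp_factorThru _ _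
  refine ⟨⟨fun U e => r.app (op ((QuotSite.incl ρ).obj U)) (E.toProductFun e), ?_, ?_⟩⟩
  · intro U V f e
    refine Eq.trans ?_ (ConcreteCategory.congr_hom
      (r.naturality ((QuotSite.incl ρ).map f).op) (E.toProductFun e))
    refine congrArg (r.app (op ((QuotSite.incl ρ).obj U))) ?_
    funext Y g
    have h : Nonempty (E.Sec (shifted Y g.weight)) := ⟨E.res (fromShifted g) (E.res f e)⟩
    refine (E.toProductFun_eq _ (fromShifted g) (toShifted_fromShifted g) h).trans ?_
    refine Eq.trans ?_ (E.toProductFun_eq e (fromShifted g ≫ f) (f := g ≫ (QuotSite.incl ρ).map f)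
      ?_ h).symm
    · rw [E.res_res]
    · rw [Functor.map_comp, ← Category.assoc, toShifted_fromShifted]
  · intro U t e
    let P : (productPresheaf A.obj).obj (op ((QuotSite.incl ρ).obj U)) := E.toProductFun e
    have h2 : E.toProductFun (E.act U t e) =
        (toProduct A.obj).app (op ((QuotSite.incl ρ).obj U)) t + P := by
      funext V f
      change E.toProductFun _ V f = A.obj.map f.op t + E.toProductFun e V f
      have h : Nonempty (E.Sec (shifted V f.weight)) := ⟨E.res (fromShifted f) e⟩
      rw [E.toProductFun_eq _ (fromShifted f) (toShifted_fromShifted f) h,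
        E.toProductFun_eq _ (fromShifted f) (toShifted_fromShifted f) h]
      have h3 : E.res (fromShifted f) (E.act U t e) = _ := E.map_act (fromShifted f) t e
      rw [h3, diff_act_right]
      refine (map_add (A.obj.map (toShifted V f.weight).op).hom _ _).trans ?_
      congr 1
      refine (functor_map_map _ _ t).trans ?_
      rw [toShifted_fromShifted]
    rw [h2]
    refine (map_add (r.app (op ((QuotSite.incl ρ).obj U))).hom _ _).trans ?_
    congr 1
    exact ConcreteCategory.congr_hom (congrArg (fun q => q.app _) hr) t

variable {E}

/-- The action adds the same term `j t` to both maps, so their difference does not depend on the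
section `e` and descends to `Z`. -/
lemma EquivariantMap.exists_sub {F : Sheaf (QuotSite.topology ρ) Ab.{u + 1}} {j : A ⟶ F}
    (φ ψ : E.EquivariantMap j) :
    ∃ b : F.obj.obj (op (QuotSite.top ρ)), ∀ U e, Mumford.toSec b U = φ.app U e - ψ.app U e := by
  refine E.exists_section F (fun U e => φ.app U e - ψ.app U e) ?_ ?_
  · intro U e e'
    rw [← E.diff_act e e', φ.app_act, ψ.app_act, add_sub_add_left_eq_sub]
  · intro U V f e
    rw [φ.app_res, ψ.app_res]
    exact (map_sub (F.obj.map _).hom _ _).symm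

/-- An isomorphism of a bundle with the bundle of the local primitives of a section `base`. -/
structure Trivialization (I : InjectiveResolution A) (E : Bundle A) extends
    E.EquivariantMap (I.ι.f 0) where
  base : (I.cocomplex.X 1).obj.obj (op (QuotSite.top ρ))
  d_app (U : Z.left.Etale) (e : E.Sec U) :
    d0 I ((QuotSite.incl ρ).obj U) (app U e) = Mumford.toSec base U

lemma isBundleClass_iff {I : InjectiveResolution A} {E : Bundle A}
    {h : ((globalSections ρ).rightDerived 1).obj A} :
    IsBundleClass I E h ↔
      ∃ τ : Trivialization I E, IsDerivedClass (globalSections ρ) I 1 τ.base h :=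
  ⟨fun ⟨a, φ, h₁, h₂, h₃, h₄⟩ => ⟨⟨⟨φ, h₁, h₂⟩, a, h₃⟩, h₄⟩,
    fun ⟨τ, hτ⟩ => ⟨τ.base, τ.app, τ.app_res, τ.app_act, τ.d_app, hτ⟩⟩

lemma toSec_map_app {F G : Sheaf (QuotSite.topology ρ) Ab.{u + 1}} (f : F ⟶ G)
    (a : F.obj.obj (op (QuotSite.top ρ))) (U : Z.left.Etale) :
    Mumford.toSec (f.hom.app (op (QuotSite.top ρ)) a) U =
      f.hom.app (op ((QuotSite.incl ρ).obj U)) (Mumford.toSec a U) :=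
  (ConcreteCategory.congr_hom (f.hom.naturality (Mumford.toTop ρ U).op) a).symm

lemma toSec_sub {F : Sheaf (QuotSite.topology ρ) Ab.{u + 1}}
    (a b : F.obj.obj (op (QuotSite.top ρ))) (U : Z.left.Etale) :
    Mumford.toSec (a - b) U = Mumford.toSec a U - Mumford.toSec b U :=
  map_sub (F.obj.map (Mumford.toTop ρ U).op).hom a b

variable (I : InjectiveResolution A)

/-- The action changes `φ` by the image of `A`, which the differential of `I⁰` kills. Hence `d φ` is
independent of the section and descends to the base section. -/
lemma nonempty_trivialization (E : Bundle A) : Nonempty (Trivialization I E) := by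
  obtain ⟨φ⟩ := E.nonempty_equivariantMap (I.ι.f 0)
  obtain ⟨a, ha⟩ := E.exists_section (I.cocomplex.X 1)
    (fun U e => d0 I ((QuotSite.incl ρ).obj U) (φ.app U e))
    (fun U e e' => by
      rw [← E.diff_act e e', φ.app_act, map_add]
      refine (zero_add _).symm.trans (congrArg (· + _) ?_)
      exact (d0_aug I _ _).symm)
    (fun U V f e => by rw [φ.app_res, d0_map])
  exact ⟨⟨φ, a, fun U e => (ha U e).symm⟩⟩

namespace Trivialization

variable {I} {E : Bundle A} (τ : Trivialization I E)

lemma app_act' (U : Z.left.Etale) (t : A.obj.obj (op ((QuotSite.incl ρ).obj U))) (e : E.Sec U) :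
    τ.app U (E.act U t e) = aug I _ t + τ.app U e := τ.app_act U t e

lemma d_base : (sectionsComplex I).d 1 2 τ.base = 0 := by
  refine E.section_ext (I.cocomplex.X 2) (a := (I.cocomplex.d 1 2).hom.app _ τ.base) (b := 0)
    fun U e => ?_
  rw [toSec_map_app, ← τ.d_app U e, Mumford.toSec_zero]
  have h := I.cocomplex.d_comp_d 0 1 2
  exact ConcreteCategory.congr_hom (congrArg (fun q => q.hom.app (op ((QuotSite.incl ρ).obj U))) h)
    (τ.app U e)

lemma exists_class : ∃ h, IsDerivedClass (globalSections ρ) I 1 τ.base h :=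
  IsDerivedClass.exists_of_d_eq_zero τ.d_base

/-- This serves twice: it shows that the class of the base depends on `E` only, and it produces the
cochain attached to an element of the Mumford group. -/
lemma exists_sub (τ' : Trivialization I E) :
    ∃ b : (I.cocomplex.X 0).obj.obj (op (QuotSite.top ρ)),
      (∀ U e, Mumford.toSec b U = τ.app U e - τ'.app U e) ∧
      d0 I (QuotSite.top ρ) b = τ.base - τ'.base := by
  obtain ⟨b, hb⟩ := τ.toEquivariantMap.exists_sub τ'.toEquivariantMap
  refine ⟨b, hb, E.section_ext _ fun U e => ?_⟩
  rw [toSec_sub, ← τ.d_app U e, ← τ'.d_app U e, ← map_sub, ← hb]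
  exact toSec_map_app _ b U

lemma class_unique (τ' : Trivialization I E) {h h' : ((globalSections ρ).rightDerived 1).obj A}
    (H : IsDerivedClass (globalSections ρ) I 1 τ.base h)
    (H' : IsDerivedClass (globalSections ρ) I 1 τ'.base h') : h = h' := by
  obtain ⟨b, -, hb⟩ := τ.exists_sub τ'
  exact (H.eq_iff H' (i := 0) (by simp)).2 ⟨b, hb⟩

/-- A trivialization of an isomorphic bundle. -/
def ofIso {E' : Bundle A} (i : E'.Iso E) : Trivialization I E' where
  app U e := τ.app U (i.equiv U e)
  app_res U V f e := by rw [i.equiv_res, τ.app_res]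
  app_act U t e := by rw [i.equiv_act, τ.app_act]
  base := τ.base
  d_app U e := τ.d_app U _

lemma app_injective (U : Z.left.Etale) : Function.Injective (τ.app U) := by
  intro e e' h
  rw [← E.diff_act e e', τ.app_act] at h
  have : E.diff e e' = 0 := aug_injective I _ (by
    rw [map_zero]
    exact add_eq_right.1 h.symm)
  rw [← E.diff_act e e', this, E.zero_act]

lemma exists_of_nonempty {U : Z.left.Etale} (e : E.Sec U) {x}
    (hx : d0 I ((QuotSite.incl ρ).obj U) x = Mumford.toSec τ.base U) : ∃ e, τ.app U e = x := by
  obtain ⟨t, ht⟩ := exists_aug I _ (x := x - τ.app U e) (by rw [map_sub, hx, τ.d_app, sub_self])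
  refine ⟨E.act U t e, ?_⟩
  rw [τ.app_act]
  exact (congrArg (· + _) ht).trans (sub_add_cancel _ _)

/-- Where `E` has a section, two primitives differ by an element of `A`, so `x` is in the image. The
local preimages are unique by injectivity of `app`, hence compatible, and they glue because `E` is a
sheaf. -/
lemma exists_app_eq {U : Z.left.Etale} {x}
    (hx : d0 I ((QuotSite.incl ρ).obj U) x = Mumford.toSec τ.base U) : ∃ e, τ.app U e = x := by
  obtain ⟨R, hR, hne⟩ := E.locally_nonempty U
  have hx' : ∀ {V : Z.left.Etale} (f : V ⟶ U),
      d0 I _ ((I.cocomplex.X 0).obj.map ((QuotSite.incl ρ).map f).op x) =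
        Mumford.toSec τ.base V := fun f => by
    rw [d0_map, hx, Mumford.map_toSec]
  choose e he using fun (V : Z.left.Etale) (f : V ⟶ U) (hf : R f) =>
    τ.exists_of_nonempty (hne V f hf).some (hx' f)
  have hsh := (isSheaf_iff_isSheaf_of_type _ _).1 E.sheaf.property R hR
  obtain ⟨e', he', -⟩ := hsh (fun V f hf => e V f hf)
    ((Presieve.compatible_iff_sieveCompatible _).2 fun V V' f g hf => τ.app_injective _ (by
      refine (he _ _ _).trans ?_
      refine Eq.trans ?_ (τ.app_res _ _ g (e V f hf)).symm
      rw [he, Functor.map_comp]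
      exact (functor_map_map _ _ x).symm))
  refine ⟨e', ?_⟩
  refine sheaf_section_ext_etale _ hR fun V f hf => ?_
  rw [← τ.app_res, ← he V f hf]
  exact congrArg (τ.app V) (he' f hf)

/-- Bundles with cohomologous base sections are isomorphic. -/
def iso {E' : Bundle A} (τ' : Trivialization I E')
    (b : (I.cocomplex.X 0).obj.obj (op (QuotSite.top ρ)))
    (hb : d0 I (QuotSite.top ρ) b = τ'.base - τ.base) : E.Iso E' := by
  -- Both bundles are identified with bundles of primitives, and adding `b` turns primitives of
  -- `τ.base` into primitives of `τ'.base`.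
  have key : ∀ U (e : E.Sec U), ∃ e' : E'.Sec U, τ'.app U e' = τ.app U e + Mumford.toSec b U := by
    intro U e
    refine τ'.exists_app_eq ?_
    have h : d0 I _ (Mumford.toSec b U) = Mumford.toSec (τ'.base - τ.base) U := by
      rw [← hb]; exact (toSec_map_app _ b U).symm
    rw [map_add, τ.d_app, h, toSec_sub]
    abel
  have key' : ∀ U (e' : E'.Sec U), ∃ e : E.Sec U, τ.app U e = τ'.app U e' - Mumford.toSec b U := by
    intro U e
    refine τ.exists_app_eq ?_
    have h : d0 I _ (Mumford.toSec b U) = Mumford.toSec (τ'.base - τ.base) U := by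
      rw [← hb]; exact (toSec_map_app _ b U).symm
    rw [map_sub, τ'.d_app, h, toSec_sub]
    abel
  choose f hf using key
  choose g hg using key'
  exact
    { equiv := fun U =>
        { toFun := f U
          invFun := g U
          left_inv := fun e => τ.app_injective U (by rw [hg, hf, add_sub_cancel_right])
          right_inv := fun e => τ'.app_injective U (by rw [hf, hg, sub_add_cancel]) }
      equiv_act := fun U a e => τ'.app_injective U (by
        change τ'.app U (f U _) = τ'.app U (E'.act U a (f U e))
        rw [hf, τ.app_act, τ'.app_act, hf, add_assoc])
      equiv_res := fun {U V} h e => τ'.app_injective U (by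
        change τ'.app U (f U _) = τ'.app U (E'.res h (f V e))
        rw [hf, τ.app_res, τ'.app_res, hf, ← Mumford.map_toSec b h]
        exact (map_add ((I.cocomplex.X 0).obj.map _).hom _ _).symm) }

end Trivialization

end Bundle

end Trivializations

/-! ### The class of a bundle in `H¹`, and its behaviour under sums and twists. -/

section BundleClasses

variable {S : Scheme.{u}} {Z : Over S} {W : Type (u + 1)} [Group W] {ρ : W →* Aut Z}
  {A : Sheaf (QuotSite.topology ρ) Ab.{u + 1}}

lemma twistInv_naturality (w : W) {U V : Z.left.Etale} (f : U ⟶ V) :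
    twistInv ρ w U ≫ (QuotSite.incl ρ).map ((shift ρ w).map f) =
      (QuotSite.incl ρ).map f ≫ twistInv ρ w V :=
  QuotSite.hom_ext ((one_mul _).trans (mul_one _).symm)
    ((Category.id_comp _).trans (Category.comp_id _).symm)

lemma twistInv_toTop (w : W) (U : Z.left.Etale) :
    twistInv ρ w U ≫ Mumford.toTop ρ ((shift ρ w).obj U) =
      Mumford.toTop ρ U ≫ QuotSite.elt ρ w⁻¹ :=
  QuotSite.hom_ext ((one_mul _).trans (mul_one _).symm) (Category.id_comp _)

/-- Both `twistInv` and the action of `w` on global sections are pull-backs over the automorphism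
`w⁻¹`. This is how a twist of bundles becomes the action of `w` on `Γ(Z, I^q)`. -/
lemma map_twistInv_toSec {F : Sheaf (QuotSite.topology ρ) Ab.{u + 1}} (w : W)
    (a : ((globalSections ρ).obj F)) (U : Z.left.Etale) :
    F.obj.map (twistInv ρ w U).op (Mumford.toSec (A := F) a ((shift ρ w).obj U)) =
      Mumford.toSec (A := F) (((globalSections ρ).obj F).ρ w a) U := by
  refine (functor_map_map _ _ _).trans ?_
  rw [twistInv_toTop]
  exact (functor_map_map _ _ _).symm

namespace Bundle

namespace Trivialization

variable {I : InjectiveResolution A} {E : Bundle A} (τ : Trivialization I E)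

/-- The trivialization of the twist of a bundle. -/
def twist (w : W) : Trivialization I (E.twist w) where
  app U e := (I.cocomplex.X 0).obj.map (twistInv ρ w U).op (τ.app ((shift ρ w).obj U) e)
  app_res U V f e := by
    refine (congrArg ((I.cocomplex.X 0).obj.map (twistInv ρ w U).op)
      (τ.app_res _ _ ((shift ρ w).map f) e)).trans ?_
    rw [functor_map_map, twistInv_naturality, ← functor_map_map]
  app_act U t e := by
    refine (congrArg ((I.cocomplex.X 0).obj.map (twistInv ρ w U).op)
      (τ.app_act _ (A.obj.map (twistHom ρ w U).op t) e)).trans ?_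
    refine (map_add ((I.cocomplex.X 0).obj.map (twistInv ρ w U).op).hom _ _).trans ?_
    congr 1
    -- On the twist, `t` acts through `twistHom`; pull-back along `twistInv` undoes this and leaves
    -- `t` itself.
    refine (aug_map I (twistInv ρ w U) _).symm.trans ?_
    rw [functor_map_map, twistInv_twistHom, functor_map_id]
    rfl
  base := ((globalSections ρ).obj (I.cocomplex.X 1)).ρ w τ.base
  d_app U e := by
    rw [d0_map]
    exact (congrArg ((I.cocomplex.X 1).obj.map (twistInv ρ w U).op) (τ.d_app _ e)).trans
      (map_twistInv_toSec w τ.base U)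

/-- The trivialization with respect to another resolution. -/
def change {J : InjectiveResolution A} (φ : I.cocomplex ⟶ J.cocomplex)
    (hφ : I.ι.f 0 ≫ φ.f 0 = J.ι.f 0) : Trivialization J E where
  app U e := (φ.f 0).hom.app (op ((QuotSite.incl ρ).obj U)) (τ.app U e)
  app_res U V f e := by
    rw [τ.app_res]
    exact ConcreteCategory.congr_hom ((φ.f 0).hom.naturality ((QuotSite.incl ρ).map f).op) _
  app_act U t e := by
    rw [τ.app_act, ← hφ]
    exact map_add ((φ.f 0).hom.app (op ((QuotSite.incl ρ).obj U))).hom _ _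
  base := (φ.f 1).hom.app (op (QuotSite.top ρ)) τ.base
  d_app U e := by
    rw [toSec_map_app, ← τ.d_app U e]
    exact ConcreteCategory.congr_hom (congrArg (fun q => q.hom.app _) (φ.comm 0 1)) (τ.app U e)

/-- The section `τ(m(e₁, e₂)) - τ₁(e₁) - τ₂(e₂)` is invariant under both copies of `A`, so it
descends along pairs of local sections to a global section of `I⁰`, whose differential compares the
bases. -/
lemma isContractedProduct_base {E₁ E₂ : Bundle A} (h : E₁.IsContractedProduct E₂ E)
    (τ₁ : Trivialization I E₁) (τ₂ : Trivialization I E₂) :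
    ∃ b : (I.cocomplex.X 0).obj.obj (op (QuotSite.top ρ)),
      d0 I (QuotSite.top ρ) b = τ.base - (τ₁.base + τ₂.base) := by
  obtain ⟨m, hm, hact⟩ := h
  let P : Z.left.Etale → Type (u + 1) := fun U => E₁.Sec U × E₂.Sec U
  let res : ∀ {U V : Z.left.Etale}, (U ⟶ V) → P V → P U :=
    fun f x => (E₁.res f x.1, E₂.res f x.2)
  have hP : ∀ U : Z.left.Etale, ∃ R ∈ Z.left.smallEtaleTopology U,
      ∀ (V : Z.left.Etale) (f : V ⟶ U), R f → Nonempty (P V) := fun U => by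
    obtain ⟨R₁, hR₁, h₁⟩ := E₁.locally_nonempty U
    obtain ⟨R₂, hR₂, h₂⟩ := E₂.locally_nonempty U
    exact ⟨R₁ ⊓ R₂, Z.left.smallEtaleTopology.intersection_covering hR₁ hR₂,
      fun V f hf => ⟨(h₁ V f hf.1).some, (h₂ V f hf.2).some⟩⟩
  let F : ∀ U, P U → (I.cocomplex.X 0).obj.obj (op ((QuotSite.incl ρ).obj U)) :=
    fun U x => τ.app U (m U x.1 x.2) - (τ₁.app U x.1 + τ₂.app U x.2)
  obtain ⟨b, hb⟩ := exists_section_of_locally (P := P) res hP (I.cocomplex.X 0) F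
    (fun U x y => by
      change τ.app U _ - (τ₁.app U _ + τ₂.app U _) = τ.app U _ - (τ₁.app U _ + τ₂.app U _)
      rw [← E₁.diff_act x.1 y.1, ← E₂.diff_act x.2 y.2, hact, τ.app_act', τ₁.app_act',
        τ₂.app_act', map_add]
      abel)
    (fun U V f x => by
      change τ.app U _ - (τ₁.app U _ + τ₂.app U _) = _
      rw [hm, τ.app_res, τ₁.app_res, τ₂.app_res]
      exact ((map_sub ((I.cocomplex.X 0).obj.map _).hom _ _).trans
        (congrArg _ (map_add ((I.cocomplex.X 0).obj.map _).hom _ _))).symm)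
  refine ⟨b, section_ext_of_locally (P := P) res hP _ fun U x => ?_⟩
  rw [toSec_sub, Mumford.toSec_add, ← τ.d_app U (m U x.1 x.2), ← τ₁.d_app U x.1,
    ← τ₂.d_app U x.2, ← map_add, ← map_sub]
  exact (toSec_map_app _ b U).trans (congrArg _ (hb U x))

end Trivialization

section Primitives

variable (I : InjectiveResolution A) (a : (I.cocomplex.X 1).obj.obj (op (QuotSite.top ρ)))

/-- The presheaf of local primitives of `a`. -/
def primitivesPresheaf : Z.left.Etaleᵒᵖ ⥤ Type (u + 1) where
  obj U := { x : (I.cocomplex.X 0).obj.obj (op ((QuotSite.incl ρ).obj U.unop)) //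
    d0 I _ x = Mumford.toSec a U.unop }
  map {U V} f := TypeCat.ofHom fun x =>
    ⟨(I.cocomplex.X 0).obj.map ((QuotSite.incl ρ).map f.unop).op x.1, by
      rw [d0_map, x.2, Mumford.map_toSec]⟩
  map_id U := by
    ext x
    exact ((congrArg (fun q => (I.cocomplex.X 0).obj.map q.op x.1)
      ((QuotSite.incl ρ).map_id U.unop)).trans (functor_map_id _))
  map_comp f g := by
    ext x
    exact ((congrArg (fun q => (I.cocomplex.X 0).obj.map q.op x.1)
      ((QuotSite.incl ρ).map_comp g.unop f.unop)).trans (functor_map_map _ _ _).symm)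

lemma isSheaf_primitivesPresheaf :
    Presheaf.IsSheaf Z.left.smallEtaleTopology (primitivesPresheaf I a) := by
  rw [isSheaf_iff_isSheaf_of_type]
  intro U R hR x hx
  have hx' := (Presieve.compatible_iff_sieveCompatible _).1 hx
  obtain ⟨b, hb⟩ := sheaf_exists_glue_etale (I.cocomplex.X 0) hR (fun V f hf => (x f hf).1)
    (fun V V' g f hf => congrArg Subtype.val (hx' f g hf))
  refine ⟨⟨b, sheaf_section_ext_etale _ hR fun V f hf => ?_⟩, fun V f hf => Subtype.ext (hb f hf),
    fun y hy => Subtype.ext (sheaf_section_ext_etale _ hR fun V f hf => ?_)⟩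
  · rw [← d0_map, hb f hf, (x f hf).2, Mumford.map_toSec]
  · exact (congrArg Subtype.val (hy f hf)).trans (hb f hf).symm

variable {I a} in
/-- The action of the structure group on the primitives of `a`. -/
def primitivesAct {U : Z.left.Etale} (t : A.obj.obj (op ((QuotSite.incl ρ).obj U)))
    (x : { x // d0 I ((QuotSite.incl ρ).obj U) x = Mumford.toSec a U }) :
    { x // d0 I ((QuotSite.incl ρ).obj U) x = Mumford.toSec a U } :=
  ⟨aug I _ t + x.1, by rw [map_add, d0_aug, zero_add, x.2]⟩

variable {I a} in
lemma primitivesAct_val {U : Z.left.Etale} (t : A.obj.obj (op ((QuotSite.incl ρ).obj U)))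
    (x : { x // d0 I ((QuotSite.incl ρ).obj U) x = Mumford.toSec a U }) :
    (primitivesAct t x).1 = aug I _ t + x.1 := rfl

variable {I a} in
lemma primitivesAct_zero {U : Z.left.Etale}
    (x : { x // d0 I ((QuotSite.incl ρ).obj U) x = Mumford.toSec a U }) :
    primitivesAct 0 x = x :=
  Subtype.ext (by rw [primitivesAct_val, map_zero, zero_add])

variable {I a} in
lemma primitivesAct_add {U : Z.left.Etale} (s t : A.obj.obj (op ((QuotSite.incl ρ).obj U)))
    (x : { x // d0 I ((QuotSite.incl ρ).obj U) x = Mumford.toSec a U }) :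
    primitivesAct (s + t) x = primitivesAct s (primitivesAct t x) :=
  Subtype.ext (by rw [primitivesAct_val, primitivesAct_val, primitivesAct_val, map_add, add_assoc])

variable {I a} in
lemma existsUnique_primitivesAct {U : Z.left.Etale}
    (x y : { x // d0 I ((QuotSite.incl ρ).obj U) x = Mumford.toSec a U }) :
    ∃! t, primitivesAct t x = y := by
  obtain ⟨t, ht⟩ := exists_aug I _ (x := y.1 - x.1) (by rw [map_sub, x.2, y.2, sub_self])
  refine ⟨t, Subtype.ext ?_, fun s hs => aug_injective I _ ?_⟩
  · rw [primitivesAct_val, ht, sub_add_cancel]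
  · rw [ht]
    exact eq_sub_of_add_eq (congrArg Subtype.val hs)

variable {a} in
/-- The bundle of local primitives of a cocycle `a`. -/
def primitives (ha : (I.cocomplex.d 1 2).hom.app (op (QuotSite.top ρ)) a = 0) : Bundle A where
  sheaf := ⟨primitivesPresheaf I a, isSheaf_primitivesPresheaf I a⟩
  act U t x := primitivesAct t x
  zero_act U x := primitivesAct_zero x
  add_act U s t x := primitivesAct_add s t x
  map_act f t x := Subtype.ext
    ((map_add ((I.cocomplex.X 0).obj.map ((QuotSite.incl ρ).map f).op).hom _ _).trans
      (congrArg (· + _) (aug_map I _ t).symm))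
  existsUnique_act U x y := existsUnique_primitivesAct x y
  locally_nonempty U := by
    obtain ⟨R, hR, h⟩ := exists_local_primitive I ((QuotSite.incl ρ).obj U)
      (x := Mumford.toSec a U) (by
        rw [← toSec_map_app, ha, Mumford.toSec_zero])
    refine ⟨R.functorPullback (QuotSite.incl ρ), ?_, fun _ f hf => ?_⟩
    · rw [mem_smallEtaleTopology_iff']
      intro x
      obtain ⟨V, f, hf, y, hy⟩ := hR x
      let g : QuotSite.over f ⟶ U := QuotSite.fromOver f
      -- The covering `R` lives in the equivariant site and may contain `f` with nontrivial weight.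
      -- Precomposing with `i`, of the inverse weight, gives a member of `R` that comes from the
      -- small site.
      let i : (QuotSite.incl ρ).obj (QuotSite.over f) ⟶ V :=
        ⟨f.weight⁻¹, 𝟙 _, by
          change 𝟙 _ ≫ V.hom = (f.map ≫ U.hom) ≫ _
          have h := f.comm
          change f.map ≫ U.hom = _ at h
          rw [h, Category.assoc, ← actHom_mul, inv_mul_cancel, actHom_one, Category.comp_id,
            Category.id_comp]⟩
      refine ⟨QuotSite.over f, g, ?_, y, hy⟩
      have hg : (QuotSite.incl ρ).map g = i ≫ f :=
        QuotSite.hom_ext (mul_inv_cancel f.weight).symm (Category.id_comp _).symm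
      change R ((QuotSite.incl ρ).map g)
      rw [hg]
      exact R.downward_closed hf _
    · obtain ⟨y, hy⟩ := h _ hf
      exact ⟨⟨y, hy.trans (Mumford.map_toSec a f)⟩⟩

variable {a} in
/-- The tautological trivialization of the bundle of primitives. -/
def primitivesTrivialization (ha : (I.cocomplex.d 1 2).hom.app (op (QuotSite.top ρ)) a = 0) :
    Trivialization I (primitives I ha) where
  app _ x := x.1
  app_res _ _ _ _ := rfl
  app_act _ _ _ := rfl
  base := a
  d_app _ x := x.2

end Primitives

/-- A morphism of resolutions. -/
lemma exists_resolution_hom (I J : InjectiveResolution A) :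
    ∃ φ : I.cocomplex ⟶ J.cocomplex, I.ι.f 0 ≫ φ.f 0 = J.ι.f 0 := by
  refine ⟨InjectiveResolution.desc (𝟙 A) J I, ?_⟩
  have h := InjectiveResolution.desc_commutes_zero (𝟙 A) J I
  exact h.trans (Category.id_comp _)

/-- A trivialization for one resolution is transported to any other along a comparison morphism, and
the class of its base is transported to the same `h`. -/
lemma exists_cl (E : Bundle A) : ∃ h, ∀ I : InjectiveResolution A, IsBundleClass I E h := by
  obtain ⟨τ⟩ := nonempty_trivialization (injectiveResolution A) E
  obtain ⟨h, hh⟩ := τ.exists_class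
  refine ⟨h, fun J => isBundleClass_iff.2 ?_⟩
  obtain ⟨φ, hφ⟩ := exists_resolution_hom (injectiveResolution A) J
  exact ⟨τ.change φ hφ, hh.change φ hφ⟩

/-- The class of a bundle. -/
def cl (E : Bundle A) : ((globalSections ρ).rightDerived 1).obj A := (exists_cl E).choose

lemma isBundleClass_cl (I : InjectiveResolution A) (E : Bundle A) : IsBundleClass I E (cl E) :=
  (exists_cl E).choose_spec I

lemma Trivialization.isDerivedClass_cl {I : InjectiveResolution A} {E : Bundle A}
    (τ : Trivialization I E) : IsDerivedClass (globalSections ρ) I 1 τ.base (cl E) := by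
  obtain ⟨τ', hτ'⟩ := isBundleClass_iff.1 (isBundleClass_cl I E)
  obtain ⟨h, hh⟩ := τ.exists_class
  rwa [← τ.class_unique τ' hh hτ']

lemma Trivialization.cl_eq {I : InjectiveResolution A} {E : Bundle A}
    (τ : Trivialization I E) {h : ((globalSections ρ).rightDerived 1).obj A}
    (hh : IsDerivedClass (globalSections ρ) I 1 τ.base h) : cl E = h :=
  τ.isDerivedClass_cl.unique hh

/-- Equal classes mean that the bases differ by the differential of a global section of `I⁰`, and
translation by that section is an isomorphism. Conversely a trivialization pulls back along an
isomorphism with the same base. -/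
lemma cl_eq_cl_iff (E E' : Bundle A) : cl E = cl E' ↔ Nonempty (E.Iso E') := by
  let I := injectiveResolution A
  obtain ⟨τ⟩ := nonempty_trivialization I E
  obtain ⟨τ'⟩ := nonempty_trivialization I E'
  constructor
  · intro h
    obtain ⟨b, hb⟩ := (τ'.isDerivedClass_cl.eq_iff τ.isDerivedClass_cl (i := 0) (by simp)).1 h.symm
    exact ⟨τ.iso τ' b hb⟩
  · rintro ⟨i⟩
    exact (τ'.ofIso i).cl_eq τ'.isDerivedClass_cl

lemma cl_surjective : Function.Surjective (cl (A := A)) := by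
  intro h
  let I := injectiveResolution A
  obtain ⟨a, ha⟩ := IsDerivedClass.exists_cocycle I 1 h
  exact ⟨primitives I ha.d_eq_zero, (primitivesTrivialization I ha.d_eq_zero).cl_eq ha⟩

lemma cl_contractedProduct {E₁ E₂ E : Bundle A} (h : E₁.IsContractedProduct E₂ E) :
    cl E = cl E₁ + cl E₂ := by
  let I := injectiveResolution A
  obtain ⟨τ⟩ := nonempty_trivialization I E
  obtain ⟨τ₁⟩ := nonempty_trivialization I E₁
  obtain ⟨τ₂⟩ := nonempty_trivialization I E₂
  obtain ⟨b, hb⟩ := τ.isContractedProduct_base h τ₁ τ₂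
  exact (τ.isDerivedClass_cl.eq_iff (τ₁.isDerivedClass_cl.add τ₂.isDerivedClass_cl)
    (i := 0) (by simp)).2 ⟨b, hb⟩

lemma cl_twist (w : W) (E : Bundle A) :
    cl (E.twist w) = (((globalSections ρ).rightDerived 1).obj A).ρ w (cl E) := by
  obtain ⟨τ⟩ := nonempty_trivialization (injectiveResolution A) E
  exact (τ.twist w).cl_eq (τ.isDerivedClass_cl.act w)

lemma isInvariant_iff_cl (E : Bundle A) :
    E.IsInvariant ↔ cl E ∈ (((globalSections ρ).rightDerived 1).obj A).ρ.invariants := by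
  refine forall_congr' fun w => ?_
  rw [← cl_eq_cl_iff, cl_twist]
  exact eq_comm


end Bundle

end BundleClasses

/-! ### The Mumford group as crossed cochains with values in `Γ(Z, I⁰)`. -/

section MumfordCochains

variable {S : Scheme.{u}} {Z : Over S} {W : Type (u + 1)} [Group W] {ρ : W →* Aut Z}
  {A : Sheaf (QuotSite.topology ρ) Ab.{u + 1}}

lemma twistInv_shiftMul (w v : W) (U : Z.left.Etale) :
    twistInv ρ (w * v) U ≫ (QuotSite.incl ρ).map (shiftMul ρ w v U) =
      twistInv ρ w U ≫ twistInv ρ v ((shift ρ w).obj U) :=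
  QuotSite.hom_ext ((one_mul _).trans (mul_inv_rev w v)) rfl

lemma twistInv_shiftOne (U : Z.left.Etale) :
    twistInv ρ 1 U ≫ (QuotSite.incl ρ).map (shiftOne ρ U) = 𝟙 _ :=
  QuotSite.hom_ext ((one_mul _).trans inv_one) (Category.comp_id _)

lemma map_twistInv_injective {F : Sheaf (QuotSite.topology ρ) Ab.{u + 1}} (w : W)
    (U : Z.left.Etale) : Function.Injective (F.obj.map (twistInv ρ w U).op) := by
  refine Function.LeftInverse.injective (g := F.obj.map (twistHom ρ w U).op) fun x => ?_
  rw [functor_map_map, twistHom_twistInv, functor_map_id]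

namespace Bundle.Trivialization

variable {I : InjectiveResolution A} {E : Bundle A} (τ : Trivialization I E)

/-- The base section of a trivialization, in the module of global sections. -/
abbrev baseSection : (globalSections ρ).obj (I.cocomplex.X 1) := τ.base

/-- The difference of two trivializations of `E` that are compared by an element of the Mumford
group. -/
def cochain (x : Mumford E) : (globalSections ρ).obj (I.cocomplex.X 0) :=
  (((τ.twist x.weight).ofIso x.iso).exists_sub τ).choose

lemma toSec_cochain (x : Mumford E) (U : Z.left.Etale) (e : E.Sec U) :
    Mumford.toSec (A := I.cocomplex.X 0) (τ.cochain x) U =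
      (I.cocomplex.X 0).obj.map (twistInv ρ x.weight U).op (τ.app _ (x.app U e)) - τ.app U e :=
  (((τ.twist x.weight).ofIso x.iso).exists_sub τ).choose_spec.1 U e

lemma d_cochain (x : Mumford E) : d0 I (QuotSite.top ρ) (τ.cochain x) =
    ((globalSections ρ).obj (I.cocomplex.X 1)).ρ x.weight τ.baseSection - τ.baseSection :=
  (((τ.twist x.weight).ofIso x.iso).exists_sub τ).choose_spec.2

/-- On a local section `e`, inserting the pull-back of `τ (x e)` splits the difference for `x * y`
into the one for `x` and the pull-back by `w⁻¹` of the one for `y`, where `w` is the weight of `x`.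
-/
lemma cochain_mul (x y : Mumford E) : τ.cochain (x * y) =
    τ.cochain x + ((globalSections ρ).obj (I.cocomplex.X 0)).ρ x.weight (τ.cochain y) := by
  refine E.section_ext (I.cocomplex.X 0) fun U e => ?_
  have h : (I.cocomplex.X 0).obj.map (twistInv ρ (x * y).weight U).op
      (τ.app _ ((x * y).app U e)) = (I.cocomplex.X 0).obj.map (twistInv ρ x.weight U).op
        ((I.cocomplex.X 0).obj.map (twistInv ρ y.weight _).op (τ.app _ (y.app _ (x.app U e)))) := by
    refine (congrArg ((I.cocomplex.X 0).obj.map (twistInv ρ (x * y).weight U).op)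
      (τ.app_res _ _ (shiftMul ρ x.weight y.weight U) _)).trans ?_
    refine (functor_map_map _ _ _).trans (Eq.trans ?_ (functor_map_map _ _ _).symm)
    exact congrArg (fun q => (I.cocomplex.X 0).obj.map (Quiver.Hom.op q) _)
      (twistInv_shiftMul x.weight y.weight U)
  rw [toSec_cochain τ _ U e, h]
  refine Eq.trans ?_ (Mumford.toSec_add _ _ U).symm
  rw [toSec_cochain τ x U e, ← map_twistInv_toSec, toSec_cochain τ y _ (x.app U e)]
  refine Eq.trans ?_ (congrArg (_ + ·)
    (map_sub ((I.cocomplex.X 0).obj.map (twistInv ρ x.weight U).op).hom _ _).symm)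
  exact (sub_add_sub_cancel' _ _ _).symm

lemma cochain_translation (t : A.obj.obj (op (QuotSite.top ρ))) :
    τ.cochain (Mumford.translation E t) = aug I (QuotSite.top ρ) t := by
  refine E.section_ext (I.cocomplex.X 0) fun U e => ?_
  have h : (I.cocomplex.X 0).obj.map (twistInv ρ 1 U).op
      (τ.app _ (E.res (shiftOne ρ U) (E.act U (Mumford.toSec t U) e))) =
        τ.app U (E.act U (Mumford.toSec t U) e) := by
    rw [τ.app_res, functor_map_map, twistInv_shiftOne, functor_map_id]
  refine (toSec_cochain τ _ U e).trans ((congrArg (· - τ.app U e) h).trans ?_)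
  rw [τ.app_act', add_sub_cancel_right]
  exact (toSec_map_app _ t U).symm

/-- By this and `cochain_mul`, the Mumford group embeds in the semidirect product of `Γ(Z, I⁰)` by
`W`, so that identities in it can be checked additively. -/
lemma eq_of_cochain_eq {x y : Mumford E} (h : x.weight = y.weight)
    (H : τ.cochain x = τ.cochain y) : x = y := by
  obtain ⟨w, i⟩ := x
  obtain ⟨v, j⟩ := y
  obtain rfl : w = v := h
  congr 1
  refine Bundle.Iso.ext (funext fun U => Equiv.ext fun e => τ.app_injective _ ?_)
  refine map_twistInv_injective w U (sub_left_injective (b := τ.app U e) ?_)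
  exact (τ.toSec_cochain ⟨w, i⟩ U e).symm.trans
    ((congrArg (fun q => Mumford.toSec (A := I.cocomplex.X 0) q U) H).trans
      (τ.toSec_cochain ⟨w, j⟩ U e))

-- For weight one the differential `w a - a` of the cochain vanishes, so the cochain comes from a
-- global section of `A`; translation by that section has the same cochain.
include τ in
lemma exists_translation {x : Mumford E} (h : x.weight = 1) :
    ∃ t, x = Mumford.translation E t := by
  obtain ⟨t, ht⟩ := exists_aug I (QuotSite.top ρ) (x := τ.cochain x) (by
    rw [d_cochain, h, map_one]
    exact sub_self _)
  exact ⟨t, τ.eq_of_cochain_eq h (ht.symm.trans (τ.cochain_translation t).symm)⟩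

end Bundle.Trivialization

variable {T : CommGrp (Over S)} {σ : W →* Aut T} {E : Bundle (coeffSheaf ρ σ)}
  {I : InjectiveResolution (coeffSheaf ρ σ)}

/-- The points of `T`, in the global sections of the first term of a resolution. -/
def pointsToResolution (I : InjectiveResolution (coeffSheaf ρ σ)) :
    pointsRep σ ⟶ (globalSections ρ).obj (I.cocomplex.X 0) :=
  constantSection ρ σ ≫ (globalSections ρ).map (I.ι.f 0)

lemma pointsToResolution_injective (hc : Function.Bijective (constant ρ σ)) :
    Function.Injective (pointsToResolution I) :=
  fun _ _ h => hc.1 (aug_injective I (QuotSite.top ρ) h)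

lemma cochain_pointsInl (τ : Bundle.Trivialization I E) (t : Multiplicative (pointsRep σ)) :
    τ.cochain (Mumford.pointsInl E t) = pointsToResolution I t.toAdd :=
  τ.cochain_translation _

lemma isExtension_mumford (hc : Function.Bijective (constant ρ σ)) (hE : E.IsInvariant) :
    IsExtension (pointsRep σ) (Mumford.pointsInl E) (Mumford.proj E) := by
  let I := injectiveResolution (coeffSheaf ρ σ)
  obtain ⟨τ⟩ := Bundle.nonempty_trivialization I E
  refine ⟨fun a b h => ?_, ?_, fun w => ?_, fun g m => ?_⟩
  · have := congrArg τ.cochain h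
    rw [cochain_pointsInl, cochain_pointsInl] at this
    exact Multiplicative.toAdd.injective (pointsToResolution_injective hc this)
  · refine le_antisymm ?_ fun x hx => ?_
    · rintro _ ⟨t, rfl⟩
      rfl
    · obtain ⟨t, rfl⟩ := τ.exists_translation (x := x) hx
      obtain ⟨t, rfl⟩ := hc.2 t
      exact ⟨Multiplicative.ofAdd t, rfl⟩
  · obtain ⟨i⟩ := hE w
    exact ⟨⟨w, i⟩, rfl⟩
  · refine τ.eq_of_cochain_eq ?_ ?_
    · change g.weight * 1 * g.weight⁻¹ = 1
      rw [mul_one, mul_inv_cancel]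
    · have h1 : τ.cochain (1 : Mumford E) = 0 := by
        have := τ.cochain_mul 1 1
        rw [mul_one, Mumford.one_weight, map_one] at this
        exact left_eq_add.1 this
      -- This gives `0 = cochain g + w · cochain g⁻¹`, with `w` the weight of `g`. In the cochain of
      -- the conjugate these two terms cancel, and only `w` applied to `m` is left.
      have h2 := τ.cochain_mul g g⁻¹
      rw [mul_inv_cancel, h1] at h2
      rw [mul_assoc, τ.cochain_mul, τ.cochain_mul, cochain_pointsInl, cochain_pointsInl, map_add]
      have h3 : (Mumford.pointsInl E (Multiplicative.ofAdd m)).weight = 1 := rfl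
      rw [h3, map_one, Module.End.one_apply, add_left_comm, ← h2, add_zero]
      exact (Rep.hom_comm_apply (pointsToResolution I) g.weight m).symm

/-- The bridge between extensions and the spectral sequence: a factor set, nontrivial in `T(k)`,
becomes in `Γ(Z, I⁰)` the coboundary of `w ↦ cochain (s w)`. -/
lemma pointsToResolution_factorSet (τ : Bundle.Trivialization I E) {s : W → Mumford E}
    (hs : ∀ w, Mumford.proj E (s w) = w) {w v : W} {t : Multiplicative (pointsRep σ)}
    (h : s w * s v = Mumford.pointsInl E t * s (w * v)) :
    pointsToResolution I t.toAdd =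
      ((globalSections ρ).obj (I.cocomplex.X 0)).ρ w (τ.cochain (s v)) -
        τ.cochain (s (w * v)) + τ.cochain (s w) := by
  have h := congrArg τ.cochain h
  have h3 : (Mumford.pointsInl E t).weight = 1 := rfl
  have h4 : (s w).weight = w := hs w
  rw [τ.cochain_mul, τ.cochain_mul, cochain_pointsInl, h3, h4, map_one, Module.End.one_apply] at h
  rw [← add_sub_cancel_right (pointsToResolution I t.toAdd) (τ.cochain (s (w * v))), ← h]
  abel

lemma exists_factorSet (hc : Function.Bijective (constant ρ σ)) (hE : E.IsInvariant) :
    ∃ (s : W → Mumford E) (f : groupCohomology.cocycles₂ (pointsRep σ)),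
      (∀ w, Mumford.proj E (s w) = w) ∧
      ∀ w v, s w * s v = Mumford.pointsInl E (Multiplicative.ofAdd (f (w, v))) * s (w * v) := by
  have hext := isExtension_mumford hc hE
  choose s hs using hext.surjective
  have key : ∀ w v, ∃ t : Multiplicative (pointsRep σ),
      Mumford.pointsInl E t = s w * s v * (s (w * v))⁻¹ := fun w v => by
    have : s w * s v * (s (w * v))⁻¹ ∈ (Mumford.proj E).ker := by
      rw [MonoidHom.mem_ker, map_mul, map_mul, map_inv, hs, hs, hs, mul_inv_cancel]
    rwa [← hext.range_eq_ker] at this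
  choose f hf using key
  have hmul : ∀ w v, s w * s v = Mumford.pointsInl E (f w v) * s (w * v) := fun w v => by
    rw [hf, inv_mul_cancel_right]
  let I := injectiveResolution (coeffSheaf ρ σ)
  obtain ⟨τ⟩ := Bundle.nonempty_trivialization I E
  let F : W × W → pointsRep σ := fun p => (f p.1 p.2).toAdd
  have hF : F ∈ groupCohomology.cocycles₂ (pointsRep σ) := by
    rw [groupCohomology.mem_cocycles₂_iff]
    intro w v x
    -- The cocycle identity is tested in `Γ(Z, I⁰)`, where the factor set is a coboundary and the
    -- identity is formal.
    refine pointsToResolution_injective (I := I) hc ?_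
    have hb := fun w v => pointsToResolution_factorSet τ hs (hmul w v)
    rw [map_add, map_add, Rep.hom_comm_apply, hb, hb, hb, hb]
    simp only [map_add, map_sub, map_mul, Module.End.mul_apply, mul_assoc]
    abel
  exact ⟨s, ⟨F, hF⟩, hs, hmul⟩

end MumfordCochains

/-! ### The second page of the spectral sequence of the double complex. -/

section DoubleComplexLemmas

variable {W : Type (u + 1)} [Group W]

lemma inhomogeneousCochains_d_map {A B : Rep.{u + 1} IntRing.{u} W} (f : A ⟶ B) (p : ℕ)
    (c : (Fin p → W) → A) :
    inhomogeneousCochains.d B p (fun g => f (c g)) =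
      fun g => f (inhomogeneousCochains.d A p c g) := by
  funext g
  simp [inhomogeneousCochains.d_hom_apply, Rep.hom_comm_apply]

namespace DoubleCochain

variable {K : CochainComplex (Rep.{u + 1} IntRing.{u} W) ℕ}

lemma horizontal_zero (x : DoubleCochain K) (q : ℕ) : horizontal x 0 q = 0 := rfl

lemma horizontal_succ (x : DoubleCochain K) (p q : ℕ) :
    horizontal x (p + 1) q = inhomogeneousCochains.d (K.X q) p (x p q) := rfl

lemma vertical_succ (x : DoubleCochain K) (p q : ℕ) :
    vertical x p (q + 1) = fun g => K.d q (q + 1) (x p q g) := rfl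

lemma D_coord (x : DoubleCochain K) (p q : ℕ) :
    D K x p q = horizontal x p q + (-1 : ℤ) ^ p • vertical x p q := rfl

lemma horizontal_eq_zero {x : DoubleCochain K} {p q : ℕ} (h : ∀ p', p = p' + 1 → x p' q = 0) :
    horizontal x p q = 0 := by
  cases p with
  | zero => rfl
  | succ p =>
    rw [horizontal_succ, h p rfl]
    exact map_zero (inhomogeneousCochains.d (K.X q) p).hom

lemma vertical_eq_zero {x : DoubleCochain K} {p q : ℕ} (h : ∀ q', q = q' + 1 → x p q' = 0) :
    vertical x p q = 0 := by
  cases q with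
  | zero => rfl
  | succ q =>
    rw [vertical_succ, h q rfl]
    exact funext fun g => map_zero (K.d q (q + 1)).hom

variable (K) in
/-- The family with one nonzero entry. -/
def single (p q : ℕ) (c : (Fin p → W) → K.X q) : DoubleCochain K := Pi.single p (Pi.single q c)

lemma single_same (p q : ℕ) (c : (Fin p → W) → K.X q) : single K p q c p q = c := by
  simp [single]

lemma single_of_ne_left {p q : ℕ} (c : (Fin p → W) → K.X q) {p' q' : ℕ} (h : p' ≠ p) :
    single K p q c p' q' = 0 := by
  simp [single, h]

lemma single_of_ne_right {p q : ℕ} (c : (Fin p → W) → K.X q) {p' q' : ℕ} (h : q' ≠ q) :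
    single K p q c p' q' = 0 := by
  by_cases hp : p' = p
  · subst hp
    simp [single, h]
  · exact single_of_ne_left c hp

lemma single_mem_degree {p q : ℕ} (c : (Fin p → W) → K.X q) {n : ℤ} (h : (p : ℤ) + q = n) :
    single K p q c ∈ degree K n := by
  intro p' q' h'
  by_cases hp : p' = p
  · exact single_of_ne_right c (by rintro rfl; subst hp; exact h' h)
  · exact single_of_ne_left c hp

lemma single_mem_filtration {p q : ℕ} (c : (Fin p → W) → K.X q) {s : ℤ} (h : s ≤ p) :
    single K p q c ∈ filtration K s := by
  intro p' q' h'
  exact single_of_ne_left c (by omega)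

lemma D_single (p q : ℕ) (c : (Fin p → W) → K.X q) :
    D K (single K p q c) = single K (p + 1) q (inhomogeneousCochains.d (K.X q) p c) +
      single K p (q + 1) ((-1 : ℤ) ^ p • fun g => K.d q (q + 1) (c g)) := by
  funext p' q'
  rw [D_coord]
  refine congrArg₂ (· + ·) ?_ ?_
  · by_cases hp : p' = p + 1
    · subst hp
      by_cases hq : q' = q
      · subst hq
        rw [horizontal_succ, single_same, single_same]
      · rw [single_of_ne_right _ hq]
        exact horizontal_eq_zero fun p'' _ => single_of_ne_right c hq
    · rw [single_of_ne_left _ hp]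
      exact horizontal_eq_zero fun p'' h => single_of_ne_left c (by omega)
  · by_cases hq : q' = q + 1
    · subst hq
      by_cases hp : p' = p
      · subst hp
        rw [vertical_succ, single_same, single_same]
      · rw [single_of_ne_left _ hp, vertical_eq_zero fun q'' _ => single_of_ne_left c hp, smul_zero]
    · rw [single_of_ne_right _ hq,
        vertical_eq_zero fun q'' h => single_of_ne_right c (by omega), smul_zero]

lemma mem_pageCycles_iff {r p n : ℤ} {z : DoubleCochain K} : z ∈ pageCycles K r p n ↔
    z ∈ degree K n ∧ z ∈ filtration K p ∧ D K z ∈ filtration K (p + r) := and_assoc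

/-- In column `p` the horizontal part of the differential comes from column `p - 1`, where an
element of `F^p` vanishes. So only the vertical part is left there, and it must vanish. -/
lemma vertical_eq_zero_of_mem {r : ℤ} {p q : ℕ} {n : ℤ} (hr : 0 < r) {z : DoubleCochain K}
    (hz : z ∈ pageCycles K r p n) : vertical z p q = 0 := by
  have h : D K z p q = 0 := hz.2 p q (by omega)
  rw [D_coord, horizontal_eq_zero fun p' hp' => hz.1.2 p' q (by omega), zero_add] at h
  rcases neg_one_pow_eq_or ℤ p with h1 | h1 <;> simpa [h1] using h

lemma d_eq_zero_of_mem {r : ℤ} {p q : ℕ} {n : ℤ} (hr : 0 < r) {z : DoubleCochain K}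
    (hz : z ∈ pageCycles K r p n) (g : Fin p → W) : K.d q (q + 1) (z p q g) = 0 :=
  congrFun (vertical_eq_zero_of_mem (q := q + 1) hr hz) g

/-- The degree `i` of the primitive is left free so that `q = 0` needs no separate statement: every
`d i 0` is zero, and so is every boundary in degree zero. -/
lemma isBoundary_vertical (x : DoubleCochain K) (p q : ℕ) (g : Fin p → W) :
    ∃ (i : ℕ) (b : K.X i), K.d i q b = vertical x p q g := by
  cases q with
  | zero => exact ⟨0, 0, map_zero (K.d 0 0).hom⟩
  | succ q => exact ⟨q, x p q g, rfl⟩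

lemma exists_of_isBoundary {n : ℕ} {a : K.X (n + 1)} (h : ∃ (i : ℕ) (b : K.X i),
    K.d i (n + 1) b = a) : ∃ b, K.d n (n + 1) b = a := by
  obtain ⟨i, b, rfl⟩ := h
  by_cases hi : i = n
  · subst hi
    exact ⟨b, rfl⟩
  · refine ⟨0, ?_⟩
    rw [K.shape i (n + 1) (fun h => hi (by simpa using h))]
    exact map_zero (K.d n (n + 1)).hom

lemma eq_zero_of_isBoundary {a : K.X 0} (h : ∃ (i : ℕ) (b : K.X i), K.d i 0 b = a) : a = 0 := by
  obtain ⟨i, b, rfl⟩ := h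
  rw [K.shape i 0 (by simp)]
  rfl

lemma homologyπ_eq_zero_iff_isBoundary (n : ℕ) (z : K.cycles n) :
    K.homologyπ n z = 0 ↔ ∃ (i : ℕ) (b : K.X i), K.d i n b = K.iCycles n z := by
  cases n with
  | zero =>
    rw [RepCohomology.homologyπ_eq_zero_iff K 0 rfl z]
    refine ⟨fun ⟨b, hb⟩ => ⟨_, b, hb⟩, fun h => ?_⟩
    rw [eq_zero_of_isBoundary h]
    exact ⟨0, map_zero (K.d _ 0).hom⟩
  | succ n =>
    rw [RepCohomology.homologyπ_eq_zero_iff K (n + 1) (i := n) (by simp) z]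
    exact ⟨fun ⟨b, hb⟩ => ⟨_, b, hb⟩, exists_of_isBoundary⟩

/-- A family whose vertical differential is a given family of boundaries. -/
lemma exists_vertical_primitive {p q : ℕ} (c : (Fin p → W) → K.X q)
    (hc : ∀ g, ∃ (i : ℕ) (b : K.X i), K.d i q b = c g) (n : ℤ) (hn : (p : ℤ) + q = n + 1) :
    ∃ x ∈ degree K n, x ∈ filtration K p ∧ D K x ∈ filtration K p ∧ D K x p q = c := by
  cases q with
  | zero =>
    refine ⟨0, zero_mem _, zero_mem _, ?_, ?_⟩
    · rw [map_zero]
      exact zero_mem (filtration K _)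
    · rw [map_zero]
      exact funext fun g => (eq_zero_of_isBoundary (hc g)).symm
  | succ q =>
    choose b hb using fun g => exists_of_isBoundary (hc g)
    -- The factor `(-1)^p` cancels the sign of the vertical part of the total differential in column
    -- `p`.
    refine ⟨single K p q ((-1 : ℤ) ^ p • b), single_mem_degree _ (by push_cast at hn; omega),
      single_mem_filtration _ le_rfl, ?_, ?_⟩
    · rw [D_single]
      exact add_mem (single_mem_filtration (p := p + 1) _ (by push_cast; omega))
        (single_mem_filtration _ le_rfl)
    · rw [D_single]
      refine (congrArg₂ (· + ·) (single_of_ne_left (K := K) (p := p + 1) (p' := p) _ (by omega))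
        (single_same _ _ _)).trans ?_
      rw [zero_add]
      funext g
      change (-1 : ℤ) ^ p • K.d q (q + 1) ((-1 : ℤ) ^ p • b g) = c g
      rw [map_zsmul (K.d q (q + 1)).hom, smul_smul, ← mul_pow, ← hb]
      simp

section SecondPage

variable {p q : ℕ}

/-- The cell `(p, q)` of a cochain of the second page, as a family of cocycles. -/
def cellCycles (z : pageCycles K 2 p (p + q)) (g : Fin p → W) : K.cycles q :=
  (RepCohomology.exists_cycle K q (d_eq_zero_of_mem two_pos z.2 g)).choose

lemma iCycles_cellCycles (z : pageCycles K 2 p (p + q)) (g : Fin p → W) :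
    K.iCycles q (cellCycles z g) = z.1 p q g :=
  (RepCohomology.exists_cycle K q (d_eq_zero_of_mem two_pos z.2 g)).choose_spec

lemma cellCycles_add (z z' : pageCycles K 2 p (p + q)) :
    cellCycles (z + z') = cellCycles z + cellCycles z' := by
  funext g
  refine RepCohomology.iCycles_injective K q ?_
  refine (iCycles_cellCycles _ g).trans (Eq.trans ?_ (map_add (K.iCycles q).hom _ _).symm)
  exact congrArg₂ (· + ·) (iCycles_cellCycles z g).symm (iCycles_cellCycles z' g).symm

variable {H : Rep.{u + 1} IntRing.{u} W} (P : K.cycles q ⟶ H)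
  (hP : Function.Surjective P)
  (hk : ∀ z, P z = 0 ↔ ∃ (i : ℕ) (b : K.X i), K.d i q b = K.iCycles q z)

-- The cell `(p + 1, q)` of `D z` is zero, so the group coboundary of `z^{p,q}` equals, up to sign,
-- the vertical differential of `z^{p+1,q-1}`, and it vanishes in `H`. Here `H` stands for the
-- cohomology of `K`, entering only through a surjection `P` from the cocycles whose kernel is the
-- boundaries.
include hk in
lemma d_cellCycles (z : pageCycles K 2 p (p + q)) :
    inhomogeneousCochains.d H p (fun g => P (cellCycles z g)) = 0 := by
  rw [inhomogeneousCochains_d_map]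
  funext g
  refine (hk _).2 ?_
  have h1 := congrFun (inhomogeneousCochains_d_map (K.iCycles q) p (cellCycles z)) g
  have h2 : (fun g => K.iCycles q (cellCycles z g)) = z.1 p q :=
    funext fun g => iCycles_cellCycles z g
  rw [h2] at h1
  have h3 : D K z.1 (p + 1) q = 0 := z.2.2 _ _ (by push_cast; omega)
  rw [D_coord, horizontal_succ] at h3
  obtain ⟨i, b, hb⟩ := isBoundary_vertical z.1 (p + 1) q g
  refine ⟨i, (-1 : ℤ) ^ p • b, ?_⟩
  refine (map_zsmul (K.d i q).hom _ _).trans ?_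
  refine Eq.trans ?_ h1
  have h4 := congrFun h3 g
  change _ + (-1 : ℤ) ^ (p + 1) • vertical z.1 (p + 1) q g = 0 at h4
  rw [eq_neg_of_add_eq_zero_left h4, ← hb, pow_succ, mul_neg_one, neg_smul, neg_neg]

/-- The map from the cochains of the second page to the cohomology with values in a quotient `H` of
the cocycles. -/
def toGroupCohomology : pageCycles K 2 p (p + q) →+ groupCohomology H p :=
  AddMonoidHom.mk'
    (fun z => groupCohomology.π H p (groupCohomology.cocyclesMk _ (d_cellCycles P hk z)))
    fun z z' => by
      rw [← map_add (groupCohomology.π H p).hom]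
      refine congrArg (groupCohomology.π H p) (ModuleCohomology.iCycles_injective _ _ ?_)
      refine (groupCohomology.iCocycles_mk _ _).trans (Eq.trans ?_
        (map_add (groupCohomology.iCocycles H p).hom _ _).symm)
      refine Eq.trans ?_ (congrArg₂ (· + ·) (groupCohomology.iCocycles_mk _ _)
        (groupCohomology.iCocycles_mk _ _)).symm
      funext g
      rw [cellCycles_add]
      exact map_add P.hom _ _

omit hk in
lemma cellCycles_eq {z : pageCycles K 2 p (p + q)} {c : (Fin p → W) → K.cycles q}
    (h : ∀ g, z.1 p q g = K.iCycles q (c g)) : cellCycles z = c :=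
  funext fun g => RepCohomology.iCycles_injective K q ((iCycles_cellCycles z g).trans (h g))

omit hk in
/-- A cochain in a filtration step whose cells of the lowest degree vanish. -/
lemma mem_filtration_succ {z : DoubleCochain K} {n : ℤ} (hz : z ∈ degree K n)
    (hz' : z ∈ filtration K p) (hn : (p : ℤ) + q = n) (h : z p q = 0) :
    z ∈ filtration K (p + 1) := by
  intro p' q' hp'
  rcases lt_or_eq_of_le (Int.lt_add_one_iff.1 hp') with h1 | h1
  · exact hz' p' q' h1
  · obtain rfl : p' = p := by exact_mod_cast h1
    by_cases hq : q' = q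
    · rw [hq, h]
    · exact hz p' q' (by omega)

-- Lift a cocycle with values in `H` to cochains `ζ` with values in the cycles of `K`. Their group
-- coboundary consists of vertical boundaries, so subtracting a suitable `x` in columns after `p`
-- moves the total differential into `F^{p+2}` without changing the cell `(p, q)`.
include hP in
lemma toGroupCohomology_surjective : Function.Surjective (toGroupCohomology (p := p) P hk) := by
  intro x
  obtain ⟨f, rfl⟩ := ModuleCohomology.homologyπ_surjective _ _ x
  choose ζ hζ using fun g => hP (groupCohomology.iCocycles H p f g)
  let c : (Fin p → W) → K.X q := fun g => K.iCycles q (ζ g)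
  have hf : inhomogeneousCochains.d H p (fun g => P (ζ g)) = 0 := by
    have h := ModuleCohomology.d_iCycles _ _ f
    rw [groupCohomology.inhomogeneousCochains.d_def] at h
    exact (congrArg (inhomogeneousCochains.d H p) (funext hζ)).trans h
  rw [inhomogeneousCochains_d_map] at hf
  obtain ⟨x, hx, hx1, hx2, hx3⟩ := exists_vertical_primitive (inhomogeneousCochains.d (K.X q) p c)
    (fun g => by
      have h1 := congrFun (inhomogeneousCochains_d_map (K.iCycles q) p ζ) g
      rw [h1]
      exact (hk _).1 (congrFun hf g)) ((p : ℤ) + q) (by push_cast; ring)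
  have hc : (fun g => K.d q (q + 1) (c g)) = 0 := funext fun g => RepCohomology.d_iCycles K q _
  have hD : D K (single K p q c) = single K (p + 1) q (inhomogeneousCochains.d (K.X q) p c) := by
    rw [D_single, hc, smul_zero]
    simp [single]
  have hx1' : x ∈ filtration K (p + 1) := by simpa using hx1
  have hdeg : single K p q c - x ∈ degree K ((p : ℤ) + q) :=
    sub_mem (single_mem_degree c rfl) hx
  have hz : single K p q c - x ∈ pageCycles K 2 p (p + q) := by
    refine mem_pageCycles_iff.2 ⟨hdeg, sub_mem (single_mem_filtration c le_rfl)
      fun p' q' h => hx1' p' q' (by omega), ?_⟩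
    have h2 := mem_filtration_succ (p := p + 1) (q := q) (D_mem_degree hdeg) (by
      rw [map_sub, hD]
      exact sub_mem (single_mem_filtration (p := p + 1) _ le_rfl) hx2) (by push_cast; ring) (by
      rw [map_sub, hD]
      refine (congrArg₂ (· - ·) (single_same _ _ _) hx3).trans (sub_self _))
    have : ((p + 1 : ℕ) : ℤ) + 1 = p + 2 := by push_cast; ring
    rwa [this] at h2
  refine ⟨⟨_, hz⟩, ?_⟩
  have hcell : cellCycles ⟨_, hz⟩ = ζ := cellCycles_eq fun g => by
    have h1 : x p q = 0 := hx1' p q (by omega)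
    change single K p q c p q g - x p q g = _
    rw [single_same, h1]
    exact sub_zero _
  refine congrArg (groupCohomology.π H p) (ModuleCohomology.iCycles_injective _ _ ?_)
  refine (groupCohomology.iCocycles_mk _ _).trans ?_
  rw [hcell]
  exact funext hζ

omit hk in
lemma groupCohomology_π_zero_eq_zero_iff (f : groupCohomology.cocycles H 0) :
    groupCohomology.π H 0 f = 0 ↔ groupCohomology.iCocycles H 0 f = 0 := by
  refine (ModuleCohomology.homologyπ_eq_zero_iff _ 0 (i := 0) (by simp) f).trans ?_
  have h0 : (groupCohomology.inhomogeneousCochains H).d 0 0 = 0 :=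
    (groupCohomology.inhomogeneousCochains H).shape 0 0 (by simp)
  rw [h0]
  exact ⟨fun ⟨_, hb⟩ => hb.symm, fun h => ⟨0, h.symm⟩⟩

omit hk in
lemma groupCohomology_π_succ_eq_zero_iff {n : ℕ} (f : groupCohomology.cocycles H (n + 1)) :
    groupCohomology.π H (n + 1) f = 0 ↔
      ∃ h, inhomogeneousCochains.d H n h = groupCohomology.iCocycles H (n + 1) f := by
  refine (ModuleCohomology.homologyπ_eq_zero_iff _ (n + 1) (i := n) (by simp) f).trans ?_
  rw [groupCohomology.inhomogeneousCochains.d_def]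

-- If the class of `z^{p,q}` is a coboundary in `H`, a cochain `y` in column `p - 1` (zero for `p =
-- 0`) accounts for `z^{p,q}` up to vertical boundaries, and a cochain `x` in column `p` accounts
-- for these. Then `z - D (y + x)` lies in `F^{p+1}`, which is the decomposition that defines the
-- page boundaries.
include hP in
lemma mem_pageBoundaries_of_toGroupCohomology_eq_zero {z : pageCycles K 2 p (p + q)}
    (h : toGroupCohomology P hk z = 0) : z.1 ∈ pageBoundaries K 2 p (p + q) := by
  obtain ⟨y, hy, hy1, hy2, hy3⟩ : ∃ y ∈ degree K ((p : ℤ) + q - 1), y ∈ filtration K ((p : ℤ) - 1) ∧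
      D K y ∈ filtration K p ∧ ∀ g, ∃ (i : ℕ) (b : K.X i), K.d i q b = (z.1 p q - D K y p q) g := by
    have key : ∀ (c : (Fin p → W) → K.cycles q), (∀ g, P (cellCycles z g) = P (c g)) → ∀ g,
        ∃ (i : ℕ) (b : K.X i), K.d i q b = z.1 p q g - K.iCycles q (c g) := fun c hc g => by
      have h1 : P (cellCycles z g - c g) = 0 := (map_sub P.hom _ _).trans (sub_eq_zero.2 (hc g))
      obtain ⟨i, b, hb⟩ := (hk _).1 h1
      refine ⟨i, b, hb.trans ((map_sub (K.iCycles q).hom _ _).trans ?_)⟩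
      exact congrArg (· - _) (iCycles_cellCycles z g)
    cases p with
    | zero =>
      refine ⟨0, zero_mem _, zero_mem _, ?_, fun g => ?_⟩
      · rw [map_zero]
        exact zero_mem (filtration K _)
      · have h1 := (groupCohomology_π_zero_eq_zero_iff _).1 h
        rw [groupCohomology.iCocycles_mk] at h1
        obtain ⟨i, b, hb⟩ := key 0 (fun g => (congrFun h1 g).trans (map_zero P.hom).symm) g
        refine ⟨i, b, hb.trans ?_⟩
        rw [map_zero]
        exact congrArg (z.1 0 q g - ·) (map_zero (K.iCycles q).hom)
    | succ p =>
      obtain ⟨f, hf⟩ := (groupCohomology_π_succ_eq_zero_iff _).1 h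
      rw [groupCohomology.iCocycles_mk] at hf
      choose ζ hζ using fun g => hP (f g)
      have hc : (fun g => K.d q (q + 1) (K.iCycles q (ζ g))) = 0 :=
        funext fun g => RepCohomology.d_iCycles K q _
      have hD : D K (single K p q fun g => K.iCycles q (ζ g)) = single K (p + 1) q
          (fun g => K.iCycles q (inhomogeneousCochains.d (K.cycles q) p ζ g)) := by
        rw [D_single, hc, smul_zero, inhomogeneousCochains_d_map]
        simp [single]
      refine ⟨single K p q fun g => K.iCycles q (ζ g), single_mem_degree _ (by push_cast; ring),
        single_mem_filtration _ (by push_cast; omega), ?_, fun g => ?_⟩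
      · rw [hD]
        exact single_mem_filtration _ le_rfl
      · rw [hD, single_same]
        refine key _ (fun g => ?_) g
        refine (congrFun hf g).symm.trans ?_
        rw [← funext hζ]
        exact congrFun (inhomogeneousCochains_d_map P p ζ) g
  obtain ⟨x, hx, hx1, hx2, hx3⟩ := exists_vertical_primitive (z.1 p q - D K y p q) hy3
    ((p : ℤ) + q - 1) (by ring)
  have hz := mem_pageCycles_iff.1 z.2
  have hY : y + x ∈ degree K ((p : ℤ) + q - 1) := add_mem hy hx
  have hdeg : z.1 - D K (y + x) ∈ degree K ((p : ℤ) + q) := by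
    have h1 := D_mem_degree hY
    rw [sub_add_cancel] at h1
    exact sub_mem hz.1 h1
  have hfil : D K (y + x) ∈ filtration K p := by
    rw [map_add]
    exact add_mem hy2 hx2
  refine AddSubgroup.mem_sup.2 ⟨z.1 - D K (y + x), mem_pageCycles_iff.2 ⟨hdeg, ?_, ?_⟩,
    D K (y + x), ⟨y + x, mem_pageCycles_iff.2 ⟨hY, ?_, ?_⟩, rfl⟩, sub_add_cancel _ _⟩
  · refine mem_filtration_succ hdeg (sub_mem hz.2.1 hfil) rfl ?_
    change z.1 p q - D K (y + x) p q = 0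
    rw [map_add]
    change z.1 p q - (D K y p q + D K x p q) = 0
    rw [hx3]
    abel
  · rw [map_sub, D_D, sub_zero]
    have : (p : ℤ) + 1 + (2 - 1) = p + 2 := by ring
    rw [this]
    exact hz.2.2
  · exact add_mem (fun p' q' h => hy1 p' q' (by omega)) fun p' q' h => hx1 p' q' (by omega)
  · have : (p : ℤ) - 2 + 1 + (2 - 1) = p := by ring
    rw [this]
    exact hfil

lemma toGroupCohomology_eq_zero_of_mem_pageBoundaries {z : pageCycles K 2 p (p + q)}
    (h : z.1 ∈ pageBoundaries K 2 p (p + q)) : toGroupCohomology P hk z = 0 := by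
  obtain ⟨x, hx, _, ⟨y, hy, rfl⟩, hxy⟩ := AddSubgroup.mem_sup.1 h
  have hy := mem_pageCycles_iff.1 hy
  have hx0 : x p q = 0 := hx.1.2 p q (by omega)
  have hz : z.1 p q = D K y p q := by
    rw [← hxy]
    change x p q + D K y p q = _
    rw [hx0, zero_add]
  have hz' (g) : ∃ (i : ℕ) (b : K.X i), K.d i q b = (z.1 p q - horizontal y p q) g := by
    obtain ⟨i, b, hb⟩ := isBoundary_vertical y p q g
    refine ⟨i, (-1 : ℤ) ^ p • b, (map_zsmul (K.d i q).hom _ _).trans ?_⟩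
    rw [hz, D_coord, add_sub_cancel_left]
    exact congrArg _ hb
  cases p with
  | zero =>
    refine (groupCohomology_π_zero_eq_zero_iff _).2 ?_
    rw [groupCohomology.iCocycles_mk]
    funext g
    refine (hk _).2 ?_
    obtain ⟨i, b, hb⟩ := hz' g
    refine ⟨i, b, hb.trans ?_⟩
    rw [iCycles_cellCycles, horizontal_zero, sub_zero]
  | succ p =>
    -- Here `p + 1` plays the role of the column. Since `D y` starts in column `p + 1`, the lowest
    -- column `p` of `y` consists of vertical cocycles, and their classes form the cochain that
    -- bounds the class of `z`.
    have hdy : ∀ g, K.d q (q + 1) (y p q g) = 0 := by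
      have h1 : vertical y p (q + 1) = 0 := vertical_eq_zero_of_mem (r := 1) (n := p + q) one_pos
        (mem_pageCycles_iff.2 ⟨fun p' q' h => hy.1 p' q' (by push_cast; omega),
          fun p' q' h => hy.2.1 p' q' (by push_cast; omega),
          fun p' q' h => hy.2.2 p' q' (by push_cast; omega)⟩)
      exact fun g => congrFun h1 g
    choose ζ hζ using fun g => RepCohomology.exists_cycle K q (hdy g)
    refine (groupCohomology_π_succ_eq_zero_iff _).2 ⟨fun g => P (ζ g), ?_⟩
    rw [groupCohomology.iCocycles_mk, inhomogeneousCochains_d_map]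
    funext g
    obtain ⟨i, b, hb⟩ := hz' g
    rw [← sub_eq_zero, ← neg_eq_zero, neg_sub]
    refine (map_sub P.hom _ _).symm.trans ((hk _).2 ⟨i, b, hb.trans ?_⟩)
    refine Eq.trans ?_ (map_sub (K.iCycles q).hom _ _).symm
    refine congrArg₂ (· - ·) (iCycles_cellCycles z g).symm ?_
    have h2 := congrFun (inhomogeneousCochains_d_map (K.iCycles q) p ζ) g
    rw [funext hζ] at h2
    exact h2

include hP in
lemma toGroupCohomology_ker : (pageBoundaries K 2 p (p + q)).addSubgroupOf
    (pageCycles K 2 p (p + q)) = (toGroupCohomology (p := p) P hk).ker := by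
  ext z
  exact ⟨toGroupCohomology_eq_zero_of_mem_pageBoundaries P hk,
    mem_pageBoundaries_of_toGroupCohomology_eq_zero P hP hk⟩

/-- The second page of the double complex is the group cohomology of the cohomology of `K`. -/
def pageEquiv : Page K 2 p (p + q) ≃+ groupCohomology H p :=
  (QuotientAddGroup.quotientAddEquivOfEq (toGroupCohomology_ker P hP hk)).trans
    (QuotientAddGroup.quotientKerEquivOfSurjective _ (toGroupCohomology_surjective P hP hk))

end SecondPage

end DoubleCochain

end DoubleComplexLemmas

/-! ### Total cohomology when the rows are exact in positive degrees. -/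

section RowExactness

variable {W : Type (u + 1)} [Group W]

namespace DoubleCochain

variable {K : CochainComplex (Rep.{u + 1} IntRing.{u} W) ℕ}

lemma d_zero_apply (A : Rep.{u + 1} IntRing.{u} W) (c : (Fin 0 → W) → A) (g : Fin 1 → W) :
    inhomogeneousCochains.d A 0 c g = A.ρ (g 0) (c default) - c default := by
  simp [inhomogeneousCochains.d_hom_apply, sub_eq_add_neg, Subsingleton.elim _ (default : Fin 0 → W)]

variable (hK : ∀ (p q : ℕ) (x : (Fin (p + 1) → W) → K.X q),
  inhomogeneousCochains.d (K.X q) (p + 1) x = 0 → ∃ y, inhomogeneousCochains.d (K.X q) p y = x)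

include hK in
/-- If the rows are exact, a cochain whose differential is concentrated in the first column is, up
to a coboundary, concentrated in the first column. -/
lemma exists_concentrated {n : ℤ} (m : ℕ) : ∀ x ∈ degree K n,
    (∀ p q, m < p → x p q = 0) → (∀ p q, 0 < p → D K x p q = 0) →
    ∃ y ∈ degree K (n - 1), ∀ p q, 0 < p → (x - D K y) p q = 0 := by
  induction m with
  | zero =>
    intro x _ h _
    refine ⟨0, zero_mem _, fun p q hp => ?_⟩
    rw [map_zero, sub_zero]
    exact h p q hp
  | succ m ih =>
    intro x hx h hD
    -- Column `m + 1` is the last that can be nonzero, so column `m + 2` of `D x` is purely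
    -- horizontal. The induction clears this last column and moves left.
    have hd : ∀ q, inhomogeneousCochains.d (K.X q) (m + 1) (x (m + 1) q) = 0 := fun q => by
      have h1 := hD (m + 2) q (by omega)
      rwa [D_coord, vertical_eq_zero fun q' _ => h (m + 2) q' (by omega), smul_zero, add_zero,
        horizontal_succ] at h1
    choose c hc using fun q => hK m q _ (hd q)
    -- The primitives `c q` are chosen for all `q`, and a primitive of zero need not be zero; the
    -- condition cuts `y` down to total degree `n - 1`.
    let y : DoubleCochain K := Pi.single m fun q => if (m : ℤ) + 1 + q = n then c q else 0
    have hy0 : ∀ p q, p ≠ m → y p q = 0 := fun p q hp => by simp [y, hp]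
    have hy1 : ∀ q : ℕ, (m : ℤ) + 1 + q = n → y m q = c q := fun q hq => by simp [y, hq]
    have hy2 : ∀ q : ℕ, (m : ℤ) + 1 + q ≠ n → y m q = 0 := fun q hq => by simp [y, hq]
    have hydeg : y ∈ degree K (n - 1) := fun p q hpq => by
      by_cases hp : p = m
      · subst hp
        exact hy2 q (by omega)
      · exact hy0 p q hp
    have hDy : D K y ∈ degree K n := by
      have := D_mem_degree hydeg
      rwa [sub_add_cancel] at this
    have hv : ∀ p q, m < p → (x - D K y) p q = 0 := fun p q hp => by
      change x p q - (horizontal y p q + (-1 : ℤ) ^ p • vertical y p q) = 0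
      rw [vertical_eq_zero fun q' _ => hy0 p q' (by omega), smul_zero, add_zero]
      by_cases hp' : p = m + 1
      · subst hp'
        rw [horizontal_succ]
        by_cases hq : (m : ℤ) + 1 + q = n
        · rw [hy1 q hq, hc, sub_self]
        · rw [hy2 q hq, hx (m + 1) q (by push_cast; exact hq), zero_sub, neg_eq_zero]
          exact map_zero (inhomogeneousCochains.d (K.X q) m).hom
      · rw [h p q (by omega), horizontal_eq_zero fun p'' _ => hy0 p'' q (by omega), sub_zero]
    obtain ⟨y', hy', hxy'⟩ := ih (x - D K y) (sub_mem hx hDy) hv fun p q hp => by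
      rw [map_sub, D_D, sub_zero]
      exact hD p q hp
    refine ⟨y + y', add_mem hydeg hy', fun p q hp => ?_⟩
    rw [map_add, ← sub_sub]
    exact hxy' p q hp

include hK in
lemma exists_concentrated_of_degree {n : ℤ} {x : DoubleCochain K} (hx : x ∈ degree K n)
    (hD : ∀ p q, 0 < p → D K x p q = 0) :
    ∃ y ∈ degree K (n - 1), ∀ p q, 0 < p → (x - D K y) p q = 0 :=
  exists_concentrated hK n.toNat x hx (fun p q h => hx p q (by omega)) hD

/-- An invariant cocycle, as a total cocycle. -/
lemma single_mem_totalCycles {n : ℕ} {y : K.X n} (hy : y ∈ (K.X n).ρ.invariants)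
    (hd : K.d n (n + 1) y = 0) : single K 0 n (fun _ => y) ∈ totalCycles K n := by
  refine ⟨single_mem_degree _ (by simp), ?_⟩
  change D K _ = 0
  have h1 : inhomogeneousCochains.d (K.X n) 0 (fun _ => y) = 0 := by
    funext g
    rw [d_zero_apply, hy, sub_self]
    rfl
  have h2 : (fun _ : Fin 0 → W => K.d n (n + 1) y) = 0 := funext fun _ => hd
  rw [D_single, h1, h2, smul_zero]
  simp [single]

/-- A total cochain that is concentrated in the first column. -/
lemma eq_single_of_concentrated {n : ℕ} {x : DoubleCochain K} (hx : x ∈ degree K n)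
    (h : ∀ p q, 0 < p → x p q = 0) : x = single K 0 n (fun _ => x 0 n default) := by
  funext p q
  rcases Nat.eq_zero_or_pos p with rfl | hp
  · by_cases hq : q = n
    · subst hq
      rw [single_same]
      funext g
      rw [Subsingleton.elim g default]
    · rw [single_of_ne_right _ hq]
      exact hx 0 q (by simpa using hq)
  · rw [h p q hp, single_of_ne_left _ hp.ne']

lemma invariant_of_D_single {n : ℕ} {y : K.X n}
    (h : ∀ p q, 0 < p → D K (single K 0 n fun _ => y) p q = 0) : y ∈ (K.X n).ρ.invariants := by
  intro w
  have h1 := congrFun (h 1 n one_pos) fun _ => w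
  rw [D_single] at h1
  have h2 : inhomogeneousCochains.d (K.X n) 0 (fun _ => y) (fun _ => w) = 0 := by
    refine Eq.trans ?_ h1
    change _ = single K 1 n _ 1 n _ + single K 0 (n + 1) _ 1 n _
    rw [single_same, single_of_ne_left _ one_ne_zero]
    exact (add_zero _).symm
  rw [d_zero_apply] at h2
  exact sub_eq_zero.1 h2

lemma D_single_zero_apply {n : ℕ} (y : K.X n) :
    D K (single K 0 n fun _ => y) 0 (n + 1) default = K.d n (n + 1) y := by
  rw [D_single]
  change single K 1 n _ 0 (n + 1) default + single K 0 (n + 1) _ 0 (n + 1) default = _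
  rw [single_same, single_of_ne_left _ zero_ne_one]
  change (0 : K.X (n + 1)) + (-1 : ℤ) ^ 0 • K.d n (n + 1) y = _
  rw [zero_add, pow_zero, one_smul]

include hK in
/-- Every total class comes from an invariant cocycle. -/
lemma exists_invariant_cocycle {n : ℕ} {x : DoubleCochain K} (hx : x ∈ totalCycles K n) :
    ∃ y : K.X n, y ∈ (K.X n).ρ.invariants ∧ K.d n (n + 1) y = 0 ∧
      x - single K 0 n (fun _ => y) ∈ (degree K ((n : ℤ) - 1)).map (D K) := by
  have hDx : D K x = 0 := hx.2
  obtain ⟨v, hv, hxv⟩ := exists_concentrated_of_degree hK hx.1 (fun p q _ => by rw [hDx]; rfl)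
  have hdeg : x - D K v ∈ degree K n := by
    have := D_mem_degree hv
    rw [sub_add_cancel] at this
    exact sub_mem hx.1 this
  have he := eq_single_of_concentrated hdeg hxv
  have hD : D K (single K 0 n fun _ => (x - D K v) 0 n default) = 0 := by
    rw [← he, map_sub, D_D, hDx, sub_zero]
  refine ⟨(x - D K v) 0 n default, invariant_of_D_single fun p q _ => by rw [hD]; rfl, ?_, v, hv, ?_⟩
  · rw [← D_single_zero_apply, hD]
    rfl
  · rw [← he, sub_sub_cancel]

include hK in
/-- An invariant cocycle that is a total coboundary is the differential of an invariant element. -/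
lemma exists_invariant_primitive {n : ℕ} {y : K.X n}
    (h : single K 0 n (fun _ => y) ∈ (degree K ((n : ℤ) - 1)).map (D K)) :
    ∃ (i : ℕ) (b : K.X i), b ∈ (K.X i).ρ.invariants ∧ K.d i n b = y := by
  obtain ⟨x, hx, hxy⟩ := h
  obtain ⟨v, hv, hxv⟩ := exists_concentrated_of_degree hK hx
    (fun p q hp => by rw [hxy]; exact single_of_ne_left _ hp.ne')
  have hdeg : x - D K v ∈ degree K ((n : ℤ) - 1) := by
    have := D_mem_degree hv
    rw [sub_add_cancel] at this
    exact sub_mem hx this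
  have hD : D K (x - D K v) = single K 0 n fun _ => y := by
    rw [map_sub, D_D, sub_zero, hxy]
  cases n with
  | zero =>
    -- For `n = 0` the primitive has total degree `-1`, where there are no cochains.
    have h0 : x - D K v = 0 := by
      funext p q
      exact hdeg p q (by push_cast; omega)
    rw [h0, map_zero] at hD
    refine ⟨0, 0, zero_mem _, ?_⟩
    have h1 := congrFun (congrFun (congrFun hD 0) 0) default
    rw [single_same] at h1
    exact (map_zero (K.d 0 0).hom).trans h1
  | succ n =>
    have hdeg' : x - D K v ∈ degree K n := by simpa using hdeg
    have he := eq_single_of_concentrated hdeg' hxv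
    rw [he] at hD
    refine ⟨n, (x - D K v) 0 n default, invariant_of_D_single fun p q hp => ?_, ?_⟩
    · rw [hD]
      exact single_of_ne_left _ hp.ne'
    · rw [← D_single_zero_apply, hD, single_same]

/-- The differential of an invariant element is a total coboundary. -/
lemma single_mem_map_of_invariant {n i : ℕ} {b : K.X i} (hb : b ∈ (K.X i).ρ.invariants) :
    single K 0 n (fun _ => K.d i n b) ∈ (degree K ((n : ℤ) - 1)).map (D K) := by
  by_cases hi : i + 1 = n
  · subst hi
    refine ⟨single K 0 i fun _ => b, single_mem_degree _ (by push_cast; ring), ?_⟩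
    have h1 : inhomogeneousCochains.d (K.X i) 0 (fun _ => b) = 0 := by
      funext g
      rw [d_zero_apply, hb, sub_self]
      rfl
    rw [D_single, h1, pow_zero, one_smul]
    simp [single]
  · have h1 : (fun _ : Fin 0 → W => K.d i n b) = 0 := by
      rw [K.shape i n (by simpa using hi)]
      rfl
    rw [h1]
    simp only [single, Pi.single_zero]
    exact zero_mem _

end DoubleCochain

end RowExactness

/-! ### Acyclicity of injective sheaves for the cohomology of `W`. -/

section Coinduced

lemma contractNth_zero_cons {G : Type*} [Group G] {n : ℕ} (a : G) (g : Fin (n + 1) → G) :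
    Fin.contractNth 0 (· * ·) (Fin.cons a g : Fin (n + 2) → G) =
      Fin.cons (a * g 0) (fun i => g i.succ) := by
  funext i
  refine Fin.cases ?_ (fun i => ?_) i
  · simp [Fin.contractNth]
  · simp [Fin.contractNth]

lemma contractNth_succ_cons {G : Type*} [Group G] {n : ℕ} (j : Fin (n + 1)) (a : G)
    (g : Fin (n + 1) → G) :
    Fin.contractNth j.succ (· * ·) (Fin.cons a g : Fin (n + 2) → G) =
      Fin.cons a (Fin.contractNth j (· * ·) g) := by
  funext i
  refine Fin.cases ?_ (fun i => ?_) i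
  · simp [Fin.contractNth]
  · simp [Fin.contractNth, Fin.cons]

variable {W : Type (u + 1)} [Group W]

/-- If `A` is a direct summand of the coinduced module of functions `W → A`, then the complex of
cochains of `W` with values in `A` is exact in positive degrees. -/
lemma exists_cochain_primitive (A : Rep.{u + 1} IntRing.{u} W) (R : (W → A) →+ A)
    (hR : ∀ m : A, R (fun _ => m) = m)
    (hact : ∀ (w : W) (φ : W → A), R (fun v => A.ρ w (φ (w⁻¹ * v))) = A.ρ w (R φ))
    (p : ℕ) (x : (Fin (p + 1) → W) → A) (hx : inhomogeneousCochains.d A (p + 1) x = 0) :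
    ∃ y, inhomogeneousCochains.d A p y = x := by
  -- The contracting homotopy of the coinduced module, followed by the retraction `R`. For each `v`,
  -- the cocycle identity at `(v⁻¹, g)`, acted on by `v`, expresses `x g` through values of `x`
  -- whose first entry involves `v⁻¹`. Applying `R` to these identities as functions of `v` gives `d
  -- y = x`.
  let y : (Fin p → W) → A := fun g => R fun v => A.ρ v (x (Fin.cons v⁻¹ g))
  refine ⟨y, funext fun g => ?_⟩
  have h1 : ∀ v : W, x g = A.ρ v (x (Fin.cons (v⁻¹ * g 0) fun i => g i.succ)) +
      ∑ j : Fin (p + 1), (-1 : IntRing.{u}) ^ ((j : ℕ) + 1) •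
        A.ρ v (x (Fin.cons v⁻¹ (Fin.contractNth j (· * ·) g))) := fun v => by
    have h := congrArg (A.ρ v) (congrFun hx (Fin.cons v⁻¹ g))
    rw [inhomogeneousCochains.d_hom_apply, Fin.sum_univ_succ, contractNth_zero_cons] at h
    simp only [contractNth_succ_cons, Fin.cons_zero, Fin.cons_succ, map_add, map_sum, map_smul] at h
    have h0 : A.ρ v (A.ρ v⁻¹ (x g)) = x g := by
      rw [← Module.End.mul_apply, ← map_mul, mul_inv_cancel, map_one, Module.End.one_apply]
    have h2 : A.ρ v ((0 : (Fin (p + 1 + 1) → W) → A) (Fin.cons v⁻¹ g)) = 0 := map_zero (A.ρ v)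
    rw [h0, h2, add_eq_zero_iff_eq_neg] at h
    rw [h, neg_add, ← Finset.sum_neg_distrib]
    simp [pow_succ]
  have h2 := congrArg R (funext h1)
  rw [hR] at h2
  rw [inhomogeneousCochains.d_hom_apply, h2]
  have h3 : ∀ (c : IntRing.{u}) (φ : W → A), R (fun v => c • φ v) = c • R φ := fun c φ => by
    rw [← IntRing.cast_down c]
    simp only [Int.cast_smul_eq_zsmul]
    exact map_zsmul R _ φ
  refine Eq.symm ((map_add R _ _).trans (congrArg₂ (· + ·) ?_ ?_))
  -- In the first term `v⁻¹ * g 0` is the inverse of `(g 0)⁻¹ * v`, so the function of `v` is a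
  -- translate by `g 0` and the equivariance of `R` applies.
  · refine Eq.trans ?_ (hact (g 0) _)
    congr 1
    funext v
    rw [← Module.End.mul_apply, ← map_mul, mul_inv_rev, inv_inv]
    simp
  · have h4 : (fun v => ∑ j : Fin (p + 1), (-1 : IntRing.{u}) ^ ((j : ℕ) + 1) •
        A.ρ v (x (Fin.cons v⁻¹ (Fin.contractNth j (· * ·) g)))) =
        ∑ j : Fin (p + 1), fun v => (-1 : IntRing.{u}) ^ ((j : ℕ) + 1) •
          A.ρ v (x (Fin.cons v⁻¹ (Fin.contractNth j (· * ·) g))) := by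
      funext v
      rw [Finset.sum_apply]
    rw [h4, map_sum]
    exact Finset.sum_congr rfl fun j _ => h3 _ _

variable {S : Scheme.{u}} {Z : Over S} {ρ : W →* Aut Z}

/-- The presheaf of families of sections indexed by `W`, on which `W` also acts by translation of
the index. -/
def coinduced (F : (QuotSite ρ)ᵒᵖ ⥤ Ab.{u + 1}) : (QuotSite ρ)ᵒᵖ ⥤ Ab.{u + 1} where
  obj U := AddCommGrpCat.of (W → F.obj U)
  map f := AddCommGrpCat.ofHom
    { toFun := fun φ v => F.map f (φ (f.unop.weight * v))
      map_zero' := funext fun _ => map_zero (F.map f).hom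
      map_add' := fun φ ψ => funext fun _ => map_add (F.map f).hom _ _ }
  map_id U := by
    refine AddCommGrpCat.hom_ext (AddMonoidHom.ext fun φ => funext fun v => ?_)
    change F.map (𝟙 U) (φ (1 * v)) = φ v
    rw [one_mul, F.map_id]
    rfl
  map_comp f g := by
    refine AddCommGrpCat.hom_ext (AddMonoidHom.ext fun φ => funext fun v => ?_)
    change F.map (f ≫ g) (φ (f.unop.weight * g.unop.weight * v)) =
      F.map g (F.map f (φ (f.unop.weight * (g.unop.weight * v))))
    rw [F.map_comp, mul_assoc]
    rfl

/-- The constant families. -/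
def toCoinduced (F : (QuotSite ρ)ᵒᵖ ⥤ Ab.{u + 1}) : F ⟶ coinduced F where
  app _ := AddCommGrpCat.ofHom
    { toFun := fun m _ => m
      map_zero' := rfl
      map_add' := fun _ _ => rfl }
  naturality _ _ _ := rfl

instance (F : (QuotSite ρ)ᵒᵖ ⥤ Ab.{u + 1}) : Mono (toCoinduced F) := by
  have : ∀ U, Mono ((toCoinduced F).app U) := fun _ =>
    (AddCommGrpCat.mono_iff_injective _).2 fun _ _ h => congrFun h (1 : W)
  exact NatTrans.mono_of_mono_app _

/-- The group cohomology of the sections of an injective sheaf vanishes in positive degrees. -/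
lemma exists_cochain_primitive_of_injective (F : Sheaf (QuotSite.topology ρ) Ab.{u + 1})
    [Injective F] (p : ℕ) (x : (Fin (p + 1) → W) → (globalSections ρ).obj F)
    (hx : inhomogeneousCochains.d ((globalSections ρ).obj F) (p + 1) x = 0) :
    ∃ y, inhomogeneousCochains.d ((globalSections ρ).obj F) p y = x := by
  -- The identity extends along the constant families because `F` is injective already as a
  -- presheaf. Naturality of the retraction for the morphisms `elt w⁻¹` is its equivariance under
  -- `W`.
  let r : coinduced F.obj ⟶ F.obj := Injective.factorThru (𝟙 F.obj) (toCoinduced F.obj)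
  have hr : toCoinduced F.obj ≫ r = 𝟙 _ := Injective.comp_factorThru _ _
  refine exists_cochain_primitive ((globalSections ρ).obj F) (r.app (op (QuotSite.top ρ))).hom (fun m => ?_) (fun w φ => ?_)
    p x hx
  · exact ConcreteCategory.congr_hom (NatTrans.congr_app hr (op (QuotSite.top ρ))) m
  · exact ConcreteCategory.congr_hom (r.naturality (QuotSite.elt ρ w⁻¹).op) φ

end Coinduced

/-! ### Identification of the abutment and of the second page. -/

section AbutmentAndSecondPage

variable {S : Scheme.{u}} {Z : Over S} {W : Type (u + 1)} [Group W] {ρ : W →* Aut Z}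
  {A : Sheaf (QuotSite.topology ρ) Ab.{u + 1}} (I : InjectiveResolution A)

open DoubleCochain

/-- The complex of invariant sections of an injective resolution. -/
abbrev invariantComplex : CochainComplex (ModuleCat.{u + 1} IntRing.{u}) ℕ :=
  ((invariantSections ρ).mapHomologicalComplex _).obj I.cocomplex

lemma sectionsComplex_exact (p q : ℕ) (x : (Fin (p + 1) → W) → (sectionsComplex I).X q)
    (hx : inhomogeneousCochains.d ((sectionsComplex I).X q) (p + 1) x = 0) :
    ∃ y, inhomogeneousCochains.d ((sectionsComplex I).X q) p y = x :=
  have := I.injective q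
  exists_cochain_primitive_of_injective (I.cocomplex.X q) p x hx

/-- The invariant section underlying a cocycle of the complex of invariant sections. -/
def invariantCycle (n : ℕ) (z : (invariantComplex I).cycles n) :
    ((sectionsComplex I).X n).ρ.invariants :=
  (invariantComplex I).iCycles n z

lemma d_invariantCycle (n : ℕ) (z : (invariantComplex I).cycles n) :
    (sectionsComplex I).d n (n + 1) (invariantCycle I n z) = 0 :=
  congrArg Subtype.val (ModuleCohomology.d_iCycles (invariantComplex I) n z)

/-- The map which places an invariant cocycle in the first column of the double complex. -/
def toTotal (n : ℕ) :
    (invariantComplex I).cycles n →+ TotalCohomology (sectionsComplex I) n :=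
  AddMonoidHom.mk'
    (fun z => QuotientAddGroup.mk ⟨_, single_mem_totalCycles (invariantCycle I n z).2
      (d_invariantCycle I n z)⟩) fun z z' => by
    rw [← QuotientAddGroup.mk_add]
    congr 1
    apply Subtype.ext
    change single _ 0 n _ = single _ 0 n _ + single _ 0 n _
    have h : (fun _ : Fin 0 → W => (invariantCycle I n (z + z')).1) =
        (fun _ => (invariantCycle I n z).1) + fun _ => (invariantCycle I n z').1 :=
      funext fun _ => congrArg Subtype.val (map_add ((invariantComplex I).iCycles n).hom z z')
    rw [h]
    simp only [single, Pi.single_add]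

/-- Exactness of the rows lets a total primitive be moved to the first column, where its horizontal
differential vanishes exactly when it is invariant. -/
lemma toTotal_eq_zero_iff (n : ℕ) (z : (invariantComplex I).cycles n) :
    toTotal I n z = 0 ↔ (invariantComplex I).homologyπ n z = 0 := by
  refine (QuotientAddGroup.eq_zero_iff _).trans (AddSubgroup.mem_addSubgroupOf.trans ?_)
  refine Iff.trans ?_ (ModuleCohomology.homologyπ_eq_zero_iff _ n rfl z).symm
  constructor
  · intro h
    obtain ⟨i, b, hb, hbz⟩ := exists_invariant_primitive (sectionsComplex_exact I) h
    -- `exists_invariant_primitive` leaves the degree of the primitive open; if it is not `n - 1`,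
    -- the differential is zero and zero serves as a primitive.
    by_cases hi : i + 1 = n
    · obtain rfl : i = (ComplexShape.up ℕ).prev n := by
        subst hi
        exact (CochainComplex.prev_nat_succ i).symm
      exact ⟨⟨b, hb⟩, Subtype.ext hbz⟩
    · refine ⟨0, Eq.trans (map_zero ((invariantComplex I).d _ n).hom) (Subtype.ext ?_)⟩
      refine Eq.trans ?_ hbz
      rw [(sectionsComplex I).shape i n (by simpa using hi)]
      rfl
  · rintro ⟨b, hb⟩
    have h : (invariantCycle I n z).1 = (sectionsComplex I).d _ n b.1 :=
      congrArg Subtype.val hb.symm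
    change single _ 0 n (fun _ => (invariantCycle I n z).1) ∈ _
    rw [h]
    exact single_mem_map_of_invariant b.2

lemma toTotal_surjective (n : ℕ) : Function.Surjective (toTotal I n) := by
  intro x
  obtain ⟨⟨x, hx⟩, rfl⟩ := QuotientAddGroup.mk_surjective x
  obtain ⟨y, hy, hd, hxy⟩ := exists_invariant_cocycle (sectionsComplex_exact I) hx
  obtain ⟨z, hz⟩ := ModuleCohomology.exists_cycle (invariantComplex I) n
    (a := (⟨y, hy⟩ : ((sectionsComplex I).X n).ρ.invariants)) (Subtype.ext hd)
  refine ⟨z, (QuotientAddGroup.eq).2 (AddSubgroup.mem_addSubgroupOf.2 ?_)⟩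
  have h : (invariantCycle I n z).1 = y := congrArg Subtype.val hz
  change - single _ 0 n (fun _ => (invariantCycle I n z).1) + x ∈ _
  rw [h, neg_add_eq_sub]
  exact hxy

/-- The cohomology of the total complex is that of the complex of invariant sections. -/
def totalEquiv (n : ℕ) :
    (invariantComplex I).homology n ≃+ TotalCohomology (sectionsComplex I) n :=
  ((QuotientAddGroup.quotientKerEquivOfSurjective
      ((invariantComplex I).homologyπ n).hom.toAddMonoidHom
      (ModuleCohomology.homologyπ_surjective _ n)).symm.trans
    (QuotientAddGroup.quotientAddEquivOfEq (N := (toTotal I n).ker)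
      (AddSubgroup.ext fun z => (toTotal_eq_zero_iff I n z).symm))).trans
    (QuotientAddGroup.quotientKerEquivOfSurjective _ (toTotal_surjective I n))

lemma totalEquiv_homologyπ (n : ℕ) (z : (invariantComplex I).cycles n) :
    totalEquiv I n ((invariantComplex I).homologyπ n z) = toTotal I n z := by
  have h : (QuotientAddGroup.quotientKerEquivOfSurjective
      ((invariantComplex I).homologyπ n).hom.toAddMonoidHom
      (ModuleCohomology.homologyπ_surjective _ n)).symm ((invariantComplex I).homologyπ n z) =
      QuotientAddGroup.mk z := (AddEquiv.symm_apply_eq _).2 rfl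
  exact congrArg (fun x => QuotientAddGroup.quotientKerEquivOfSurjective _ (toTotal_surjective I n)
    (QuotientAddGroup.quotientAddEquivOfEq
      (AddSubgroup.ext fun z => (toTotal_eq_zero_iff I n z).symm) x)) h

lemma exists_isAbutmentIso (n : ℕ) : ∃ a, IsAbutmentIso I n a := by
  refine ⟨(I.isoRightDerivedObj (invariantSections ρ) n).toLinearEquiv.toAddEquiv.trans
    (totalEquiv I n), fun y h ⟨z, hz, hzh⟩ => ?_⟩
  refine ⟨⟨_, single_mem_totalCycles (invariantCycle I n z).2 (d_invariantCycle I n z)⟩,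
    fun g => ?_, fun p q hp => single_of_ne_left _ hp, ?_⟩
  · change single _ 0 n _ 0 n g = _
    rw [single_same]
    exact congrArg Subtype.val hz
  · change totalEquiv I n ((I.isoRightDerivedObj (invariantSections ρ) n).hom h) = _
    rw [← hzh]
    exact totalEquiv_homologyπ I n z

/-- The projection from the cocycles to the cohomology `H^q(Z, A)`. -/
def cyclesToDerived (q : ℕ) :
    (sectionsComplex I).cycles q ⟶ ((globalSections ρ).rightDerived q).obj A :=
  (sectionsComplex I).homologyπ q ≫ (IsDerivedClass.homologyEquiv I q).inv

lemma isDerivedClass_cyclesToDerived (q : ℕ) (z : (sectionsComplex I).cycles q) :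
    IsDerivedClass (globalSections ρ) I q ((sectionsComplex I).iCycles q z)
      (cyclesToDerived I q z) :=
  ⟨z, rfl, (ConcreteCategory.congr_hom (IsDerivedClass.homologyEquiv I q).inv_hom_id _).symm⟩

lemma cyclesToDerived_surjective (q : ℕ) : Function.Surjective (cyclesToDerived I q) := by
  intro h
  obtain ⟨_, z, rfl, hz⟩ := IsDerivedClass.exists_cocycle I q h
  exact ⟨z, (isDerivedClass_cyclesToDerived I q z).unique ⟨z, rfl, hz⟩⟩

lemma cyclesToDerived_eq_zero_iff (q : ℕ) (z : (sectionsComplex I).cycles q) :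
    cyclesToDerived I q z = 0 ↔
      ∃ (i : ℕ) (b : (sectionsComplex I).X i), (sectionsComplex I).d i q b =
        (sectionsComplex I).iCycles q z := by
  refine ((isDerivedClass_cyclesToDerived I q z).zero_iff rfl).trans ?_
  exact (RepCohomology.homologyπ_eq_zero_iff (sectionsComplex I) q rfl z).symm.trans
    (homologyπ_eq_zero_iff_isBoundary q z)

/-- The terms of the second page. -/
def secondPage (p q : ℕ) : Page (sectionsComplex I) 2 p (p + q) ≃+
    groupCohomology (((globalSections ρ).rightDerived q).obj A) p :=
  pageEquiv (cyclesToDerived I q) (cyclesToDerived_surjective I q)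
    (cyclesToDerived_eq_zero_iff I q)

lemma isSecondPageIso_secondPage (p q : ℕ) : IsSecondPageIso I p q (secondPage I p q) := by
  intro z
  refine ⟨groupCohomology.cocyclesMk _
    (d_cellCycles (cyclesToDerived I q) (cyclesToDerived_eq_zero_iff I q) z), fun g => ?_, rfl⟩
  rw [groupCohomology.iCocycles_mk, ← iCycles_cellCycles z g]
  exact isDerivedClass_cyclesToDerived I q _

end AbutmentAndSecondPage

/-! ### The differential `d₂` from `E₂^{0,1}` to `E₂^{2,0}`. -/

section SecondDifferential

variable {S : Scheme.{u}} {Z : Over S} {W : Type (u + 1)} [Group W] {ρ : W →* Aut Z}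

open DoubleCochain

lemma d_one_apply (A : Rep.{u + 1} IntRing.{u} W) (c : (Fin 1 → W) → A) (g : Fin 2 → W) :
    inhomogeneousCochains.d A 1 c g =
      A.ρ (g 0) (c fun _ => g 1) - c (fun _ => g 0 * g 1) + c (fun _ => g 0) := by
  have h0 : Fin.contractNth 0 (· * ·) g = fun _ => g 0 * g 1 := by
    funext i
    rw [Subsingleton.elim i 0]
    rfl
  have h1 : Fin.contractNth 1 (· * ·) g = fun _ => g 0 := by
    funext i
    rw [Subsingleton.elim i 0]
    rfl
  have h2 : (fun i : Fin 1 => g i.succ) = fun _ => g 1 := by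
    funext i
    rw [Subsingleton.elim i 0]
    rfl
  rw [inhomogeneousCochains.d_hom_apply, Fin.sum_univ_two, h0, h1, h2]
  simp [sub_eq_add_neg, add_assoc]

/-- The second page uses cocycles on `Fin 2 → W` and factor sets use `cocycles₂` on `W × W`; this
compares the two, together with the change of coefficients. -/
lemma π_eq_map_H2π {M N : Rep.{u + 1} IntRing.{u} W} (φ : M ⟶ N)
    (f : groupCohomology.cocycles₂ M) (f' : groupCohomology.cocycles N 2)
    (h : ∀ g, groupCohomology.iCocycles N 2 f' g = φ (f (g 0, g 1))) :
    groupCohomology.π N 2 f' =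
      (groupCohomology.functor IntRing.{u} W 2).map φ (groupCohomology.H2π M f) := by
  refine Eq.trans (congrArg (groupCohomology.π N 2) ?_) (ConcreteCategory.congr_hom
    (groupCohomology.π_map (MonoidHom.id W) φ 2) ((groupCohomology.isoCocycles₂ M).inv f)).symm
  refine ModuleCohomology.iCycles_injective _ _ (funext fun g => (h g).trans ?_)
  have h1 := ConcreteCategory.congr_hom (HomologicalComplex.cyclesMap_i
    (groupCohomology.cochainsMap (MonoidHom.id W) φ) 2) ((groupCohomology.isoCocycles₂ M).inv f)
  have h2 := ConcreteCategory.congr_hom (groupCohomology.isoCocycles₂_inv_comp_iCocycles M) f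
  refine Eq.trans ?_ (congrFun h1 g).symm
  exact congrArg φ (congrFun h2 g).symm

namespace DoubleCochain

variable {K : CochainComplex (Rep.{u + 1} IntRing.{u} W) ℕ}

/-- The cochain of total degree one with components `b` and `a`. -/
def transgressionCochain (b : K.X 1) (a : W → K.X 0) : DoubleCochain K :=
  single K 0 1 (fun _ => b) + single K 1 0 (fun g => a (g 0))

lemma transgressionCochain_zero_one (b : K.X 1) (a : W → K.X 0) (g : Fin 0 → W) :
    transgressionCochain b a 0 1 g = b := by
  change single K 0 1 _ 0 1 g + single K 1 0 _ 0 1 g = _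
  rw [single_same, single_of_ne_left _ zero_ne_one]
  exact add_zero _

/-- In bidegree `(1,1)` the group coboundary of `b` and the vertical differential of `a` cancel,
because the latter carries the sign `(-1)^1`. In bidegree `(0,2)` the entry vanishes since `b` is
closed. -/
lemma D_transgressionCochain {b : K.X 1} {a : W → K.X 0} (hb : K.d 1 2 b = 0)
    (ha : ∀ w, K.d 0 1 (a w) = (K.X 1).ρ w b - b) :
    D K (transgressionCochain b a) =
      single K 2 0 (inhomogeneousCochains.d (K.X 0) 1 fun g => a (g 0)) := by
  have h1 : inhomogeneousCochains.d (K.X 1) 0 (fun _ => b) = fun g => K.d 0 1 (a (g 0)) := by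
    funext g
    rw [d_zero_apply, ha]
  have h2 : (fun _ : Fin 0 → W => K.d 1 2 b) = 0 := funext fun _ => hb
  rw [transgressionCochain, map_add, D_single, D_single, h1, h2, smul_zero, pow_one]
  simp only [single, neg_smul, one_smul, Pi.single_neg, Pi.single_zero, add_zero]
  abel

lemma transgressionCochain_mem {b : K.X 1} {a : W → K.X 0} (hb : K.d 1 2 b = 0)
    (ha : ∀ w, K.d 0 1 (a w) = (K.X 1).ρ w b - b) :
    transgressionCochain b a ∈ pageCycles K 2 (0 : ℕ) ((0 : ℕ) + (1 : ℕ)) := by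
  refine mem_pageCycles_iff.2 ⟨add_mem (single_mem_degree _ (by simp))
    (single_mem_degree _ (by simp)), add_mem (single_mem_filtration _ (by simp))
      (single_mem_filtration _ (by simp)), ?_⟩
  rw [D_transgressionCochain hb ha]
  exact single_mem_filtration _ (by simp)

lemma D_transgressionCochain_apply {b : K.X 1} {a : W → K.X 0} (hb : K.d 1 2 b = 0)
    (ha : ∀ w, K.d 0 1 (a w) = (K.X 1).ρ w b - b) (g : Fin 2 → W) :
    D K (transgressionCochain b a) 2 0 g =
      (K.X 0).ρ (g 0) (a (g 1)) - a (g 0 * g 1) + a (g 0) := by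
  rw [D_transgressionCochain hb ha, single_same, d_one_apply]

end DoubleCochain

section

variable {A : Sheaf (QuotSite.topology ρ) Ab.{u + 1}} {I : InjectiveResolution A}

lemma H0Iso_secondPage {q : ℕ} (z : pageCycles (sectionsComplex I) 2 (0 : ℕ) ((0 : ℕ) + (q : ℕ)))
    {h : ((globalSections ρ).rightDerived q).obj A}
    (H : IsDerivedClass (globalSections ρ) I q (z.1 0 q default) h) :
    ((groupCohomology.H0Iso _).hom (secondPage I 0 q (QuotientAddGroup.mk z))).1 = h := by
  obtain ⟨f, hf, he⟩ := isSecondPageIso_secondPage I 0 q z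
  rw [he]
  refine Eq.trans ?_ ((hf default).unique H)
  refine (congrArg Subtype.val (ConcreteCategory.congr_hom (groupCohomology.π_comp_H0Iso_hom _) f)).trans ?_
  exact ConcreteCategory.congr_hom (groupCohomology.cocyclesIso₀_hom_comp_f _) f

end

variable {T : CommGrp (Over S)} {σ : W →* Aut T} {I : InjectiveResolution (coeffSheaf ρ σ)}

lemma isDerivedClass_pointsToH0 (t : pointsRep σ) :
    IsDerivedClass (globalSections ρ) I 0 (pointsToResolution I t) (pointsToH0 ρ σ t) :=
  IsDerivedClass.toRightDerivedZero I (constantSection ρ σ t)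

lemma secondPage_points (z : pageCycles (sectionsComplex I) 2 (2 : ℕ) ((2 : ℕ) + (0 : ℕ)))
    (f : groupCohomology.cocycles₂ (pointsRep σ))
    (hz : ∀ g, z.1 2 0 g = pointsToResolution I (f (g 0, g 1))) :
    secondPage I 2 0 (QuotientAddGroup.mk z) =
      (groupCohomology.functor IntRing.{u} W 2).map (pointsToH0 ρ σ)
        (groupCohomology.H2π (pointsRep σ) f) := by
  obtain ⟨f', hf', he⟩ := isSecondPageIso_secondPage I 2 0 z
  refine he.trans (π_eq_map_H2π (pointsToH0 ρ σ) f f' fun g => (hf' g).unique ?_)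
  rw [hz]
  exact isDerivedClass_pointsToH0 _

/-- The second differential sends the class of an invariant bundle to that of the factor sets of
its Mumford group. -/
lemma secondPage_differential {E : Bundle (coeffSheaf ρ σ)}
    (hE : Bundle.cl E ∈
      (((globalSections ρ).rightDerived 1).obj (coeffSheaf ρ σ)).ρ.invariants)
    {s : W → Mumford E} {f : groupCohomology.cocycles₂ (pointsRep σ)}
    (hs : ∀ w, Mumford.proj E (s w) = w)
    (hf : ∀ w v, s w * s v =
      Mumford.pointsInl E (Multiplicative.ofAdd (f (w, v))) * s (w * v)) :
    secondPage I 2 0 (differential (sectionsComplex I) 2 (by norm_num) (by norm_num)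
      ((secondPage I 0 1).symm ((groupCohomology.H0Iso _).inv ⟨Bundle.cl E, hE⟩))) =
        (groupCohomology.functor IntRing.{u} W 2).map (pointsToH0 ρ σ)
          (groupCohomology.H2π (pointsRep σ) f) := by
  obtain ⟨τ⟩ := Bundle.nonempty_trivialization I E
  let b : (sectionsComplex I).X 1 := τ.baseSection
  let a : W → (sectionsComplex I).X 0 := fun w => τ.cochain (s w)
  have hb : (sectionsComplex I).d 1 2 b = 0 := τ.d_base
  have ha : ∀ w, (sectionsComplex I).d 0 1 (a w) = ((sectionsComplex I).X 1).ρ w b - b :=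
    fun w => (τ.d_cochain (s w)).trans (by rw [show (s w).weight = w from hs w]; rfl)
  -- The representative of the class of `E` on the second page: the base section corrected by the
  -- cochains of `s`, with differential `w b - b` by `d_cochain`. Its total differential is the
  -- image of the factor set.
  let z : pageCycles (sectionsComplex I) 2 (0 : ℕ) ((0 : ℕ) + (1 : ℕ)) :=
    ⟨_, transgressionCochain_mem hb ha⟩
  have hz : z.1 0 1 default = τ.base := transgressionCochain_zero_one _ _ _
  have h1 : (secondPage I 0 1).symm ((groupCohomology.H0Iso _).inv
      ⟨Bundle.cl E, hE⟩) = QuotientAddGroup.mk z := by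
    rw [AddEquiv.symm_apply_eq]
    have h2 : (groupCohomology.H0Iso _).hom (secondPage I 0 1 (QuotientAddGroup.mk z)) =
        ⟨Bundle.cl E, hE⟩ :=
      Subtype.ext (H0Iso_secondPage z (by rw [hz]; exact τ.isDerivedClass_cl))
    rw [← h2]
    exact ConcreteCategory.congr_hom (groupCohomology.H0Iso _).hom_inv_id _
  rw [h1]
  refine secondPage_points ⟨D _ z.1, _⟩ f fun g => ?_
  exact (D_transgressionCochain_apply hb ha g).trans
    (pointsToResolution_factorSet τ hs (hf _ _)).symm

end SecondDifferential

/-! ### Sections of `T` over `Z` are constant. -/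

section ConstantSections

lemma locallyQuasiFinite_of_etale {X Y : Scheme.{u}} (f : X ⟶ Y) [Etale f] :
    LocallyQuasiFinite f := by
  refine (HasRingHomProperty.iff_appLE (P := @LocallyQuasiFinite)).2 fun U V e => ?_
  have h1 : (f.appLE U V e).hom.FormallyUnramified :=
    (HasRingHomProperty.iff_appLE (P := @FormallyUnramified)).1 inferInstance U V e
  have h2 : (f.appLE U V e).hom.FiniteType :=
    (HasRingHomProperty.iff_appLE (P := @LocallyOfFiniteType)).1 inferInstance U V e
  algebraize [(f.appLE U V e).hom]
  exact (inferInstance : Algebra.QuasiFinite Γ(Y, U) Γ(X, V))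

variable {k : Type u} [Field k]

/-- A scheme that is locally quasi-finite over a field is locally Artinian, hence discrete. -/
lemma discreteTopology_of_etale {Y : Scheme.{u}} (f : Y ⟶ Spec (.of k)) [Etale f] :
    DiscreteTopology Y := by
  have := locallyQuasiFinite_of_etale f
  have := IsLocallyArtinian.of_locallyQuasiFinite (f := f)
  infer_instance

/-- The global functions on a proper integral scheme over an algebraically closed field are
constant. -/
lemma isIso_appTop [IsAlgClosed k] {X : Scheme.{u}} [IsIntegral X] (f : X ⟶ Spec (.of k))
    [IsProper f] : IsIso f.appTop := by
  let F := (Scheme.ΓSpecIso (.of k)).inv ≫ f.appTop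
  -- Universal closedness makes the global functions integral over `k`. They form a domain, and `k`
  -- is algebraically closed, so they are `k`.
  have hF : F.hom.IsIntegral := by
    apply RingHom.isIntegral_respectsIso.2
      (e := (Scheme.ΓSpecIso _).symm.commRingCatIsoToRingEquiv)
    exact isIntegral_appTop_of_universallyClosed f
  have h : IsIso F := (ConcreteCategory.isIso_iff_bijective F).2
    (IsAlgClosed.ringHom_bijective_of_isIntegral (k := k) F.hom hF)
  exact IsIso.of_isIso_comp_left (Scheme.ΓSpecIso (.of k)).inv f.appTop

/-- A morphism to an affine scheme factors through a morphism to an affine scheme with the same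
global functions. -/
lemma exists_factor_of_isAffine {X B Y : Scheme.{u}} [IsAffine B] [IsAffine Y] (f : X ⟶ B)
    [IsIso f.appTop] (g : X ⟶ Y) : ∃ h : B ⟶ Y, f ≫ h = g := by
  refine ⟨B.toSpecΓ ≫ inv (Spec.map f.appTop) ≫ Spec.map g.appTop ≫ inv Y.toSpecΓ, ?_⟩
  rw [← Category.assoc, Scheme.toSpecΓ_naturality, Category.assoc, IsIso.hom_inv_id_assoc,
    ← Category.assoc, ← Scheme.toSpecΓ_naturality, Category.assoc, IsIso.hom_inv_id,
    Category.comp_id]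

/-- If `Y` is discrete, the image of the irreducible `X` is one point, so `g` lands in an affine
open subscheme and the affine case applies. -/
lemma exists_factor {X B Y : Scheme.{u}} [IsAffine B] [IsIntegral X] (f : X ⟶ B)
    [IsIso f.appTop] (hY : IsAffine Y ∨ DiscreteTopology Y) (g : X ⟶ Y) :
    ∃ h : B ⟶ Y, f ≫ h = g := by
  rcases hY with hY | hY
  · exact exists_factor_of_isAffine f g
  · have x : X := Nonempty.some inferInstance
    obtain ⟨U, hU, hxU, -⟩ :=
      exists_isAffineOpen_mem_and_subset (TopologicalSpace.Opens.mem_top (g x))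
    have hs : (Set.range g).Subsingleton := by
      rw [← Set.image_univ]
      exact ((PreirreducibleSpace.isPreirreducible_univ (X := X)).image g
        g.continuous.continuousOn).subsingleton
    have hr : Set.range g ⊆ Set.range U.ι := by
      rintro _ ⟨y, rfl⟩
      rw [hs ⟨y, rfl⟩ ⟨x, rfl⟩]
      simpa using hxU
    have : IsAffine U := hU
    obtain ⟨h, hh⟩ := exists_factor_of_isAffine f (IsOpenImmersion.lift U.ι g hr)
    exact ⟨h ≫ U.ι, by rw [← Category.assoc, hh, IsOpenImmersion.lift_fac]⟩

lemma epi_of_nonempty {X : Scheme.{u}} [Nonempty X] (f : X ⟶ Spec (.of k)) : Epi f := by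
  have : Surjective f := ⟨fun y => ⟨Nonempty.some inferInstance, Subsingleton.elim _ _⟩⟩
  exact Flat.epi_of_flat_of_surjective f

/-- On a proper integral scheme over an algebraically closed field, the sections of a group scheme
that is affine or étale are constant. -/
lemma constant_bijective [IsAlgClosed k] {W : Type (u + 1)} [Group W]
    {Z : Over (Spec (.of k))} [IsIntegral Z.left] [IsProper Z.hom] (ρ : W →* Aut Z)
    {T : CommGrp (Over (Spec (.of k)))} (hT : IsAffine T.X.left ∨ Etale T.X.hom)
    (σ : W →* Aut T) : Function.Bijective (constant ρ σ) := by
  have hepi := epi_of_nonempty Z.hom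
  have := isIso_appTop Z.hom
  have hT' : IsAffine T.X.left ∨ DiscreteTopology T.X.left :=
    hT.imp_right fun h => @discreteTopology_of_etale k _ T.X.left T.X.hom h
  have hleft (t : ULift.{u + 1} (Additive (Over.mk (𝟙 (Spec (.of k))) ⟶ T.X))) :
      (constant ρ σ t).down.toMul.left = Z.hom ≫ t.down.toMul.left := by
    change (𝟙 _ ≫ Z.hom) ≫ _ = _
    rw [Category.id_comp]
  refine ⟨fun s t h => ?_, fun x => ?_⟩
  · apply ULift.ext
    refine Over.OverMorphism.ext ((cancel_epi Z.hom).1 ?_)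
    exact (hleft s).symm.trans
      ((congrArg (fun q => (ULift.down q).toMul.left) h).trans (hleft t))
  · obtain ⟨h, hh⟩ := exists_factor Z.hom hT' x.down.toMul.left
    -- The factorization was found among morphisms of schemes; it lies over the base because `Z.hom`
    -- is an epimorphism.
    have hw : h ≫ T.X.hom = 𝟙 _ := by
      rw [← cancel_epi Z.hom, ← Category.assoc]
      refine (congrArg (· ≫ T.X.hom) hh).trans ((Over.w x.down.toMul).trans ?_)
      exact (Category.id_comp _).trans (Category.comp_id _).symm
    refine ⟨⟨Additive.ofMul (Over.homMk h hw)⟩, ?_⟩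
    apply ULift.ext
    refine Over.OverMorphism.ext ?_
    exact (hleft _).trans hh

end ConstantSections

/-! ### The comparison `T(k) → H⁰(Z, T)` and the homomorphism `c`. -/

section PointsToH0

variable {S : Scheme.{u}} {Z : Over S} {W : Type (u + 1)} [Group W] {ρ : W →* Aut Z}
  {T : CommGrp (Over S)} {σ : W →* Aut T}

lemma pointsToH0_bijective (hc : Function.Bijective (constant ρ σ)) :
    Function.Bijective (pointsToH0 ρ σ) := by
  let I := injectiveResolution (coeffSheaf ρ σ)
  refine ⟨(injective_iff_map_eq_zero (pointsToH0 ρ σ).hom).2 fun t ht => ?_, fun h => ?_⟩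
  · obtain ⟨b, hb⟩ := ((isDerivedClass_pointsToH0 (I := I) t).zero_iff (i := 0) (by simp)).1 ht
    rw [(sectionsComplex I).shape 0 0 (by simp)] at hb
    exact pointsToResolution_injective (I := I) hc
      (hb.symm.trans (map_zero (pointsToResolution I).hom).symm)
  · obtain ⟨a, ha⟩ := IsDerivedClass.exists_cocycle I 0 h
    obtain ⟨t, rfl⟩ := exists_aug I (QuotSite.top ρ) ha.d_eq_zero
    obtain ⟨t, rfl⟩ := hc.2 t
    exact ⟨t, (isDerivedClass_pointsToH0 (I := I) t).unique ha⟩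

lemma functor_map_pointsToH0_bijective (hc : Function.Bijective (constant ρ σ)) (n : ℕ) :
    Function.Bijective ((groupCohomology.functor IntRing.{u} W n).map (pointsToH0 ρ σ)) := by
  have h := pointsToH0_bijective hc
  have : Mono (pointsToH0 ρ σ) := (Rep.mono_iff_injective _).2 h.1
  have : Epi (pointsToH0 ρ σ) := (Rep.epi_iff_surjective _).2 h.2
  have : IsIso (pointsToH0 ρ σ) := isIso_of_mono_of_epi _
  exact (ConcreteCategory.isIso_iff_bijective _).1 inferInstance

/-- The homomorphism from the invariant classes to the second cohomology of the points, read off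
from the second differential of the spectral sequence. -/
def extensionClass (hc : Function.Bijective (constant ρ σ)) :
    (((globalSections ρ).rightDerived 1).obj (coeffSheaf ρ σ)).ρ.invariants →+
      groupCohomology (pointsRep σ) 2 :=
  let I := injectiveResolution (coeffSheaf ρ σ)
  let φ := LinearEquiv.ofBijective
    ((groupCohomology.functor IntRing.{u} W 2).map (pointsToH0 ρ σ)).hom
    (functor_map_pointsToH0_bijective hc 2)
  φ.symm.toAddEquiv.toAddMonoidHom.comp <| (secondPage I 2 0).toAddMonoidHom.comp <|
    (DoubleCochain.differential (sectionsComplex I) 2 (by norm_num) (by norm_num)).comp <|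
      (secondPage I 0 1).symm.toAddMonoidHom.comp
        (groupCohomology.H0Iso _).inv.hom.toAddMonoidHom

/-- The left side does not involve `s` and `f`, so the class of the factor set is independent of the
section chosen, and it depends on `E` only through its class. -/
lemma extensionClass_cl (hc : Function.Bijective (constant ρ σ)) {E : Bundle (coeffSheaf ρ σ)}
    (hE : Bundle.cl E ∈
      (((globalSections ρ).rightDerived 1).obj (coeffSheaf ρ σ)).ρ.invariants)
    {s : W → Mumford E} {f : groupCohomology.cocycles₂ (pointsRep σ)}
    (hs : ∀ w, Mumford.proj E (s w) = w)
    (hf : ∀ w v, s w * s v =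
      Mumford.pointsInl E (Multiplicative.ofAdd (f (w, v))) * s (w * v)) :
    extensionClass hc ⟨Bundle.cl E, hE⟩ = groupCohomology.H2π (pointsRep σ) f :=
  (LinearEquiv.symm_apply_eq _).2 (secondPage_differential hE hs hf)

end PointsToH0

end EquivariantCurve

end

/-! ### The main theorem. -/

theorem mainTheorem2 {k : Type u} [Field k] [IsAlgClosed k]
    {W : Type (u + 1)} [Group W] [Finite W]
    {X Z : Over (Spec (.of k))}
    (hX : IsSmoothProjectiveCurve X) (hZ : IsSmoothProjectiveCurve Z)
    (π : Z ⟶ X) (ρ : W →* Aut Z) (hπ : IsEtaleGaloisCover π ρ)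
    (T : CommGrp (Over (Spec (.of k)))) (hT : IsAffine T.X.left ∨ Etale T.X.hom)
    (σ : W →* Aut T) :
    ∃ cl : Bundle (coeffSheaf ρ σ) → ((globalSections ρ).rightDerived 1).obj (coeffSheaf ρ σ),
      (∀ (I : InjectiveResolution (coeffSheaf ρ σ)) (E : Bundle (coeffSheaf ρ σ)),
        IsBundleClass I E (cl E)) ∧
      (∀ E E' : Bundle (coeffSheaf ρ σ), cl E = cl E' ↔ Nonempty (E.Iso E')) ∧
      Function.Surjective cl ∧
      (∀ E₁ E₂ E : Bundle (coeffSheaf ρ σ), E₁.IsContractedProduct E₂ E →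
        cl E = cl E₁ + cl E₂) ∧
      (∀ (w : W) (E : Bundle (coeffSheaf ρ σ)), cl (E.twist w) =
        (((globalSections ρ).rightDerived 1).obj (coeffSheaf ρ σ)).ρ w (cl E)) ∧
      (∀ E : Bundle (coeffSheaf ρ σ), E.IsInvariant →
        IsExtension (pointsRep σ) (Mumford.pointsInl E) (Mumford.proj E)) ∧
      ∃ c : (((globalSections ρ).rightDerived 1).obj (coeffSheaf ρ σ)).ρ.invariants →+
          groupCohomology (pointsRep σ) 2,
        (∀ E : Bundle (coeffSheaf ρ σ), E.IsInvariant → ∃ h : cl E ∈ _,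
          IsExtensionClass (pointsRep σ) (Mumford.pointsInl E) (Mumford.proj E) (c ⟨cl E, h⟩)) ∧
        Function.Bijective ((groupCohomology.functor IntRing.{u} W 2).map (pointsToH0 ρ σ)) ∧
        ∀ I : InjectiveResolution (coeffSheaf ρ σ),
          (∃ e : ∀ p q : ℕ, DoubleCochain.Page (sectionsComplex I) 2 p (p + q) ≃+
              groupCohomology (((globalSections ρ).rightDerived q).obj (coeffSheaf ρ σ)) p,
            (∀ p q : ℕ, IsSecondPageIso I p q (e p q)) ∧
            ∀ x, (groupCohomology.functor IntRing.{u} W 2).map (pointsToH0 ρ σ) (c x) =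
              e 2 0 (DoubleCochain.differential (sectionsComplex I) 2 (by norm_num) (by norm_num)
                ((e 0 1).symm ((groupCohomology.H0Iso _).inv x)))) ∧
          ∀ n : ℕ, ∃ a, IsAbutmentIso I n a := by
  have := hZ.isIntegral
  have := hZ.isProper
  have hc : Function.Bijective (constant ρ σ) := constant_bijective ρ hT σ
  refine ⟨Bundle.cl, Bundle.isBundleClass_cl, Bundle.cl_eq_cl_iff, Bundle.cl_surjective,
    fun _ _ _ => Bundle.cl_contractedProduct, Bundle.cl_twist, fun _ => isExtension_mumford hc,
    extensionClass hc, fun E hE => ?_, functor_map_pointsToH0_bijective hc 2, fun I =>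
      ⟨⟨secondPage I, isSecondPageIso_secondPage I, ?_⟩, exists_isAbutmentIso I⟩⟩
  · obtain ⟨s, f, hs, hf⟩ := exists_factorSet hc hE
    exact ⟨(Bundle.isInvariant_iff_cl E).1 hE, s, f, hs, hf, extensionClass_cl hc _ hs hf⟩
  -- The map `c` was built with one fixed resolution, while `I` is arbitrary. Every invariant class
  -- is that of an invariant bundle, and for it the map `c` and the differential for `I` are both
  -- computed by the same factor set.
  · rintro ⟨x, hx⟩
    obtain ⟨E, rfl⟩ := Bundle.cl_surjective x
    obtain ⟨s, f, hs, hf⟩ := exists_factorSet hc ((Bundle.isInvariant_iff_cl E).2 hx)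
    rw [extensionClass_cl hc hx hs hf]
    exact (secondPage_differential hx hs hf).symm
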